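/- Let $\mathbb K\in\{\mathbb R,\mathbb C\}$, let $\Lambda$ be a set, and let $(A_\lambda:X_\lambda\to Y_\lambda)_{\lambda\in\Lambda}$ be bounded linear operators between Banach spaces over $\mathbb K$ with $\sup_\lambda\|A_\lambda\|<\infty$. **Direct sums.** For $p\in\{0\}\cup[1,\infty]$ let $E_p=(\oplus_\lambda X_\lambda)_{\ell_p(\Lambda)}$ and $F_p=(\oplus_\lambda Y_\lambda)_{\ell_p(\Lambda)}$, where $\ell_0(\Lambda)$ means $c_0(\Lambda)$. Let $p,r\in\{0\}\cup[1,\infty]$ satisfy either $r=0$ and $p<\infty$, or $1\le p\le r\le\infty$, $1<r$ and $p<\infty$. For $\Upsilon\subset\Lambda$ let $D^{p,r}_\Upsilon:E_p\to F_r$, $(x_\lambda)_\lambda\mapsto(1_\Upsilon(\lambda)A_\lambda x_\lambda)_\lambda$. **Szlenk index.** For a Banach space $X$, a weak$^*$-compact $K\subset X^*$ and $\varepsilon>0$, let $s_\varepsilon(K)$ be the set of $x^*\in K$ with $\operatorname{diam}(V\cap K)>\varepsilon$ for every weak$^*$-neighbourhood $V$ of $x^*$; put $s^0_\varepsilon(K)=K$,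 $s^{\xi+1}_\varepsilon(K)=s_\varepsilon(s^\xi_\varepsilon(K))$, and take intersections at limit ordinals. $Sz(K,\varepsilon)$ is the least $\xi$ with $s^\xi_\varepsilon(K)=\varnothing$ ($\infty$ if there is none), $Sz(K)=\sup_{\varepsilon>0}Sz(K,\varepsilon)$, and $Sz(A)=Sz(A^*B_{Y^*})$ for an operator $A:X\to Y$. **Trees.** Finite sequences are ordered by "is an initial segment of", and $MAX(T)$ is the set of maximal elements of $T$. Write $\zeta+(\zeta_i)_i=(\zeta+\zeta_i)_i$. Let $\Gamma_{0,1}=\{(0)\}$ with weight $\mathbb P_{0,1}=1$. Given $\Gamma_{\xi,1}$ and $\mathbb P_{\xi,1}$, for $1\le i\le n$ let $\Lambda_{\xi,n,i}$ be the set of all concatenations $t=(\omega^\xi(n-1)+t_1)\smallfrown\cdots\smallfrown(\omega^\xi(n-i)+t_i)$ with $t_1,\dots,t_i\in\Gamma_{\xi,1}$ and $t_1,\dots,t_{i-1}\in MAX(\Gamma_{\xi,1})$, let $\mathbb P_{\xi,n}(t)=\mathbb P_{\xi,1}(t_i)$ for such $t$, and let $\Gamma_{\xi,n}=\bigcup_{i=1}^n\Lambda_{\xi,n,i}$.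 Let $\Gamma_{\xi+1,1}=\bigcup_{n\ge1}\Gamma_{\xi,n}$ with $\mathbb P_{\xi+1,1}=\frac1n\mathbb P_{\xi,n}$ on $\Gamma_{\xi,n}$. For a limit ordinal $\xi$ let $\Gamma_{\xi,1}=\bigcup_{\zeta<\xi}(\omega^\zeta+\Gamma_{\zeta+1,1})$ with $\mathbb P_{\xi,1}(\omega^\zeta+t)=\mathbb P_{\zeta+1,1}(t)$. For a directed set $D$ let $\Gamma_{\xi,n}.D$ (and likewise $\Lambda_{\xi,n,i}.D$) be the set of sequences $(\zeta_j,u_j)_{j=1}^k$ with $(\zeta_j)_{j=1}^k\in\Gamma_{\xi,n}$ and $u_j\in D$; weights are computed from the first coordinates. A collection $(x_t)_{t\in\Gamma_{\xi,n}.D}$ in $X$ is weakly null if for every $s\in\{\varnothing\}\cup\Gamma_{\xi,n}.D$ and every ordinal $\zeta$ such that the sequences $s\smallfrown(\zeta,u)$, $u\in D$, lie in $\Gamma_{\xi,n}.D$, the net $(x_{s\smallfrown(\zeta,u)})_{u\in D}$ is weakly null. For $t\in MAX(\Gamma_{\xi,n}.D)$ let $z^t_i=\sum\{\mathbb P_{\xi,n}(s)x_s: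 s\le t,\ s\in\Lambda_{\xi,n,i}.D\}$. **The quantities $\alpha$ and $\theta$.** Let $r_K(x)=\max_{x^*\in K}\operatorname{Re}x^*(x)$ (and $r_\varnothing=0$). For $1\le\gamma\le\infty$ and $n\ge1$, $\alpha_{\xi,\gamma,n}(K)$ is the infimum of the $\alpha>0$ such that $$\inf_{t\in MAX(\Gamma_{\xi,n}.D)}r_K\Bigl(\sum_{i=1}^na_iz^t_i\Bigr)\le\alpha\|(a_i)_{i=1}^n\|_{\ell_\gamma^n}$$ for all (non-empty) directed sets $D$, all $(a_i)_{i=1}^n\in\mathbb K^n$ and all weakly null $(x_t)_{t\in\Gamma_{\xi,n}.D}\subset B_X$; $\alpha_{\xi,\gamma}(K)=\sup_n\alpha_{\xi,\gamma,n}(K)\in[0,\infty]$. $\theta_{\xi,n}(K)$ is the infimum of the $\theta>0$ such that $\inf_{t\in MAX(\Gamma_{\xi,n}.D)}r_K(\sum_{i=1}^n\frac1nz^t_i)\le\theta$ for all such $D$ and $(x_t)$. For an operator $A:X\to Y$, $\alpha_{\xi,\gamma}(A)=\alpha_{\xi,\gamma}(A^*B_{Y^*})$ and $\theta_{\xi,n}(A)=\theta_{\xi,n}(A^*B_{Y^*})$.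 A family in $[0,\infty]$ belongs to $\ell_s(\Lambda)$ if all its members are finite and the resulting real family is in $\ell_s(\Lambda)$. **Theorem.** Let $1\le\gamma\le\infty$ and let $\xi,\zeta$ be ordinals with $Sz(D^{p,r}_\Lambda)=\omega^{\xi+1}$ and $\sup_{\lambda\in\Lambda}Sz(A_\lambda)=\omega^\zeta$. If $\zeta=\xi$, then $\alpha_{\xi,\gamma}(D^{p,r}_\Lambda)<\infty$ if and only if either $r=0$ or $1\le\gamma\le r$. If $\zeta=\xi+1$, then $\alpha_{\xi,\gamma}(D^{p,r}_\Lambda)<\infty$ if and only if one of the following holds: (i) $r=0$ and $(\alpha_{\xi,\gamma}(A_\lambda))_{\lambda\in\Lambda}\in\ell_\infty(\Lambda)$; (ii) $1\le\gamma\le r\le\infty$ and $(\alpha_{\xi,\gamma}(A_\lambda))_{\lambda\in\Lambda}\in\ell_\infty(\Lambda)$; (iii) $1\le r<\gamma\le\infty$, $\inf\{\theta_{\xi,1}(D^{p,r}_{\Lambda\setminus\Upsilon}):\Upsilon\subset\Lambda\text{ finite}\}=0$, and $(\alpha_{\xi,\gamma}(A_\lambda))_{\lambda\in\Lambda}\in\ell_s(\Lambda)$,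 where $1/\gamma+1/s=1/r$. -/

import Mathlib

open Filter Topology Ordinal
open scoped ENNReal

universe u

namespace SzlenkSums

/-! ### The trees `Γ_{ξ,n}`, their levels and their weights

A tree is a set of non-empty finite sequences, ordered by "is an initial segment of". -/

/-- The sequence `δ + t`, for a sequence `t` of ordinals. -/
def shift (δ : Ordinal.{u}) (t : List Ordinal.{u}) : List Ordinal.{u} :=
  t.map (fun a => δ + a)

/-- `MAX(T)`: the members of `T` that are maximal for the initial segment order. -/
def maxs {β : Type*} (T : Set (List β)) : Set (List β) :=
  {t | t ∈ T ∧ ∀ s ∈ T, t <+: s → s = t}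

/-- Given `G = Γ_{ξ,1}` and `δ = ω ^ ξ`, the level `Λ_{ξ,n,i}`: all concatenations
`(δ (n-1) + t₁) ⌢ ⋯ ⌢ (δ (n-i) + tᵢ)` with `t₁, …, tᵢ ∈ G` and `t₁, …, tᵢ₋₁ ∈ MAX(G)`.
(The sequence `t_{j+1}` is `v j`.) -/
def block (δ : Ordinal.{u}) (G : Set (List Ordinal.{u})) (n i : ℕ) : Set (List Ordinal.{u}) :=
  {t | ∃ v : ℕ → List Ordinal.{u}, (∀ j < i, v j ∈ G) ∧ (∀ j, j + 1 < i → v j ∈ maxs G) ∧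
    t = (List.range i).flatMap (fun j => shift (δ * ((n - (j + 1) : ℕ) : Ordinal.{u})) (v j))}

/-- The union `⋃_{1 ≤ i ≤ n} Λ_{ξ,n,i}` of the levels. -/
def blocks (δ : Ordinal.{u}) (G : Set (List Ordinal.{u})) (n : ℕ) : Set (List Ordinal.{u}) :=
  {t | ∃ i, 1 ≤ i ∧ i ≤ n ∧ t ∈ block δ G n i}

/-- The tree `Γ_{ξ,1}`. -/
noncomputable def gammaOne (ξ : Ordinal.{u}) : Set (List Ordinal.{u}) :=
  Ordinal.limitRecOn ξ {[0]}
    (fun ζ G => {t | ∃ n : ℕ, 1 ≤ n ∧ t ∈ blocks (ω ^ ζ) G n})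
    (fun ξ hξ IH => {t | ∃ (ζ : Ordinal.{u}) (h : ζ < ξ),
      ∃ s ∈ IH (ζ + 1) (hξ.add_one_lt h), t = shift (ω ^ ζ) s})

/-- The tree `Γ_{ξ,n}`, for `n ≥ 1`. -/
noncomputable def gamma (ξ : Ordinal.{u}) (n : ℕ) : Set (List Ordinal.{u}) :=
  blocks (ω ^ ξ) (gammaOne ξ) n

/-- The level `Λ_{ξ,n,i}` of `Γ_{ξ,n}`, for `1 ≤ i ≤ n`. -/
noncomputable def level (ξ : Ordinal.{u}) (n i : ℕ) : Set (List Ordinal.{u}) :=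
  block (ω ^ ξ) (gammaOne ξ) n i

/-- For `t = (δ (n-1) + t₁) ⌢ ⋯ ⌢ (δ (n-i) + tᵢ)` with all entries of the `tⱼ` below `δ`, this is
the sequence `tᵢ` (see `lastBlock_eq`). -/
noncomputable def lastBlock (δ : Ordinal.{u}) (t : List Ordinal.{u}) : List Ordinal.{u} :=
  (t.filter (fun a => decide (a / δ = t.getLastD 0 / δ))).map (fun a => a % δ)

/-- The weight `ℙ_{ξ,1}` on `Γ_{ξ,1}`. It is characterised by `weightOne_zero`, `weightOne_succ`
and `weightOne_limit` below. -/
noncomputable def weightOne (ξ : Ordinal.{u}) : List Ordinal.{u} → ℝ :=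
  Ordinal.limitRecOn ξ (fun _ => 1)
    (fun ζ w t => w (lastBlock (ω ^ ζ) t) /
      ((sInf {n : ℕ | t.headD 0 < ω ^ ζ * (n : Ordinal.{u})} : ℕ) : ℝ))
    (fun ξ _ IH t =>
      open Classical in
      if h : Ordinal.log ω (t.headD 0) + 1 < ξ then
        IH (Ordinal.log ω (t.headD 0) + 1) h
          (t.map (fun a => a - ω ^ Ordinal.log ω (t.headD 0)))
      else 0)

/-- The weight `ℙ_{ξ,n}` on `Γ_{ξ,n}`: its value at
`(ω ^ ξ (n-1) + t₁) ⌢ ⋯ ⌢ (ω ^ ξ (n-i) + tᵢ)` is `ℙ_{ξ,1}(tᵢ)` (see `weight_eq`). It does not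
depend on `n`. -/
noncomputable def weight (ξ : Ordinal.{u}) (t : List Ordinal.{u}) : ℝ :=
  weightOne ξ (lastBlock (ω ^ ξ) t)

section TreeFacts

theorem gammaOne_zero : gammaOne (0 : Ordinal.{u}) = {[0]} := by
  simp [gammaOne]

theorem gammaOne_succ (ζ : Ordinal.{u}) :
    gammaOne (ζ + 1) = {t | ∃ n : ℕ, 1 ≤ n ∧ t ∈ gamma ζ n} := by
  simp only [gammaOne, gamma, Ordinal.limitRecOn_add_one]

theorem gammaOne_limit {ξ : Ordinal.{u}} (hξ : Order.IsSuccLimit ξ) :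
    gammaOne ξ = {t | ∃ ζ < ξ, ∃ s ∈ gammaOne (ζ + 1), t = shift (ω ^ ζ) s} := by
  unfold gammaOne
  rw [Ordinal.limitRecOn_limit _ _ _ _ hξ]
  ext t
  simp

theorem block_bounds {δ : Ordinal.{u}} {G : Set (List Ordinal.{u})}
    (hG : ∀ t ∈ G, t ≠ [] ∧ ∀ a ∈ t, a < δ) {n i : ℕ} (hi : 1 ≤ i) (hin : i ≤ n)
    {t : List Ordinal.{u}} (ht : t ∈ block δ G n i) :
    t ≠ [] ∧ (∀ a ∈ t, a < δ * (n : Ordinal.{u})) ∧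
      δ * ((n - 1 : ℕ) : Ordinal.{u}) ≤ t.headD 0 := by
  obtain ⟨v, hv, -, rfl⟩ := ht
  obtain ⟨i, rfl⟩ : ∃ k, i = k + 1 := ⟨i - 1, by omega⟩
  have h0 := hG _ (hv 0 (by omega))
  obtain ⟨b, l, hbl⟩ := List.exists_cons_of_ne_nil h0.1
  refine ⟨?_, ?_, ?_⟩
  · simp [List.range_succ_eq_map, hbl, shift]
  · intro a ha
    simp only [List.mem_flatMap, List.mem_range, shift, List.mem_map] at ha
    obtain ⟨j, hj, b, hb, rfl⟩ := ha
    have hb' := (hG _ (hv j hj)).2 b hb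
    calc δ * ((n - (j + 1) : ℕ) : Ordinal.{u}) + b
        < δ * ((n - (j + 1) : ℕ) : Ordinal.{u}) + δ := by gcongr
      _ = δ * ((n - (j + 1) + 1 : ℕ) : Ordinal.{u}) := by push_cast; rw [mul_add, mul_one]
      _ ≤ δ * (n : Ordinal.{u}) := by
        gcongr
        exact_mod_cast (by omega : n - (j + 1) + 1 ≤ n)
  · simp [List.range_succ_eq_map, hbl, shift]

/-- `Γ_{ξ,1}` consists of non-empty sequences in `[0, ω ^ ξ)`. -/
theorem gammaOne_bounds (ξ : Ordinal.{u}) :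
    ∀ t ∈ gammaOne ξ, t ≠ [] ∧ ∀ a ∈ t, a < ω ^ ξ := by
  induction ξ using Ordinal.limitRecOn with
  | zero => simp [gammaOne_zero]
  | add_one ζ ih =>
    intro t ht
    rw [gammaOne_succ] at ht
    obtain ⟨n, hn, i, hi, hin, ht⟩ := ht
    have h := block_bounds ih hi hin ht
    refine ⟨h.1, fun a ha => (h.2.1 a ha).trans ?_⟩
    rw [opow_add, opow_one]
    exact mul_lt_mul_of_pos_left (natCast_lt_omega0 n) (opow_pos ζ omega0_pos)
  | limit ξ hξ ih =>
    intro t ht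
    rw [gammaOne_limit hξ] at ht
    obtain ⟨ζ, hζ, s, hs, rfl⟩ := ht
    have h := ih (ζ + 1) (hξ.add_one_lt hζ) s hs
    refine ⟨by simpa [shift] using h.1, ?_⟩
    intro a ha
    simp only [shift, List.mem_map] at ha
    obtain ⟨b, hb, rfl⟩ := ha
    have hb' := h.2 b hb
    have h1 : (ω : Ordinal.{u}) ^ ζ < ω ^ (ζ + 1) :=
      (opow_lt_opow_iff_right one_lt_omega0).2 (lt_add_one ζ)
    have h2 : (ω : Ordinal.{u}) ^ ζ + b < ω ^ (ζ + 1) :=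
      (isPrincipal_add_omega0_opow (ζ + 1)) h1 hb'
    exact h2.trans ((opow_lt_opow_iff_right one_lt_omega0).2 (hξ.add_one_lt hζ))

theorem lastBlock_eq {δ : Ordinal.{u}} (hδ : 0 < δ) {n i : ℕ} (hin : i + 1 ≤ n)
    (v : ℕ → List Ordinal.{u}) (hv : ∀ j ≤ i, ∀ a ∈ v j, a < δ) (hne : v i ≠ []) :
    lastBlock δ ((List.range (i + 1)).flatMap
      (fun j => shift (δ * ((n - (j + 1) : ℕ) : Ordinal.{u})) (v j))) = v i := by
  have hdiv : ∀ (k : ℕ) (a : Ordinal.{u}), a < δ → (δ * (k : Ordinal.{u}) + a) / δ = k := by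
    intro k a ha
    rw [Ordinal.mul_add_div _ hδ.ne', Ordinal.div_eq_zero_of_lt ha, add_zero]
  have hmod : ∀ (k : ℕ) (a : Ordinal.{u}), a < δ → (δ * (k : Ordinal.{u}) + a) % δ = a := by
    intro k a ha
    rw [Ordinal.mul_add_mod_self, Ordinal.mod_eq_of_lt ha]
  set T := (List.range (i + 1)).flatMap
      (fun j => shift (δ * ((n - (j + 1) : ℕ) : Ordinal.{u})) (v j)) with hT
  have hT' : T = (List.range i).flatMap
      (fun j => shift (δ * ((n - (j + 1) : ℕ) : Ordinal.{u})) (v j)) ++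
      shift (δ * ((n - (i + 1) : ℕ) : Ordinal.{u})) (v i) := by
    simp [hT, List.range_succ]
  have hlast : T.getLastD 0 / δ = ((n - (i + 1) : ℕ) : Ordinal.{u}) := by
    obtain ⟨l, b, hbl⟩ := (List.eq_nil_or_concat (v i)).resolve_left hne
    have hb : b < δ := hv i le_rfl b (by simp [hbl])
    have : T.getLastD 0 = δ * ((n - (i + 1) : ℕ) : Ordinal.{u}) + b := by
      rw [hT', hbl]
      simp [shift, List.getLastD_eq_getLast?]
    rw [this, hdiv _ _ hb]
  unfold lastBlock
  rw [hlast, hT', List.filter_append, List.map_append]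
  have h1 : ((List.range i).flatMap
      (fun j => shift (δ * ((n - (j + 1) : ℕ) : Ordinal.{u})) (v j))).filter
      (fun a => decide (a / δ = ((n - (i + 1) : ℕ) : Ordinal.{u}))) = [] := by
    rw [List.filter_eq_nil_iff]
    intro a ha
    simp only [List.mem_flatMap, List.mem_range, shift, List.mem_map] at ha
    obtain ⟨j, hj, b, hb, rfl⟩ := ha
    rw [hdiv _ _ (hv j hj.le b hb), decide_eq_true_eq, Nat.cast_inj]
    omega
  have h2 : (shift (δ * ((n - (i + 1) : ℕ) : Ordinal.{u})) (v i)).filter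
      (fun a => decide (a / δ = ((n - (i + 1) : ℕ) : Ordinal.{u}))) =
      shift (δ * ((n - (i + 1) : ℕ) : Ordinal.{u})) (v i) := by
    rw [List.filter_eq_self]
    intro a ha
    simp only [shift, List.mem_map] at ha
    obtain ⟨b, hb, rfl⟩ := ha
    rw [decide_eq_true_eq]
    exact hdiv _ _ (hv i le_rfl b hb)
  rw [h1, h2, List.map_nil, List.nil_append]
  simp only [shift, List.map_map]
  refine (List.map_congr_left fun a ha => ?_).trans (List.map_id _)
  exact hmod _ _ (hv i le_rfl a ha)

/-- `ℙ_{ξ,n}((ω ^ ξ (n-1) + t₁) ⌢ ⋯ ⌢ (ω ^ ξ (n-i) + tᵢ)) = ℙ_{ξ,1}(tᵢ)`. -/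
theorem weight_eq (ξ : Ordinal.{u}) {n i : ℕ} (hin : i + 1 ≤ n) (v : ℕ → List Ordinal.{u})
    (hv : ∀ j ≤ i, v j ∈ gammaOne ξ) :
    weight ξ ((List.range (i + 1)).flatMap
      (fun j => shift (ω ^ ξ * ((n - (j + 1) : ℕ) : Ordinal.{u})) (v j))) =
      weightOne ξ (v i) := by
  unfold weight
  rw [lastBlock_eq (opow_pos ξ omega0_pos) hin v
    (fun j hj => (gammaOne_bounds ξ _ (hv j hj)).2) (gammaOne_bounds ξ _ (hv i le_rfl)).1]

theorem weightOne_zero (t : List Ordinal.{u}) : weightOne 0 t = 1 := by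
  simp [weightOne]

/-- `ℙ_{ξ+1,1} = ℙ_{ξ,n} / n` on `Γ_{ξ,n}`. -/
theorem weightOne_succ (ξ : Ordinal.{u}) {n : ℕ} {t : List Ordinal.{u}}
    (ht : t ∈ gamma ξ n) : weightOne (ξ + 1) t = weight ξ t / n := by
  obtain ⟨i, hi, hin, ht⟩ := ht
  have h := block_bounds (gammaOne_bounds ξ) hi hin ht
  have hs : sInf {m : ℕ | t.headD 0 < ω ^ ξ * (m : Ordinal.{u})} = n := by
    apply le_antisymm
    · apply Nat.sInf_le
      obtain ⟨b, l, rfl⟩ := List.exists_cons_of_ne_nil h.1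
      exact h.2.1 _ (by simp)
    · apply le_csInf
      · obtain ⟨b, l, rfl⟩ := List.exists_cons_of_ne_nil h.1
        exact ⟨n, h.2.1 _ (by simp)⟩
      · intro m hm
        have h3 := lt_of_le_of_lt h.2.2 hm
        have h4 : ((n - 1 : ℕ) : Ordinal.{u}) < m := lt_of_mul_lt_mul_left' h3
        have h5 : n - 1 < m := by exact_mod_cast h4
        omega
  unfold weightOne
  rw [Ordinal.limitRecOn_add_one, hs]
  rfl

/-- `ℙ_{ξ,1}(ω ^ ζ + t) = ℙ_{ζ+1,1}(t)` for `ζ < ξ`, `ξ` a limit and `t ∈ Γ_{ζ+1,1}`. -/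
theorem weightOne_limit {ξ ζ : Ordinal.{u}} (hξ : Order.IsSuccLimit ξ) (hζ : ζ < ξ)
    {t : List Ordinal.{u}} (ht : t ∈ gammaOne (ζ + 1)) :
    weightOne ξ (shift (ω ^ ζ) t) = weightOne (ζ + 1) t := by
  have h := gammaOne_bounds _ t ht
  obtain ⟨b, l, rfl⟩ := List.exists_cons_of_ne_nil h.1
  have h1 : (ω : Ordinal.{u}) ^ ζ < ω ^ (ζ + 1) :=
    (opow_lt_opow_iff_right one_lt_omega0).2 (lt_add_one ζ)
  have h2 : (ω : Ordinal.{u}) ^ ζ + b < ω ^ (ζ + 1) :=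
    (isPrincipal_add_omega0_opow (ζ + 1)) h1 (h.2 b (by simp))
  have hlog : Ordinal.log ω ((shift (ω ^ ζ) (b :: l)).headD 0) = ζ := by
    have hne : (ω : Ordinal.{u}) ^ ζ + b ≠ 0 :=
      ((opow_pos ζ omega0_pos).trans_le le_self_add).ne'
    simp only [shift, List.map_cons, List.headD_cons]
    apply le_antisymm
    · have := (Ordinal.lt_opow_iff_log_lt one_lt_omega0 hne).1 h2
      exact Order.lt_add_one_iff.1 this
    · exact (Ordinal.opow_le_iff_le_log one_lt_omega0 hne).1 le_self_add
  have hsub : (shift (ω ^ ζ) (b :: l)).map (fun a => a - ω ^ ζ) = b :: l := by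
    simp [shift, Function.comp_def, Ordinal.add_sub_cancel]
  conv_lhs => unfold weightOne
  rw [Ordinal.limitRecOn_limit _ _ _ _ hξ]
  simp only [hlog]
  rw [dif_pos (hξ.add_one_lt hζ), hsub]
  rfl

end TreeFacts

/-- `T.D`: the sequences `(ζ_j, u_j)_j` with `(ζ_j)_j ∈ T` and `u_j ∈ D`. -/
def withIndex (T : Set (List Ordinal.{u})) (D : Type u) : Set (List (Ordinal.{u} × D)) :=
  {t | t.map Prod.fst ∈ T}

section Banach

variable {𝕜 : Type*} [RCLike 𝕜] {X : Type u} [NormedAddCommGroup X] [NormedSpace 𝕜 X]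

/-- `(x_t)_{t ∈ T.D} ⊆ B_X`. -/
def InBall (T : Set (List Ordinal.{u})) (D : Type u) (x : List (Ordinal.{u} × D) → X) : Prop :=
  ∀ t ∈ withIndex T D, ‖x t‖ ≤ 1

variable (𝕜) in
/-- `(x_t)_{t ∈ T.D}` is weakly null: for every `s ∈ {∅} ∪ T.D` and every ordinal `ζ` such that the
`s ⌢ (ζ, v)` lie in `T.D`, the net `(x_{s ⌢ (ζ, v)})_{v ∈ D}` converges weakly to zero. -/
def WeaklyNull (T : Set (List Ordinal.{u})) (D : Type u) [Preorder D]
    (x : List (Ordinal.{u} × D) → X) : Prop :=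
  ∀ (s : List (Ordinal.{u} × D)) (ζ : Ordinal.{u}), s.map Prod.fst ++ [ζ] ∈ T →
    ∀ f : StrongDual 𝕜 X, Tendsto (fun v : D => f (x (s ++ [(ζ, v)]))) atTop (𝓝 0)

/-- The vector `z^t_i = ∑ ℙ_{ξ,n}(s) x_s`, the sum over all initial segments `s` of `t` that lie
in `Λ_{ξ,n,i}.D`. -/
noncomputable def blockSum (ξ : Ordinal.{u}) (n i : ℕ) {D : Type u}
    (x : List (Ordinal.{u} × D) → X) (t : List (Ordinal.{u} × D)) : X :=
  open Classical in
  ∑ k ∈ (Finset.Icc 1 t.length).filter (fun k => t.take k ∈ withIndex (level ξ n i) D),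
    ((weight ξ ((t.take k).map Prod.fst) : ℝ) : 𝕜) • x (t.take k)

/-! ### The quantities `α_{ξ,γ,n}`, `α_{ξ,γ}` and `θ_{ξ,n}` -/

/-- `r_K(x) = max_{f ∈ K} Re f(x)`, and `r_∅ = 0`. -/
noncomputable def supportFn (K : Set (StrongDual 𝕜 X)) (x : X) : ℝ :=
  ⨆ f : K, RCLike.re (f.1 x)

/-- `inf_{t ∈ MAX(Γ_{ξ,n}.D)} r_K(∑_i a_i z^t_i)`. -/
noncomputable def treeInf (K : Set (StrongDual 𝕜 X)) (ξ : Ordinal.{u}) (n : ℕ) (a : Fin n → 𝕜)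
    {D : Type u} (x : List (Ordinal.{u} × D) → X) : ℝ :=
  ⨅ t : maxs (withIndex (gamma ξ n) D),
    supportFn K (∑ i : Fin n, a i • blockSum (𝕜 := 𝕜) ξ n (i + 1) x t.1)

/-- `α_{ξ,γ,n}(K)`, for `n ≥ 1` and `1 ≤ γ ≤ ∞`. -/
noncomputable def alphaN (K : Set (StrongDual 𝕜 X)) (ξ : Ordinal.{u}) (γ : ℝ≥0∞) (n : ℕ) : ℝ≥0∞ :=
  ⨅ (α : ℝ) (_ : 0 < α ∧
    ∀ (D : Type u) [Preorder D] [IsDirectedOrder D] [Nonempty D] (a : Fin n → 𝕜)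
      (x : List (Ordinal.{u} × D) → X),
      InBall (gamma ξ n) D x → WeaklyNull 𝕜 (gamma ξ n) D x →
        treeInf K ξ n a x ≤ α * ‖(WithLp.toLp γ a : PiLp γ (fun _ : Fin n => 𝕜))‖),
    ENNReal.ofReal α

/-- `α_{ξ,γ}(K) = sup_{n ≥ 1} α_{ξ,γ,n}(K)`. -/
noncomputable def alpha (K : Set (StrongDual 𝕜 X)) (ξ : Ordinal.{u}) (γ : ℝ≥0∞) : ℝ≥0∞ :=
  ⨆ (n : ℕ) (_ : 1 ≤ n), alphaN K ξ γ n

/-- `θ_{ξ,n}(K)`, for `n ≥ 1`. -/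
noncomputable def theta (K : Set (StrongDual 𝕜 X)) (ξ : Ordinal.{u}) (n : ℕ) : ℝ≥0∞ :=
  ⨅ (θ : ℝ) (_ : 0 < θ ∧
    ∀ (D : Type u) [Preorder D] [IsDirectedOrder D] [Nonempty D]
      (x : List (Ordinal.{u} × D) → X),
      InBall (gamma ξ n) D x → WeaklyNull 𝕜 (gamma ξ n) D x →
        treeInf K ξ n (fun _ => (1 / n : 𝕜)) x ≤ θ),
    ENNReal.ofReal θ

/-! ### The Szlenk index -/

/-- `s_ε(K)`. -/
def szlenkDerivative (ε : ℝ) (K : Set (StrongDual 𝕜 X)) : Set (StrongDual 𝕜 X) :=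
  {f | f ∈ K ∧ ∀ V ∈ 𝓝 (StrongDual.toWeakDual f),
    ENNReal.ofReal ε < Metric.ediam (StrongDual.toWeakDual ⁻¹' V ∩ K)}

/-- `s_ε^ξ(K)`. -/
noncomputable def szlenkDerivatives (ε : ℝ) (K : Set (StrongDual 𝕜 X)) (ξ : Ordinal.{u}) :
    Set (StrongDual 𝕜 X) :=
  Ordinal.limitRecOn ξ K (fun _ L => szlenkDerivative ε L)
    (fun ξ _ IH => ⋂ (ζ : Ordinal.{u}) (h : ζ < ξ), IH ζ h)

/-- `Sz(K, ε)`: the least `ξ` with `s_ε^ξ(K) = ∅`, and `∞` if there is none. -/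
noncomputable def szlenkAt (K : Set (StrongDual 𝕜 X)) (ε : ℝ) : WithTop Ordinal.{u} :=
  ⨅ (ξ : Ordinal.{u}) (_ : szlenkDerivatives ε K ξ = ∅), (ξ : WithTop Ordinal.{u})

/-- `Sz(K) = sup_{ε > 0} Sz(K, ε)`. -/
noncomputable def szlenk (K : Set (StrongDual 𝕜 X)) : WithTop Ordinal.{u} :=
  ⨆ (ε : ℝ) (_ : 0 < ε), szlenkAt K ε

/-! ### The versions for operators -/

variable {Y : Type u} [NormedAddCommGroup Y] [NormedSpace 𝕜 Y]

/-- `A^* B_{Y^*}`, the image of the closed dual unit ball under the adjoint of `A : X → Y`. -/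
def adjointBall (A : X →L[𝕜] Y) : Set (StrongDual 𝕜 X) :=
  (fun f : StrongDual 𝕜 Y => f.comp A) '' Metric.closedBall 0 1

/-- `Sz(A)`. -/
noncomputable def opSzlenk (A : X →L[𝕜] Y) : WithTop Ordinal.{u} := szlenk (adjointBall A)

/-- `α_{ξ,γ}(A)`. -/
noncomputable def opAlpha (A : X →L[𝕜] Y) (ξ : Ordinal.{u}) (γ : ℝ≥0∞) : ℝ≥0∞ :=
  alpha (adjointBall A) ξ γ

/-- `θ_{ξ,n}(A)`. -/
noncomputable def opTheta (A : X →L[𝕜] Y) (ξ : Ordinal.{u}) (n : ℕ) : ℝ≥0∞ :=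
  theta (adjointBall A) ξ n

end Banach

/-! ### Direct sums

The exponents range over `{0} ∪ [1, ∞]`; the exponent `0` stands for the `c₀`-sum. -/

/-- The exponent of the norm: the `c₀`-sum carries the supremum norm. -/
noncomputable def normExp (p : ℝ≥0∞) : ℝ≥0∞ := if p = 0 then ∞ else p

instance normExp_fact (p : ℝ≥0∞) [hp : Fact (p = 0 ∨ 1 ≤ p)] : Fact (1 ≤ normExp p) :=
  ⟨by
    unfold normExp
    split_ifs with h
    · exact le_top
    · exact hp.out.resolve_left h⟩

section Sums

variable (𝕜 : Type*) [RCLike 𝕜] {Λ : Type u} (X : Λ → Type u)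
  [∀ l, NormedAddCommGroup (X l)] [∀ l, NormedSpace 𝕜 (X l)]

/-- The direct sum `(⊕ X_λ)_{ℓ_p(Λ)}` for `1 ≤ p ≤ ∞`, and `(⊕ X_λ)_{c₀(Λ)}` for `p = 0`: if
`p ≠ 0` this is all of `lp X p`; if `p = 0` these are the members `x` of `lp X ∞` for which
`‖x_λ‖` tends to zero along the cofinite filter. -/
noncomputable def directSum (p : ℝ≥0∞) [Fact (p = 0 ∨ 1 ≤ p)] : Submodule 𝕜 (lp X (normExp p)) where
  carrier := {x | p = 0 → Tendsto (fun l => ‖x l‖) cofinite (𝓝 0)}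
  zero_mem' := fun _ => by simpa using tendsto_const_nhds
  add_mem' := fun {x y} hx hy h =>
    squeeze_zero (fun l => norm_nonneg _) (fun l => by simpa using norm_add_le (x l) (y l))
      (by simpa using (hx h).add (hy h))
  smul_mem' := fun c x hx h => by
    simpa [norm_smul] using (hx h).const_mul ‖c‖

variable {𝕜} {X} {Y : Λ → Type u} [∀ l, NormedAddCommGroup (Y l)] [∀ l, NormedSpace 𝕜 (Y l)]

/-- The exponents for which the diagonal operators are considered: `r = 0` and `p < ∞`, or
`1 ≤ p ≤ r ≤ ∞`, `1 < r` and `p < ∞`. -/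
def Admissible (p r : ℝ≥0∞) : Prop :=
  (r = 0 ∧ p < ∞) ∨ (1 ≤ p ∧ p ≤ r ∧ 1 < r ∧ p < ∞)

theorem norm_mono_exponent {p q : ℝ≥0∞} [hp : Fact (1 ≤ p)] [Fact (1 ≤ q)] (hpq : p ≤ q) (x : lp X p) (y : lp Y q)
    {C : ℝ} (hC : 0 ≤ C) (h : ∀ l, ‖y l‖ ≤ C * ‖x l‖) : ‖y‖ ≤ C * ‖x‖ := by
  have hp0 : p ≠ 0 := (zero_lt_one.trans_le hp.out).ne'
  have hxx : ∀ l, ‖x l‖ ≤ ‖x‖ := fun l => lp.norm_apply_le_norm hp0 x l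
  rcases eq_or_ne q ∞ with rfl | hq
  · exact lp.norm_le_of_forall_le (by positivity) fun l => (h l).trans (by gcongr; exact hxx l)
  have hpt : p ≠ ∞ := fun hh => hq (top_le_iff.1 (hh ▸ hpq))
  have hp1 : 0 < p.toReal := ENNReal.toReal_pos hp0 hpt
  have hpq' : p.toReal ≤ q.toReal := ENNReal.toReal_mono hq hpq
  have hq1 : 0 < q.toReal := hp1.trans_le hpq'
  rcases eq_or_lt_of_le (norm_nonneg x) with h0 | h0
  · refine lp.norm_le_of_forall_sum_le hq1 (by positivity) fun s => ?_
    have : ∀ l ∈ s, ‖y l‖ ^ q.toReal = 0 := fun l _ => by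
      have h1 := hxx l
      rw [← h0] at h1
      have h2 := h l
      have h3 : ‖x l‖ = 0 := le_antisymm h1 (norm_nonneg _)
      rw [h3, mul_zero] at h2
      rw [le_antisymm h2 (norm_nonneg _), Real.zero_rpow hq1.ne']
    rw [Finset.sum_eq_zero this]
    positivity
  · refine lp.norm_le_of_forall_sum_le hq1 (by positivity) fun s => ?_
    have hs := lp.sum_rpow_le_norm_rpow hp1 x s
    calc ∑ l ∈ s, ‖y l‖ ^ q.toReal
        ≤ ∑ l ∈ s, (C * ‖x‖) ^ q.toReal * ((‖x l‖ / ‖x‖) ^ p.toReal) := by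
          refine Finset.sum_le_sum fun l _ => ?_
          calc ‖y l‖ ^ q.toReal ≤ (C * ‖x l‖) ^ q.toReal := by gcongr; exact h l
            _ = (C * ‖x‖) ^ q.toReal * (‖x l‖ / ‖x‖) ^ q.toReal := by
              rw [← Real.mul_rpow (by positivity) (by positivity)]
              congr 1
              field_simp
            _ ≤ _ := by
              refine mul_le_mul_of_nonneg_left ?_ (by positivity)
              exact Real.rpow_le_rpow_of_exponent_ge' (by positivity)
                ((div_le_one h0).2 (hxx l)) hp1.le hpq'
      _ = (C * ‖x‖) ^ q.toReal * ((∑ l ∈ s, ‖x l‖ ^ p.toReal) / ‖x‖ ^ p.toReal) := by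
          rw [← Finset.mul_sum, Finset.sum_div]
          congr 1
          exact Finset.sum_congr rfl fun l _ => Real.div_rpow (norm_nonneg _) h0.le _
      _ ≤ (C * ‖x‖) ^ q.toReal * 1 := by
          refine mul_le_mul_of_nonneg_left ?_ (by positivity)
          exact (div_le_one (by positivity)).2 hs
      _ = _ := mul_one _

theorem Admissible.normExp_le {p r : ℝ≥0∞} (h : Admissible p r) : normExp p ≤ normExp r := by
  rcases h with ⟨rfl, -⟩ | ⟨h1, h2, h3, -⟩
  · simp [normExp]
  · rw [normExp, normExp, if_neg (zero_lt_one.trans_le h1).ne', if_neg (zero_lt_one.trans h3).ne']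
    exact h2

theorem Admissible.lt_top {p r : ℝ≥0∞} (h : Admissible p r) : p < ∞ := by
  rcases h with ⟨-, h⟩ | ⟨-, -, -, h⟩ <;> exact h

/-- The family `(1_Υ(λ) A_λ x_λ)_λ`. -/
noncomputable def diagFun (A : ∀ l, X l →L[𝕜] Y l) (S : Set Λ) (x : ∀ l, X l) : ∀ l, Y l :=
  fun l => S.indicator (fun _ => (1 : 𝕜)) l • A l (x l)

theorem norm_diagFun_le (A : ∀ l, X l →L[𝕜] Y l) {C : ℝ} (hC : ∀ l, ‖A l‖ ≤ C) (S : Set Λ)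
    (x : ∀ l, X l) (l : Λ) : ‖diagFun A S x l‖ ≤ |C| * ‖x l‖ := by
  have h1 : ‖S.indicator (fun _ => (1 : 𝕜)) l‖ ≤ 1 := by
    by_cases h : l ∈ S <;> simp [h]
  calc ‖diagFun A S x l‖ ≤ 1 * ‖A l (x l)‖ := by
        rw [diagFun, norm_smul]; gcongr
    _ ≤ |C| * ‖x l‖ := by
        rw [one_mul]
        exact (A l).le_of_opNorm_le ((hC l).trans (le_abs_self C)) _

theorem memlp_diagFun {p r : ℝ≥0∞} (h : Admissible p r) (A : ∀ l, X l →L[𝕜] Y l) {C : ℝ}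
    (hC : ∀ l, ‖A l‖ ≤ C) (S : Set Λ) (x : lp X (normExp p)) :
    Memℓp (diagFun A S x) (normExp r) := by
  refine Memℓp.of_exponent_ge ?_ h.normExp_le
  have := ((lp.memℓp x).norm.const_mul |C|)
  exact Memℓp.mono this fun l => by
    simpa using norm_diagFun_le A hC S x l

theorem tendsto_norm_of_exponent {p : ℝ≥0∞} [Fact (p = 0 ∨ 1 ≤ p)] (hp : p < ∞) (x : directSum 𝕜 X p) :
    Tendsto (fun l => ‖x.1 l‖) cofinite (𝓝 0) := by
  rcases eq_or_ne p 0 with h0 | h0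
  · exact x.2 h0
  · have he : normExp p = p := if_neg h0
    have hpos : 0 < (normExp p).toReal := by
      rw [he]; exact ENNReal.toReal_pos h0 hp.ne
    have hs := ((lp.memℓp x.1).summable hpos).tendsto_cofinite_zero
    have h2 := hs.rpow_const (p := (normExp p).toReal⁻¹) (Or.inr (by positivity))
    rw [Real.zero_rpow (by positivity)] at h2
    refine h2.congr fun l => ?_
    rw [← Real.rpow_mul (norm_nonneg _), mul_inv_cancel₀ hpos.ne', Real.rpow_one]

variable {p r : ℝ≥0∞} [Fact (p = 0 ∨ 1 ≤ p)] [Fact (r = 0 ∨ 1 ≤ r)]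

/-- The operator `D^{p,r}_Υ : E_p → F_r`, `(x_λ)_λ ↦ (1_Υ(λ) A_λ x_λ)_λ`. -/
noncomputable def diagOp (h : Admissible p r) (A : ∀ l, X l →L[𝕜] Y l)
    (hA : ∃ C : ℝ, ∀ l, ‖A l‖ ≤ C) (S : Set Λ) : directSum 𝕜 X p →L[𝕜] directSum 𝕜 Y r :=
  LinearMap.mkContinuous
    { toFun := fun x => ⟨⟨diagFun A S x.1, memlp_diagFun h A hA.choose_spec S x.1⟩, fun _ => by
        have hx := tendsto_norm_of_exponent h.lt_top x
        exact squeeze_zero (fun l => norm_nonneg _)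
          (fun l => norm_diagFun_le A hA.choose_spec S x.1 l)
          (by simpa using hx.const_mul |hA.choose|)⟩
      map_add' := fun x y => by
        apply Subtype.ext
        apply lp.ext
        funext l
        change S.indicator (fun _ => (1 : 𝕜)) l • A l (x.1 l + y.1 l) =
          S.indicator (fun _ => (1 : 𝕜)) l • A l (x.1 l) +
            S.indicator (fun _ => (1 : 𝕜)) l • A l (y.1 l)
        rw [map_add, smul_add]
      map_smul' := fun c x => by
        apply Subtype.ext
        apply lp.ext
        funext l
        change S.indicator (fun _ => (1 : 𝕜)) l • A l (c • x.1 l) =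
          c • (S.indicator (fun _ => (1 : 𝕜)) l • A l (x.1 l))
        rw [map_smul, smul_comm] }
    |hA.choose| fun x => norm_mono_exponent h.normExp_le x.1 _
      (abs_nonneg _) fun l => norm_diagFun_le A hA.choose_spec S x.1 l

theorem diagOp_apply (h : Admissible p r) (A : ∀ l, X l →L[𝕜] Y l)
    (hA : ∃ C : ℝ, ∀ l, ‖A l‖ ≤ C) (S : Set Λ) (x : directSum 𝕜 X p) (l : Λ) :
    (diagOp h A hA S x).1 l = S.indicator (fun _ => (1 : 𝕜)) l • A l (x.1 l) :=
  rfl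

end Sums

/-- `(a_λ)_λ ∈ ℓ_s(Λ)` for a family in `[0, ∞]`: all `a_λ` are finite and the family of reals lies
in `ℓ_s(Λ)`. -/
def MemEll {Λ : Type u} (s : ℝ≥0∞) (a : Λ → ℝ≥0∞) : Prop :=
  (∀ l, a l ≠ ∞) ∧ Memℓp (fun l => (a l).toReal) s

end SzlenkSums

namespace SzlenkSums

/-! ### Szlenk derivatives -/

section Szlenk

variable {𝕜 : Type*} [RCLike 𝕜] {X : Type u} [NormedAddCommGroup X] [NormedSpace 𝕜 X]

/-! The theorem is moved from trees to derivatives of the dual set. `Estimate K ξ γ β` says that ∑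
bᵢ εᵢ ≤ β ‖b‖_γ whenever the iterated derivative of K of order ω ^ ξ at the levels ε₁, …, εₙ is
non-empty. For K = A^* B_{Y^*} an estimate with β gives α_{ξ,γ}(A) ≤ β (`opAlpha_le_of_estimate`),
and α_{ξ,γ}(A) ≤ M gives an estimate with 8M (`estimate_of_opAlpha_le`). Thus α_{ξ,γ}(A) is finite
exactly when some estimate holds, and an estimate with β = 0 means Sz(A) ≤ ω ^ ξ
(`estimate_zero_iff`).

Both passages go through games on Γ_{ξ,1}, defined by recursion on ξ. For upper bounds, weak-star
compactness shows that adding a vector from a suitable weak neighbourhood of zero to y replaces a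
functional of K by one of a derivative of K at y, at a cost given by the level of that derivative. A
pigeonhole argument turns many small drops into one drop of order ω ^ ξ (`gameT_drop`). For lower
bounds, a functional in a derivative of order ω ^ ξ lets the opponent play vectors on which nearby
functionals of K stay large (`gameS_of_mem_szlenkDerivatives`). Strategies become branches in every
weakly null tree (`exists_adapted_branch`) or weakly null trees (`exists_tree_of_derivList`).

Let D be the full diagonal operator. If r = 0 or γ ≤ r, uniform estimates for the A_λ suffice
(`opAlpha_diagOp_le`): along a good branch the coordinate λ contributes at most a constant times
‖(a_m w_m(λ))_m‖_γ, where ‖w_m‖_r ≤ 1, and Minkowski's inequality for γ ≤ r finishes, with r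
replaced by ∞ when r = 0.

Let r < γ. If for some ε > 0 no finite set S makes the ε-derivative of order ω ^ ξ of the tail
D_{Λ∖S} vanish, then the ℓ_{r'}-structure of the dual allows n successive derivatives of level about
ε n^{-1/r'}; an estimate would give n^{1/r} ≤ const · n^{1/γ} for all n, which is absurd
(`not_estimate_of_forall_tail`). So finiteness of α forces the tails to become small, which is the
condition on θ. Taking derivatives coordinate by coordinate, with weights that give equality in
Hölder's inequality, puts the near-optimal constants of the A_λ into ℓ_s
(`exists_memℓp_of_estimate`). Conversely, small tails and constants in ℓ_s give a bound by Hölder's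
inequality (`opAlpha_diagOp_le_of_hoelder`).

If ζ = ξ, all A_λ satisfy estimates with constant 0. For γ > r the last bound would then give
α_{ξ,γ}(D) = 0, that is Sz(D) ≤ ω ^ ξ, contrary to Sz(D) = ω ^ (ξ+1). -/

theorem szlenkDerivatives_zero (ε : ℝ) (K : Set (StrongDual 𝕜 X)) :
    szlenkDerivatives ε K (0 : Ordinal.{u}) = K := by
  simp [szlenkDerivatives]

theorem szlenkDerivatives_succ (ε : ℝ) (K : Set (StrongDual 𝕜 X)) (η : Ordinal.{u}) :
    szlenkDerivatives ε K (η + 1) = szlenkDerivative ε (szlenkDerivatives ε K η) := by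
  simp only [szlenkDerivatives, Ordinal.limitRecOn_add_one]

theorem szlenkDerivatives_limit (ε : ℝ) (K : Set (StrongDual 𝕜 X)) {η : Ordinal.{u}}
    (hη : Order.IsSuccLimit η) :
    szlenkDerivatives ε K η = ⋂ (ζ : Ordinal.{u}) (_ : ζ < η), szlenkDerivatives ε K ζ := by
  unfold szlenkDerivatives
  rw [Ordinal.limitRecOn_limit _ _ _ _ hη]

theorem szlenkDerivatives_one (ε : ℝ) (K : Set (StrongDual 𝕜 X)) :
    szlenkDerivatives ε K (1 : Ordinal.{u}) = szlenkDerivative ε K := by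
  rw [← zero_add (1 : Ordinal.{u}), szlenkDerivatives_succ, szlenkDerivatives_zero]

theorem mem_szlenkDerivative {ε : ℝ} (hε : 0 ≤ ε) {K : Set (StrongDual 𝕜 X)}
    {f : StrongDual 𝕜 X} :
    f ∈ szlenkDerivative ε K ↔ f ∈ K ∧ ∀ V ∈ 𝓝 (StrongDual.toWeakDual f),
      ∃ g ∈ K, ∃ g' ∈ K, StrongDual.toWeakDual g ∈ V ∧ StrongDual.toWeakDual g' ∈ V ∧
        ε < ‖g - g'‖ := by
  refine and_congr_right fun _ => forall₂_congr fun V _ => ?_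
  rw [← not_le, Metric.ediam_le_iff]
  push Not
  constructor
  · rintro ⟨g, hg, g', hg', h⟩
    rw [edist_dist, ENNReal.ofReal_lt_ofReal_iff_of_nonneg hε, dist_eq_norm] at h
    exact ⟨g, hg.2, g', hg'.2, hg.1, hg'.1, h⟩
  · rintro ⟨g, hg, g', hg', h1, h2, h⟩
    refine ⟨g, ⟨h1, hg⟩, g', ⟨h2, hg'⟩, ?_⟩
    rw [edist_dist, ENNReal.ofReal_lt_ofReal_iff_of_nonneg hε, dist_eq_norm]
    exact h

theorem szlenkDerivative_subset (ε : ℝ) (K : Set (StrongDual 𝕜 X)) :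
    szlenkDerivative ε K ⊆ K := fun _ h => h.1

theorem szlenkDerivatives_anti (ε : ℝ) (K : Set (StrongDual 𝕜 X)) {η η' : Ordinal.{u}}
    (h : η ≤ η') : szlenkDerivatives ε K η' ⊆ szlenkDerivatives ε K η := by
  induction η' using Ordinal.limitRecOn with
  | zero =>
    rw [le_antisymm h bot_le]
  | add_one ζ ih =>
    rcases h.lt_or_eq with h | rfl
    · rw [szlenkDerivatives_succ]
      exact (szlenkDerivative_subset _ _).trans (ih (Order.lt_add_one_iff.1 h))
    · rfl
  | limit ζ hζ ih =>
    rcases h.lt_or_eq with h | rfl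
    · rw [szlenkDerivatives_limit _ _ hζ]
      exact Set.iInter₂_subset η h
    · rfl

theorem szlenkDerivatives_subset (ε : ℝ) (K : Set (StrongDual 𝕜 X)) (η : Ordinal.{u}) :
    szlenkDerivatives ε K η ⊆ K := by
  simpa [szlenkDerivatives_zero] using szlenkDerivatives_anti ε K (bot_le : (0 : Ordinal) ≤ η)

theorem szlenkDerivatives_add (ε : ℝ) (K : Set (StrongDual 𝕜 X)) (η η' : Ordinal.{u}) :
    szlenkDerivatives ε K (η + η') = szlenkDerivatives ε (szlenkDerivatives ε K η) η' := by
  induction η' using Ordinal.limitRecOn with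
  | zero => simp [szlenkDerivatives_zero]
  | add_one ζ ih => rw [← add_assoc, szlenkDerivatives_succ, szlenkDerivatives_succ, ih]
  | limit ζ hζ ih =>
    have hlim : Order.IsSuccLimit (η + ζ) := Ordinal.isSuccLimit_add η hζ
    rw [szlenkDerivatives_limit _ _ hlim, szlenkDerivatives_limit _ _ hζ]
    apply Set.Subset.antisymm
    · refine Set.subset_iInter₂ fun a ha => ?_
      rw [← ih a ha]
      exact Set.iInter₂_subset (η + a) (by gcongr)
    · refine Set.subset_iInter₂ fun a ha => ?_
      obtain ⟨b, hb, hab⟩ := (Ordinal.lt_add_iff hζ.ne_bot).1 ha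
      refine (Set.iInter₂_subset b hb).trans ?_
      rw [← ih b hb]
      exact szlenkDerivatives_anti _ _ hab

/-- Images of Szlenk derivatives under weak-star continuous maps that do not contract by more than
the factor `c`. -/
theorem image_szlenkDerivatives {Z : Type u} [NormedAddCommGroup Z] [NormedSpace 𝕜 Z]
    {φ : StrongDual 𝕜 X → StrongDual 𝕜 Z}
    (hφ : Continuous fun f : WeakDual 𝕜 X =>
      StrongDual.toWeakDual (φ (StrongDual.toWeakDual.symm f)))
    {c ε ε' : ℝ} (hc : 0 < c) (hε' : 0 ≤ ε') (hεε' : ε' ≤ c * ε)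
    {L : Set (StrongDual 𝕜 X)} {K : Set (StrongDual 𝕜 Z)}
    (hL : ∀ f ∈ L, ∀ g ∈ L, c * ‖f - g‖ ≤ ‖φ f - φ g‖) (hLK : Set.MapsTo φ L K)
    (η : Ordinal.{u}) :
    Set.MapsTo φ (szlenkDerivatives ε L η) (szlenkDerivatives ε' K η) := by
  have hε : 0 ≤ ε := nonneg_of_mul_nonneg_right (hε'.trans hεε') hc
  induction η using Ordinal.limitRecOn with
  | zero => simpa [szlenkDerivatives_zero] using hLK
  | add_one ζ ih =>
    rw [szlenkDerivatives_succ, szlenkDerivatives_succ]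
    intro f hf
    rw [mem_szlenkDerivative hε] at hf
    rw [mem_szlenkDerivative hε']
    refine ⟨ih hf.1, fun V hV => ?_⟩
    have hcont := hφ.continuousAt (x := StrongDual.toWeakDual f)
    obtain ⟨g, hg, g', hg', h1, h2, h3⟩ := hf.2 _ (hcont.preimage_mem_nhds (by simpa using hV))
    refine ⟨φ g, ih hg, φ g', ih hg', by simpa using h1, by simpa using h2, ?_⟩
    calc ε' ≤ c * ε := hεε'
      _ < c * ‖g - g'‖ := by gcongr
      _ ≤ _ := hL g (szlenkDerivatives_subset _ _ _ hg) g' (szlenkDerivatives_subset _ _ _ hg')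
  | limit ζ hζ ih =>
    rw [szlenkDerivatives_limit _ _ hζ, szlenkDerivatives_limit _ _ hζ]
    intro f hf
    simp only [Set.mem_iInter] at hf ⊢
    exact fun a ha => ih a ha (hf a ha)

theorem szlenkDerivatives_mono {ε ε' : ℝ} (hε' : 0 ≤ ε') (h : ε' ≤ ε)
    {L K : Set (StrongDual 𝕜 X)} (hLK : L ⊆ K) (η : Ordinal.{u}) :
    szlenkDerivatives ε L η ⊆ szlenkDerivatives ε' K η := by
  have := image_szlenkDerivatives (φ := id) (c := 1) (ε := ε) (ε' := ε') (L := L) (K := K)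
    (by simpa using continuous_id') one_pos hε' (by simpa using h) (by simp) hLK η
  exact this

/-- Weak-star compactness. -/
def WCompact (K : Set (StrongDual 𝕜 X)) : Prop := IsCompact (StrongDual.toWeakDual '' K)

/-- The points of K that are removed form a relatively open set: a neighbourhood of F on which K has
small diameter is a neighbourhood of all points near F. -/
theorem WCompact.szlenkDerivative {K : Set (StrongDual 𝕜 X)} (hK : WCompact K) (ε : ℝ) :
    WCompact (szlenkDerivative ε K) := by
  have : StrongDual.toWeakDual '' (SzlenkSums.szlenkDerivative ε K) =
      StrongDual.toWeakDual '' K ∩ {F : WeakDual 𝕜 X | ∀ V ∈ 𝓝 F,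
        ENNReal.ofReal ε < Metric.ediam (StrongDual.toWeakDual ⁻¹' V ∩ K)} := by
    ext F
    constructor
    · rintro ⟨f, hf, rfl⟩
      exact ⟨⟨f, hf.1, rfl⟩, hf.2⟩
    · rintro ⟨⟨f, hf, rfl⟩, h⟩
      exact ⟨f, ⟨hf, h⟩, rfl⟩
  rw [WCompact, this]
  refine hK.inter_right ?_
  rw [← isOpen_compl_iff, isOpen_iff_mem_nhds]
  intro F hF
  simp only [Set.mem_compl_iff, Set.mem_ofPred_eq, not_forall] at hF
  obtain ⟨V, hV, h⟩ := hF
  filter_upwards [eventually_mem_nhds_iff.2 hV] with G hG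
  simp only [Set.mem_compl_iff, Set.mem_ofPred_eq, not_forall]
  exact ⟨V, hG, h⟩

theorem WCompact.szlenkDerivatives {K : Set (StrongDual 𝕜 X)} (hK : WCompact K) (ε : ℝ)
    (η : Ordinal.{u}) : WCompact (szlenkDerivatives ε K η) := by
  induction η using Ordinal.limitRecOn with
  | zero => rwa [szlenkDerivatives_zero]
  | add_one ζ ih =>
    rw [szlenkDerivatives_succ]
    exact ih.szlenkDerivative ε
  | limit ζ hζ ih =>
    refine IsCompact.of_isClosed_subset hK ?_ (Set.image_mono (szlenkDerivatives_subset ε K ζ))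
    rw [szlenkDerivatives_limit _ _ hζ, Set.image_iInter₂ StrongDual.toWeakDual.bijective]
    exact isClosed_biInter fun a ha => (ih a ha).isClosed

theorem continuous_weakDual_re (y : X) :
    Continuous fun f : WeakDual 𝕜 X => RCLike.re (f y) :=
  RCLike.continuous_re.comp (WeakDual.eval_continuous y)

/-- The maximum of a functional over a decreasing family of weak-star compact sets. -/
theorem exists_le_of_directed {ι : Type*} [Nonempty ι] {F : ι → Set (StrongDual 𝕜 X)}
    (hF : Directed (· ⊇ ·) F) (hFc : ∀ i, WCompact (F i)) (y : X) {τ : ℝ} (hτ : 0 < τ) :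
    ∃ i, ∀ f ∈ F i, ∃ g ∈ ⋂ i, F i, RCLike.re (f y) ≤ RCLike.re (g y) + τ := by
  -- An open neighbourhood of the intersection, so by compactness it contains some `F i`. If the
  -- intersection is empty then so is `U`, and the conclusion says that some `F i` is empty.
  set U : Set (WeakDual 𝕜 X) :=
    {f | ∃ g ∈ ⋂ i, F i, RCLike.re (f y) < RCLike.re (g y) + τ} with hU
  have hUo : IsOpen U := by
    have : U = ⋃ g ∈ ⋂ i, F i, {f : WeakDual 𝕜 X | RCLike.re (f y) < RCLike.re (g y) + τ} := by
      ext f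
      simp [hU]
    rw [this]
    exact isOpen_biUnion fun g _ =>
      isOpen_lt (continuous_weakDual_re y) continuous_const
  obtain ⟨i, hi⟩ := exists_subset_nhds_of_isCompact' (V := fun i => StrongDual.toWeakDual '' F i)
    (U := U) (fun i j => (hF i j).imp fun _ h => ⟨Set.image_mono h.1, Set.image_mono h.2⟩) hFc (fun i => (hFc i).isClosed)
    (fun f hf => hUo.mem_nhds (by
      rw [← Set.image_iInter StrongDual.toWeakDual.bijective] at hf
      obtain ⟨g, hg, rfl⟩ := hf
      exact ⟨g, hg, by simpa using hτ⟩))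
  refine ⟨i, fun f hf => ?_⟩
  obtain ⟨g, hg, h⟩ := hi ⟨f, hf, rfl⟩
  exact ⟨g, hg, h.le⟩

theorem szlenk_le_iff {K : Set (StrongDual 𝕜 X)} {η : Ordinal.{u}} :
    szlenk K ≤ (η : WithTop Ordinal.{u}) ↔
      ∀ ε : ℝ, 0 < ε → szlenkDerivatives ε K η = ∅ := by
  rw [szlenk, iSup₂_le_iff]
  refine forall₂_congr fun ε hε => ?_
  constructor
  · intro h
    by_contra hne
    have : ((η + 1 : Ordinal.{u}) : WithTop Ordinal.{u}) ≤ szlenkAt K ε := by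
      refine le_iInf₂ fun ζ hζ => WithTop.coe_le_coe.2 ?_
      by_contra hlt
      have hle : ζ ≤ η := Order.lt_add_one_iff.1 (not_le.1 hlt)
      exact hne (Set.subset_empty_iff.1 (hζ ▸ szlenkDerivatives_anti ε K hle))
    have := WithTop.coe_le_coe.1 (this.trans h)
    exact absurd this (not_le.2 (lt_add_one η))
  · intro h
    exact iInf₂_le η h

end Szlenk

/-! ### Games -/

section Games

/-- `n` successive rounds of the game `F`. -/
def hist {V : Type*} (F : (V → Prop) → Prop) : ℕ → (List V → Prop) → Prop
  | 0, Q => Q []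
  | n + 1, Q => F fun v => hist F n fun h => Q (v :: h)

theorem hist_mono {V : Type*} {F : (V → Prop) → Prop}
    (hF : ∀ Q Q' : V → Prop, (∀ v, Q v → Q' v) → F Q → F Q') (n : ℕ) {Q Q' : List V → Prop}
    (h : ∀ v, Q v → Q' v) (hQ : hist F n Q) : hist F n Q' := by
  induction n generalizing Q Q' with
  | zero => exact h _ hQ
  | succ n ih => exact hF _ _ (fun v hv => ih (fun _ => h _) hv) hQ

/-- Winning each round separately wins all of them, even if the goal `G h` of a round depends on the
history `h` of the previous rounds. The default value `d` is never read. -/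
theorem hist_of_step {V : Type*} {F : (V → Prop) → Prop}
    (hF : ∀ Q Q' : V → Prop, (∀ v, Q v → Q' v) → F Q → F Q') (n : ℕ) (d : V)
    (G : List V → V → Prop) (hG : ∀ h, h.length < n → F (G h)) :
    hist F n fun H => H.length = n ∧ ∀ k < n, G (H.take k) (H.getD k d) := by
  induction n generalizing G with
  | zero => exact ⟨rfl, fun k hk => absurd hk (Nat.not_lt_zero k)⟩
  | succ n ih =>
    refine hF _ _ (fun v hv => ?_) (hG [] (by simp))
    refine hist_mono hF n (fun H hH => ?_)
      (ih (fun h => G (v :: h)) fun h hh => hG _ (by simpa using hh))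
    refine ⟨by simp [hH.1], fun k hk => ?_⟩
    cases k with
    | zero => simpa using hv
    | succ k => simpa using hH.2 k (by omega)

theorem hist_and {V : Type*} {F : (V → Prop) → Prop}
    (hF : ∀ Q Q' : V → Prop, (∀ v, Q v → Q' v) → F Q → F Q') (P : V → Prop)
    (hP : ∀ Q, F Q → F fun v => Q v ∧ P v) (n : ℕ) (Q : List V → Prop) (hQ : hist F n Q) :
    hist F n fun h => Q h ∧ h.length = n ∧ ∀ v ∈ h, P v := by
  induction n generalizing Q with
  | zero => exact ⟨hQ, rfl, by simp⟩
  | succ n ih =>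
    refine hF _ _ (fun v hv => ?_) (hP _ hQ)
    refine hist_mono hF n (fun h hh => ?_) (ih _ hv.1)
    exact ⟨hh.1, by simp [hh.2.1], by simpa using ⟨hv.2, hh.2.2⟩⟩

variable (𝕜 : Type*) [RCLike 𝕜] {X : Type u} [NormedAddCommGroup X] [NormedSpace 𝕜 X]

variable (X) in
/-- The filter of weak neighbourhoods of zero. -/
def weakNhds : Filter X := ⨅ f : StrongDual 𝕜 X, comap f (𝓝 0)

theorem tendsto_weakNhds {ι : Type*} {l : Filter ι} {x : ι → X} :
    Tendsto x l (weakNhds 𝕜 X) ↔ ∀ f : StrongDual 𝕜 X, Tendsto (fun i => f (x i)) l (𝓝 0) := by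
  simp only [weakNhds, tendsto_iInf, tendsto_comap_iff, Function.comp_def]

theorem tendsto_apply_weakNhds (f : StrongDual 𝕜 X) : Tendsto f (weakNhds 𝕜 X) (𝓝 0) :=
  (tendsto_weakNhds 𝕜 (x := id)).1 tendsto_id f

theorem eventually_norm_apply_lt (f : StrongDual 𝕜 X) {τ : ℝ} (hτ : 0 < τ) :
    ∀ᶠ x in weakNhds 𝕜 X, ‖f x‖ < τ := by
  have := (tendsto_apply_weakNhds 𝕜 f).norm
  rw [norm_zero] at this
  exact this.eventually_lt_const hτ

variable {V : Type*} [AddCommMonoid V] (e : ℝ → X → V)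

/-- The game on `Γ_{ξ,1}` in which we choose the ordinals and the weak neighbourhoods, and the
opponent chooses vectors of the ball. We win if the weighted sum satisfies the given predicate. -/
def gameT (ξ : Ordinal.{u}) : ℝ → (V → Prop) → Prop :=
  Ordinal.limitRecOn ξ
    (fun c Q => ∀ᶠ x in weakNhds 𝕜 X, ‖x‖ ≤ 1 → Q (e c x))
    (fun _ IH c Q => ∃ n : ℕ, 1 ≤ n ∧ hist (IH (c / n)) n fun h => Q h.sum)
    (fun ξ hξ IH c Q => ∃ (ζ : Ordinal.{u}) (h : ζ < ξ), IH (ζ + 1) (hξ.add_one_lt h) c Q)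

/-- The game on `Γ_{ξ,1}` in which the opponent chooses the ordinals and the weak neighbourhoods,
and we choose vectors of the ball. -/
def gameS (ξ : Ordinal.{u}) : ℝ → (V → Prop) → Prop :=
  Ordinal.limitRecOn ξ
    (fun c Q => ∃ᶠ x in weakNhds 𝕜 X, ‖x‖ ≤ 1 ∧ Q (e c x))
    (fun _ IH c Q => ∀ n : ℕ, 1 ≤ n → hist (IH (c / n)) n fun h => Q h.sum)
    (fun ξ hξ IH c Q => ∀ (ζ : Ordinal.{u}) (h : ζ < ξ), IH (ζ + 1) (hξ.add_one_lt h) c Q)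

theorem gameT_zero (c : ℝ) (Q : V → Prop) :
    gameT 𝕜 e 0 c Q ↔ ∀ᶠ x in weakNhds 𝕜 X, ‖x‖ ≤ 1 → Q (e c x) := by
  simp [gameT]

/-- The number `c` is the total weight still to be distributed; the `n` blocks receive `c / n` each
because ℙ_{ξ+1,1} = ℙ_{ξ,n} / n. -/
theorem gameT_succ (ξ : Ordinal.{u}) (c : ℝ) (Q : V → Prop) :
    gameT 𝕜 e (ξ + 1) c Q ↔ ∃ n : ℕ, 1 ≤ n ∧ hist (gameT 𝕜 e ξ (c / n)) n fun h => Q h.sum := by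
  simp only [gameT, Ordinal.limitRecOn_add_one]

theorem gameT_limit {ξ : Ordinal.{u}} (hξ : Order.IsSuccLimit ξ) (c : ℝ) (Q : V → Prop) :
    gameT 𝕜 e ξ c Q ↔ ∃ ζ < ξ, gameT 𝕜 e (ζ + 1) c Q := by
  unfold gameT
  rw [Ordinal.limitRecOn_limit _ _ _ _ hξ]
  simp

theorem gameS_zero (c : ℝ) (Q : V → Prop) :
    gameS 𝕜 e 0 c Q ↔ ∃ᶠ x in weakNhds 𝕜 X, ‖x‖ ≤ 1 ∧ Q (e c x) := by
  simp [gameS]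

theorem gameS_succ (ξ : Ordinal.{u}) (c : ℝ) (Q : V → Prop) :
    gameS 𝕜 e (ξ + 1) c Q ↔ ∀ n : ℕ, 1 ≤ n → hist (gameS 𝕜 e ξ (c / n)) n fun h => Q h.sum := by
  simp only [gameS, Ordinal.limitRecOn_add_one]

theorem gameS_limit {ξ : Ordinal.{u}} (hξ : Order.IsSuccLimit ξ) (c : ℝ) (Q : V → Prop) :
    gameS 𝕜 e ξ c Q ↔ ∀ ζ < ξ, gameS 𝕜 e (ζ + 1) c Q := by
  unfold gameS
  rw [Ordinal.limitRecOn_limit _ _ _ _ hξ]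

theorem gameT_mono (ξ : Ordinal.{u}) (c : ℝ) (Q Q' : V → Prop) (h : ∀ v, Q v → Q' v)
    (hQ : gameT 𝕜 e ξ c Q) : gameT 𝕜 e ξ c Q' := by
  induction ξ using Ordinal.limitRecOn generalizing c Q Q' with
  | zero =>
    rw [gameT_zero] at hQ ⊢
    exact hQ.mono fun x hx h1 => h _ (hx h1)
  | add_one ξ ih =>
    rw [gameT_succ] at hQ ⊢
    obtain ⟨n, hn, hQ⟩ := hQ
    exact ⟨n, hn, hist_mono (ih _) n (fun _ => h _) hQ⟩
  | limit ξ hξ ih =>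
    rw [gameT_limit _ _ hξ] at hQ ⊢
    obtain ⟨ζ, hζ, hQ⟩ := hQ
    exact ⟨ζ, hζ, ih _ (hξ.add_one_lt hζ) c _ _ h hQ⟩

/-- The weighted sums inherit every additive bound. -/
theorem gameT_inv (P : ℝ → V → Prop) (h0 : P 0 0)
    (hadd : ∀ c c' v v', 0 ≤ c → 0 ≤ c' → P c v → P c' v' → P (c + c') (v + v'))
    (he : ∀ c x, 0 ≤ c → ‖x‖ ≤ 1 → P c (e c x)) (ξ : Ordinal.{u}) {c : ℝ} (hc : 0 ≤ c)
    (Q : V → Prop) (hQ : gameT 𝕜 e ξ c Q) : gameT 𝕜 e ξ c fun v => Q v ∧ P c v := by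
  -- With `c / n` for `c`, this adds up the `n` blocks of a successor step to the total weight `c`.
  have hlist : ∀ (c : ℝ), 0 ≤ c → ∀ h : List V, (∀ v ∈ h, P c v) → P (h.length * c) h.sum := by
    intro c hc h hh
    induction h with
    | nil => simpa using h0
    | cons v h ih =>
      rw [List.forall_mem_cons] at hh
      have := hadd c (h.length * c) v h.sum hc (by positivity) hh.1 (ih hh.2)
      rw [List.sum_cons, List.length_cons]
      convert this using 1
      push_cast
      ring
  induction ξ using Ordinal.limitRecOn generalizing c Q with
  | zero =>
    rw [gameT_zero] at hQ ⊢
    exact hQ.mono fun x hx h1 => ⟨hx h1, he c x hc h1⟩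
  | add_one ξ ih =>
    rw [gameT_succ] at hQ ⊢
    obtain ⟨n, hn, hQ⟩ := hQ
    have hn' : (n : ℝ) ≠ 0 := by positivity
    refine ⟨n, hn, hist_mono (gameT_mono 𝕜 e ξ _) n (fun h hh => ⟨hh.1, ?_⟩)
      (hist_and (gameT_mono 𝕜 e ξ _) (P (c / n)) (fun Q hQ => ih (by positivity) Q hQ) n _ hQ)⟩
    have := hlist (c / n) (by positivity) h hh.2.2
    rwa [hh.2.1, mul_div_cancel₀ c hn'] at this
  | limit ξ hξ ih =>
    rw [gameT_limit _ _ hξ] at hQ ⊢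
    obtain ⟨ζ, hζ, hQ⟩ := hQ
    exact ⟨ζ, hζ, ih _ (hξ.add_one_lt hζ) hc _ hQ⟩

end Games

/-! ### Iterated derivatives with varying `ε` -/

section Iterated

variable {𝕜 : Type*} [RCLike 𝕜] {X : Type u} [NormedAddCommGroup X] [NormedSpace 𝕜 X]

/-- `s_ε^η(K)`, with the convention `s_0^η(K) = K`. -/
noncomputable def derivZ (η : Ordinal.{u}) (ε : ℝ) (K : Set (StrongDual 𝕜 X)) :
    Set (StrongDual 𝕜 X) :=
  open Classical in if ε = 0 then K else szlenkDerivatives ε K η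

/-- `s_{ε₁}^η (s_{ε₂}^η (⋯ s_{εₙ}^η(K)))` for `l = [ε₁, …, εₙ]`. -/
noncomputable def derivList (η : Ordinal.{u}) (l : List ℝ) (K : Set (StrongDual 𝕜 X)) :
    Set (StrongDual 𝕜 X) :=
  l.foldr (derivZ η) K

variable {η : Ordinal.{u}} {K : Set (StrongDual 𝕜 X)}

theorem derivZ_zero : derivZ η 0 K = K := by simp [derivZ]

theorem derivZ_of_ne {ε : ℝ} (hε : ε ≠ 0) : derivZ η ε K = szlenkDerivatives ε K η := by
  simp [derivZ, hε]

theorem derivList_nil : derivList η [] K = K := rfl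

theorem derivList_cons (ε : ℝ) (l : List ℝ) :
    derivList η (ε :: l) K = derivZ η ε (derivList η l K) := rfl

theorem derivList_append (l l' : List ℝ) :
    derivList η (l ++ l') K = derivList η l (derivList η l' K) := by
  simp [derivList]

theorem derivZ_subset (ε : ℝ) : derivZ η ε K ⊆ K := by
  unfold derivZ
  split_ifs
  · exact le_rfl
  · exact szlenkDerivatives_subset _ _ _

theorem derivList_subset (l : List ℝ) : derivList η l K ⊆ K := by
  induction l with
  | nil => exact le_rfl
  | cons ε l ih => exact (derivZ_subset ε).trans ih

theorem WCompact.derivZ (hK : WCompact K) (ε : ℝ) : WCompact (derivZ η ε K) := by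
  unfold SzlenkSums.derivZ
  split_ifs
  · exact hK
  · exact hK.szlenkDerivatives _ _

theorem WCompact.derivList (hK : WCompact K) (l : List ℝ) : WCompact (derivList η l K) := by
  induction l with
  | nil => exact hK
  | cons ε l ih => exact ih.derivZ ε

/-- A weak-star compact set of diameter at most `d` on which differences of functionals are
controlled by `N`. -/
structure Controlled (K : Set (StrongDual 𝕜 X)) (N : X → ℝ) (d : ℝ) : Prop where
  wcompact : WCompact K
  norm_sub_le : ∀ f ∈ K, ∀ g ∈ K, ‖f - g‖ ≤ d
  apply_le : ∀ f ∈ K, ∀ g ∈ K, ∀ x, ‖(f - g) x‖ ≤ ‖f - g‖ * N x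

theorem Controlled.derivList {N : X → ℝ} {d : ℝ} (h : Controlled K N d) (l : List ℝ) :
    Controlled (derivList η l K) N d where
  wcompact := h.wcompact.derivList l
  norm_sub_le := fun f hf g hg => h.norm_sub_le f (derivList_subset l hf) g (derivList_subset l hg)
  apply_le := fun f hf g hg => h.apply_le f (derivList_subset l hf) g (derivList_subset l hg)

/-- The maximum over `K` at `y + a z` is controlled by the maxima at `y` over the derivatives
of `K` of order `η`. -/
def Drop (η : Ordinal.{u}) (δ : ℝ) (J : ℕ) (a : 𝕜) (τ : ℝ) (K : Set (StrongDual 𝕜 X)) (y z : X)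
    (w : ℝ) : Prop :=
  ∀ f ∈ K, ∃ j : Fin (J + 1), ∃ g ∈ derivZ η (j * δ) K,
    RCLike.re (f (y + a • z)) ≤ RCLike.re (g y) + ‖a‖ * (w * ((j + 1) * δ)) + τ

/-- The list of thresholds `j₁ δ, …, jₙ δ`. -/
def gridList (δ : ℝ) {J : ℕ} (l : List (Fin (J + 1))) : List ℝ :=
  l.map fun j : Fin (J + 1) => ((j : ℕ) : ℝ) * δ

/-- The rounds are removed from the last one down to round `k`. Dropping at round `m` acts on the
derivative already produced by the later rounds, so the round must be played well against every
possible list of `n - m - 1` later thresholds; as the thresholds come from a finite grid, these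
lists are finite in number. -/
theorem telescope {δ : ℝ} {J : ℕ} {a : ℕ → 𝕜} {τ : ℕ → ℝ} {y : X} {z : ℕ → X} {w : ℕ → ℝ}
    {n k : ℕ} (hkn : k ≤ n)
    (hstep : ∀ m, k ≤ m → m < n → ∀ l : List (Fin (J + 1)), l.length = n - m - 1 →
      Drop η δ J (a m) (τ m) (derivList η (gridList δ l) K)
        (y + ∑ i ∈ Finset.range m, a i • z i) (z m) (w m))
    {f : StrongDual 𝕜 X} (hf : f ∈ K) :
    ∃ l : List (Fin (J + 1)), l.length = n - k ∧ ∃ g ∈ derivList η (gridList δ l) K,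
      RCLike.re (f (y + ∑ i ∈ Finset.range n, a i • z i)) ≤
        RCLike.re (g (y + ∑ i ∈ Finset.range k, a i • z i)) +
          ∑ m ∈ Finset.range (n - k),
            (‖a (k + m)‖ * (w (k + m) * (((l.getD m 0 : Fin (J + 1)) + 1) * δ)) + τ (k + m)) := by
  obtain ⟨d, rfl⟩ : ∃ d, n = k + d := ⟨n - k, by omega⟩
  simp only [Nat.add_sub_cancel_left]
  induction d generalizing k with
  | zero => exact ⟨[], rfl, f, hf, by simp⟩
  | succ d ih =>
    have e : k + (d + 1) = k + 1 + d := by ring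
    obtain ⟨l, hl, g, hg, h⟩ := ih (k := k + 1) (by omega) (fun m hm hm' l hl =>
      hstep m (by omega) (by omega) l (by omega))
    obtain ⟨j, g', hg', h'⟩ := hstep k le_rfl (by omega) l (by omega) g hg
    refine ⟨j :: l, by simp [hl], g', hg', ?_⟩
    rw [e]
    refine h.trans ?_
    rw [Finset.sum_range_succ, ← add_assoc, Finset.sum_range_succ']
    simp only [List.getD_cons_zero, List.getD_cons_succ, add_zero]
    have e' : ∀ m, k + 1 + m = k + (m + 1) := fun m => by ring
    simp only [e']
    linarith

/-- Every entry of size at least `j` raises the order by `η`, and the other entries only make the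
set smaller. -/
theorem derivList_subset_szlenkDerivatives {δ : ℝ} (hδ : 0 < δ) {J : ℕ} (l : List (Fin (J + 1)))
    (j : Fin (J + 1)) (hj : (j : ℕ) ≠ 0) :
    derivList η (gridList δ l) K ⊆
      szlenkDerivatives (j * δ) K (η * (l.countP fun i => j ≤ i : ℕ)) := by
  have hj' : (0 : ℝ) < j * δ := mul_pos (by positivity) hδ
  induction l with
  | nil => simp [gridList, derivList_nil, szlenkDerivatives_zero]
  | cons i l ih =>
    by_cases h : j ≤ i
    · have hle : (j : ℝ) * δ ≤ i * δ :=
        mul_le_mul_of_nonneg_right (Nat.cast_le.2 (Fin.le_def.1 h)) hδ.le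
      have h1 : (0 : ℝ) < i * δ := hj'.trans_le hle
      rw [List.countP_cons_of_pos (by simpa using h)]
      simp only [gridList, List.map_cons, derivList_cons] at ih ⊢
      rw [derivZ_of_ne h1.ne', Nat.cast_add, Nat.cast_one, mul_add, mul_one,
        szlenkDerivatives_add]
      exact szlenkDerivatives_mono hj'.le hle ih η
    · rw [List.countP_cons_of_neg (by simpa using h)]
      exact (derivZ_subset _).trans ih

/-- Pigeonhole: all but few of the `l m` are at most `j`, where `j` is the largest value that is
reached at least `N` times. -/
theorem exists_countP_ge {J n N : ℕ} (hN : N ≤ n) (l : List (Fin (J + 1))) (hl : l.length = n)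
    {δ : ℝ} (hδ : 0 ≤ δ) {b : ℝ} (w : ℕ → ℝ) (hw : ∀ m < n, 0 ≤ w m ∧ w m ≤ b) (hb : 0 ≤ b) :
    ∃ j : Fin (J + 1), ((j : ℕ) ≠ 0 → N ≤ l.countP fun i => j ≤ i) ∧
      ∑ m ∈ Finset.range n, w m * (((l.getD m 0 : Fin (J + 1)) + 1) * δ) ≤
        (∑ m ∈ Finset.range n, w m) * ((j + 1) * δ) + N * (b * ((J + 1) * δ)) := by
  classical
  -- The hypothesis `N ≤ n` puts 0 into `S`, so that there is a largest element.
  set S : Finset (Fin (J + 1)) := Finset.univ.filter fun j => N ≤ l.countP fun i => j ≤ i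
  have hS : S.Nonempty := ⟨0, by simp [S, hl, hN]⟩
  have hj := S.max'_mem hS
  set j := S.max' hS with hjdef
  refine ⟨j, fun _ => (Finset.mem_filter.1 hj).2, ?_⟩
  set B : Finset ℕ := (Finset.range n).filter fun m => j < l.getD m 0
  have hB : B.card ≤ N := by
    have hcard : B.card = l.countP fun i => j < i := by
      clear_value j
      subst hl
      clear hN hw hS S hj hjdef
      have : ∀ l : List (Fin (J + 1)),
          ((Finset.range l.length).filter fun m => j < l.getD m 0).card =
            l.countP fun i => j < i := by
        intro l
        induction l with
        | nil => simp
        | cons i l ih =>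
          rw [List.length_cons, Finset.card_filter, Finset.sum_range_succ', List.countP_cons, ← ih,
            Finset.card_filter]
          simp
      exact this l
    by_cases hjJ : (j : ℕ) = J
    · rw [hcard, List.countP_eq_zero.2]
      · exact Nat.zero_le _
      · intro i _
        simp only [decide_eq_true_eq, not_lt]
        exact Fin.le_def.2 (by omega)
    · have hlt : (j : ℕ) + 1 < J + 1 := by omega
      -- If more than `N` entries exceeded `j`, then `j + 1` would lie in `S`, against maximality.
      by_contra hcon
      have hmem : (⟨j + 1, hlt⟩ : Fin (J + 1)) ∈ S := by
        simp only [S, Finset.mem_filter, Finset.mem_univ, true_and]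
        rw [hcard] at hcon
        refine (not_le.1 hcon).le.trans (List.countP_mono_left fun i _ hi => ?_)
        simp only [decide_eq_true_eq] at hi ⊢
        exact Fin.le_def.2 hi
      have := S.le_max' _ hmem
      rw [← hjdef, Fin.le_def] at this
      simp at this
  have hterm : ∀ m ∈ Finset.range n, w m * (((l.getD m 0 : Fin (J + 1)) + 1) * δ) ≤
      w m * ((j + 1) * δ) + if j < l.getD m 0 then b * ((J + 1) * δ) else 0 := by
    intro m hm
    have hwm := hw m (Finset.mem_range.1 hm)
    split_ifs with h
    · have h1 : ((l.getD m 0 : Fin (J + 1)) : ℝ) ≤ J := by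
        exact_mod_cast Nat.lt_succ_iff.1 (l.getD m 0).isLt
      have h2 : w m * (((l.getD m 0 : Fin (J + 1)) + 1) * δ) ≤ b * ((J + 1) * δ) := by
        gcongr
        exact hwm.2
      have h3 : 0 ≤ w m * (((j : ℕ) + 1 : ℝ) * δ) := mul_nonneg hwm.1 (by positivity)
      linarith
    · rw [add_zero]
      refine mul_le_mul_of_nonneg_left ?_ hwm.1
      have : ((l.getD m 0 : Fin (J + 1)) : ℝ) ≤ j := by exact_mod_cast not_lt.1 h
      gcongr
  refine (Finset.sum_le_sum hterm).trans ?_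
  rw [Finset.sum_add_distrib, ← Finset.sum_mul, ← Finset.sum_filter, Finset.sum_const]
  refine add_le_add le_rfl ?_
  calc _ = (B.card : ℝ) * (b * ((J + 1) * δ)) := nsmul_eq_mul _ _
    _ ≤ _ := by gcongr

end Iterated

/-! ### Upper bounds: a winning strategy in terms of derivatives -/

section Upper

variable {𝕜 : Type*} [RCLike 𝕜] {X : Type u} [NormedAddCommGroup X] [NormedSpace 𝕜 X]

variable (𝕜) in
/-- One step of the game that records the vector together with some bounds for it. -/
noncomputable def recordStep {ι : Type*} (N : ι → X → ℝ) (c : ℝ) (x : X) : X × (ι → ℝ) :=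
  ((c : 𝕜) • x, fun i => c * N i x)

/-- Let `j` be the first index for which `f` is outside the derivative at `(j + 1) δ`; there is one
because the diameter of `K` is at most `(J + 1) δ`. For `j = 0` membership is the convention that
the derivative at level 0 is `K`. Being outside the next derivative supplies the neighbourhood. -/
theorem exists_threshold {K : Set (StrongDual 𝕜 X)} {δ : ℝ} (hδ : 0 < δ) {J : ℕ}
    (hd : ∀ f ∈ K, ∀ g ∈ K, ‖f - g‖ ≤ (J + 1) * δ) {f : StrongDual 𝕜 X} (hf : f ∈ K) :
    ∃ j : Fin (J + 1), f ∈ derivZ 1 (j * δ) K ∧ ∃ V ∈ 𝓝 (StrongDual.toWeakDual f),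
      ∀ g ∈ K, StrongDual.toWeakDual g ∈ V → ‖g - f‖ ≤ (j + 1) * δ := by
  have hex : ∃ j : ℕ, j ≤ J ∧ f ∈ derivZ (1 : Ordinal.{u}) (j * δ) K ∧
      f ∉ szlenkDerivative (((j : ℝ) + 1) * δ) K := by
    by_contra hcon
    push Not at hcon
    have hall : ∀ j : ℕ, j ≤ J → f ∈ derivZ (1 : Ordinal.{u}) (j * δ) K := by
      intro j
      induction j with
      | zero => intro _; simpa [derivZ_zero] using hf
      | succ j ih =>
        intro hj
        have := hcon j (by omega) (ih (by omega))
        rw [derivZ_of_ne (by positivity), szlenkDerivatives_one]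
        exact_mod_cast this
    have := hcon J le_rfl (hall J le_rfl)
    rw [mem_szlenkDerivative (by positivity)] at this
    obtain ⟨g, hg, g', hg', -, -, h⟩ := this.2 Set.univ univ_mem
    exact absurd h (not_lt.2 (hd g hg g' hg'))
  obtain ⟨j, hj, hfj, hfj'⟩ := hex
  refine ⟨⟨j, by omega⟩, hfj, ?_⟩
  rw [mem_szlenkDerivative (by positivity)] at hfj'
  push Not at hfj'
  obtain ⟨V, hV, h⟩ := hfj' hf
  exact ⟨V, hV, fun g hg hgV => h g hg f hf hgV (mem_of_mem_nhds hV)⟩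

/-- Near a given `f ∈ K`, functionals `h` satisfy h(y) ≤ f(y) + τ/2 and lie within `(j + 1) δ` of
`f`, with `j` the threshold of `f`. Then h(x) = (h - f)(x) + f(x), where the first term is the cost
and the second is small for `x` in a weak neighbourhood of zero. Hence `f` itself serves as `g`, and
by weak-star compactness finitely many such `f`, with one weak neighbourhood, suffice. -/
theorem eventually_drop {K : Set (StrongDual 𝕜 X)} {N : X → ℝ} {δ : ℝ} (hδ : 0 < δ) {J : ℕ}
    (hK : Controlled K N ((J + 1) * δ)) (hN : ∀ x, 0 ≤ N x)
    (a : 𝕜) {τ : ℝ} (hτ : 0 < τ) (y : X) {c : ℝ} (hc : 0 ≤ c) :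
    ∀ᶠ x in weakNhds 𝕜 X, Drop 1 δ J a τ K y ((c : 𝕜) • x) (c * N x) := by
  set P : Set (WeakDual 𝕜 X) → Prop := fun s => ∀ᶠ x in weakNhds 𝕜 X, ∀ f ∈ K,
    StrongDual.toWeakDual f ∈ s → ∃ j : Fin (J + 1), ∃ g ∈ derivZ 1 (j * δ) K,
      RCLike.re (f (y + a • (c : 𝕜) • x)) ≤
        RCLike.re (g y) + ‖a‖ * (c * N x * ((j + 1) * δ)) + τ with hP
  have key : P (StrongDual.toWeakDual '' K) := by
    refine hK.wcompact.induction_on (p := P) ?_ ?_ ?_ ?_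
    · simp [hP]
    · exact fun s t hst ht => ht.mono fun x hx f hf hfs => hx f hf (hst hfs)
    · intro s t hs ht
      filter_upwards [hs, ht] with x h1 h2 f hf hfst
      exact hfst.elim (h1 f hf) (h2 f hf)
    · rintro _ ⟨f, hf, rfl⟩
      obtain ⟨j, hfj, V, hV, hVj⟩ := exists_threshold hδ hK.norm_sub_le hf
      refine ⟨V ∩ {h : WeakDual 𝕜 X | RCLike.re (h y) < RCLike.re (f y) + τ / 2},
        mem_nhdsWithin_of_mem_nhds (inter_mem hV ?_), ?_⟩
      · refine (isOpen_lt (continuous_weakDual_re y) continuous_const).mem_nhds ?_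
        simpa using hτ
      · have hτ' : 0 < τ / 2 / (‖a‖ * c + 1) := by positivity
        filter_upwards [eventually_norm_apply_lt 𝕜 f hτ'] with x hx h hh hhV
        refine ⟨j, f, hfj, ?_⟩
        have h1 : RCLike.re (h y) < RCLike.re (f y) + τ / 2 := hhV.2
        have h2 : ‖(h - f) x‖ ≤ (j + 1) * δ * N x :=
          (hK.apply_le h hh f hf x).trans
            (mul_le_mul_of_nonneg_right (hVj h hh hhV.1) (hN x))
        have hcn : ‖(c : 𝕜)‖ = c := by simp [abs_of_nonneg hc]
        have h3 : RCLike.re (h (a • (c : 𝕜) • x)) ≤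
            ‖a‖ * (c * N x * ((j + 1) * δ)) + τ / 2 := by
          have e1 : h (a • (c : 𝕜) • x) = a * (c * ((h - f) x)) + a * (c * f x) := by
            simp; ring
          rw [e1, map_add]
          refine add_le_add ((RCLike.re_le_norm _).trans ?_) ((RCLike.re_le_norm _).trans ?_)
          · rw [norm_mul, norm_mul, hcn]
            calc ‖a‖ * (c * ‖(h - f) x‖) ≤ ‖a‖ * (c * ((j + 1) * δ * N x)) := by gcongr
              _ = _ := by ring
          · rw [norm_mul, norm_mul, hcn, ← mul_assoc]
            calc ‖a‖ * c * ‖f x‖ ≤ (‖a‖ * c + 1) * (τ / 2 / (‖a‖ * c + 1)) := by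
                  gcongr; linarith
              _ = τ / 2 := by field_simp
        rw [map_add, map_add]
        linarith
  filter_upwards [key] with x hx f hf
  exact hx f hf ⟨f, hf, rfl⟩

/-- Passing to the limit in the order of the derivatives, uniformly for a finite family. -/
theorem exists_order_close {κ I : Type*} [Finite κ] [Nonempty I] [Preorder I] [IsDirectedOrder I]
    {K : κ → Set (StrongDual 𝕜 X)} (hK : ∀ k, WCompact (K k)) (y : κ → X) {β : I → Ordinal.{u}}
    (hβ : Monotone β) {θ : Ordinal.{u}} (hθ : Order.IsSuccLimit θ) (hβθ : ∀ a < θ, ∃ i, a ≤ β i)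
    {τ : ℝ} (hτ : 0 < τ) (δ : ℝ) (J : ℕ) :
    ∃ i, ∀ k, ∀ j : Fin (J + 1), ∀ f ∈ derivZ (β i) (j * δ) (K k),
      ∃ g ∈ derivZ θ (j * δ) (K k), RCLike.re (f (y k)) ≤ RCLike.re (g (y k)) + τ := by
  have hone : ∀ q : κ × Fin (J + 1), ∃ i, ∀ f ∈ derivZ (β i) (q.2 * δ) (K q.1),
      ∃ g ∈ derivZ θ (q.2 * δ) (K q.1),
        RCLike.re (f (y q.1)) ≤ RCLike.re (g (y q.1)) + τ := by
    rintro ⟨k, j⟩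
    by_cases hj : (j : ℝ) * δ = 0
    · simp only [hj, derivZ_zero]
      exact ⟨Classical.arbitrary I, fun f hf => ⟨f, hf, by linarith⟩⟩
    · simp only [derivZ_of_ne hj]
      obtain ⟨i, hi⟩ := exists_le_of_directed (𝕜 := 𝕜) (X := X)
        (F := fun i => szlenkDerivatives (j * δ) (K k) (β i))
        (directed_of_isDirected_le fun i i' h => szlenkDerivatives_anti _ _ (hβ h))
        (fun i => (hK k).szlenkDerivatives _ _) (y k) hτ
      refine ⟨i, fun f hf => ?_⟩
      obtain ⟨g, hg, h⟩ := hi f hf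
      refine ⟨g, ?_, h⟩
      rw [szlenkDerivatives_limit _ _ hθ]
      simp only [Set.mem_iInter] at hg ⊢
      intro a ha
      obtain ⟨i', hi'⟩ := hβθ a ha
      exact szlenkDerivatives_anti _ _ hi' (hg i')
  choose i hi using hone
  obtain ⟨M, hM⟩ := Finite.exists_le i
  refine ⟨M, fun k j f hf => hi (k, j) f ?_⟩
  by_cases hj : (j : ℝ) * δ = 0
  · simpa only [hj, derivZ_zero] using hf
  · simp only [derivZ_of_ne hj] at hf ⊢
    exact szlenkDerivatives_anti _ _ (hβ (hM (k, j))) hf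

theorem list_sum_fst {ι : Type*} (h : List (X × (ι → ℝ))) :
    h.sum.1 = ∑ m ∈ Finset.range h.length, (h.getD m 0).1 := by
  induction h with
  | nil => simp
  | cons v h ih => rw [List.sum_cons, List.length_cons, Finset.sum_range_succ']; simp [ih, add_comm]

theorem list_sum_snd {ι : Type*} (h : List (X × (ι → ℝ))) (i : ι) :
    h.sum.2 i = ∑ m ∈ Finset.range h.length, (h.getD m 0).2 i := by
  induction h with
  | nil => simp
  | cons v h ih => rw [List.sum_cons, List.length_cons, Finset.sum_range_succ']; simp [ih, add_comm]

theorem getD_take {α : Type*} (h : List α) {k m : ℕ} (hm : m < k) (d : α) :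
    (h.take k).getD m d = h.getD m d := by
  simp [List.getD_eq_getElem?_getD, hm]

/-- The main estimate: on `Γ_{ξ,1}` we can choose a branch along which the maxima over finitely many
sets drop to maxima over derivatives of order `ω ^ ξ`. -/
theorem gameT_drop {ι : Type*} {N : ι → X → ℝ} (hN : ∀ i x, 0 ≤ N i x ∧ N i x ≤ ‖x‖) {δ : ℝ}
    (hδ : 0 < δ) (J : ℕ) (a : 𝕜) (ξ : Ordinal.{u}) {c : ℝ} (hc : 0 < c) {τ : ℝ} (hτ : 0 < τ)
    {κ : Type u} [Finite κ] (i : κ → ι) (K : κ → Set (StrongDual 𝕜 X))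
    (hK : ∀ k, Controlled (K k) (N (i k)) ((J + 1) * δ)) (y : κ → X) :
    gameT 𝕜 (recordStep 𝕜 N) ξ c fun v =>
      ∀ k, Drop (ω ^ ξ) δ J a τ (K k) (y k) v.1 (v.2 (i k)) := by
  induction ξ using Ordinal.limitRecOn generalizing c τ κ with
  | zero =>
    rw [gameT_zero]
    simp only [opow_zero, recordStep]
    have := (eventually_all (ι := κ)).2 fun k =>
      eventually_drop hδ (hK k) (fun x => (hN (i k) x).1) a hτ (y k) hc.le
    exact this.mono fun x hx _ => hx
  | add_one ξ ih =>
    have hlim : Order.IsSuccLimit ((ω : Ordinal.{u}) ^ (ξ + 1)) :=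
      isSuccLimit_opow_left isSuccLimit_omega0 (by simp)
    -- Since ω ^ (ξ+1) is the supremum of the ω ^ ξ · M, some finite `M` gives maxima that are
    -- within τ/2 of the final ones. The rest of the error is τ/4 from the `n` rounds together and
    -- τ/4 from the exceptional rounds.
    obtain ⟨M, hM⟩ := exists_order_close (I := ℕ) (β := fun n => ω ^ ξ * (n : Ordinal.{u}))
      (fun k => (hK k).wcompact) y
      (fun n m h => by
        have : (n : Ordinal.{u}) ≤ m := by exact_mod_cast h
        show ω ^ ξ * (n : Ordinal.{u}) ≤ ω ^ ξ * (m : Ordinal.{u})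
        gcongr) hlim
      (fun b hb => by
        rw [opow_add, opow_one] at hb
        obtain ⟨n, hn, hbn⟩ := (Ordinal.lt_mul_iff_of_isSuccLimit isSuccLimit_omega0).1 hb
        obtain ⟨n, rfl⟩ := lt_omega0.1 hn
        exact ⟨n, hbn.le⟩) (half_pos hτ) δ J
    -- The inequality `M ≤ n` is for the pigeonhole argument; the second bound makes the at most `M`
    -- exceptional rounds, each of weight `c / n`, cost at most τ/4 in total.
    obtain ⟨n, hn⟩ := exists_nat_gt (max (M : ℝ) (‖a‖ * (M * (c * ((J + 1) * δ))) / (τ / 4)))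
    have hnM : M ≤ n := by exact_mod_cast ((le_max_left _ _).trans_lt hn).le
    have hn0 : (0 : ℝ) < n := (le_max_left _ _).trans_lt hn |>.trans_le' (by positivity)
    have hn1 : 1 ≤ n := by exact_mod_cast hn0
    have hsmall : ‖a‖ * (M * (c / n * ((J + 1) * δ))) ≤ τ / 4 := by
      have := ((le_max_right _ _).trans_lt hn).le
      rw [div_le_iff₀ (by positivity)] at this
      rw [show ‖a‖ * (M * (c / n * ((J + 1) * δ))) = ‖a‖ * (M * (c * ((J + 1) * δ))) / n by
        ring, div_le_iff₀ hn0]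
      linarith
    rw [gameT_succ]
    refine ⟨n, hn1, ?_⟩
    have hcn : 0 < c / n := by positivity
    -- The induction hypothesis is applied to the finite family of all derivatives of the `K k` that
    -- the remaining rounds may produce, at the points reached so far.
    have hstep : ∀ h : List (X × (ι → ℝ)), h.length < n →
        gameT 𝕜 (recordStep 𝕜 N) ξ (c / n) fun v =>
          (∀ q : κ × List.Vector (Fin (J + 1)) (n - h.length - 1),
            Drop (ω ^ ξ) δ J a (τ / 4 / n) (derivList (ω ^ ξ) (gridList δ q.2.1) (K q.1))
              (y q.1 + a • h.sum.1) v.1 (v.2 (i q.1))) ∧ ∀ i, 0 ≤ v.2 i ∧ v.2 i ≤ c / n := by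
      intro h _
      refine gameT_inv 𝕜 _ (fun c (v : X × (ι → ℝ)) => ∀ i, 0 ≤ v.2 i ∧ v.2 i ≤ c) (by simp) ?_ ?_ ξ hcn.le _ ?_
      · intro c c' v v' _ _ h1 h2 i
        exact ⟨add_nonneg (h1 i).1 (h2 i).1, add_le_add (h1 i).2 (h2 i).2⟩
      · intro c x hc hx i
        have := hN i x
        exact ⟨mul_nonneg hc this.1, mul_le_of_le_one_right hc (this.2.trans hx)⟩
      · let e : ULift.{u} (List.Vector (Fin (J + 1)) (n - h.length - 1)) ≃ _ := Equiv.ulift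
        refine gameT_mono 𝕜 _ ξ _ _ _ (fun v hv q => hv (q.1, e.symm q.2))
          (ih (κ := κ × ULift.{u} (List.Vector (Fin (J + 1)) (n - h.length - 1)))
            hcn (τ := τ / 4 / n) (by positivity) (fun q => i q.1)
            (fun q => derivList (ω ^ ξ) (gridList δ q.2.down.1) (K q.1))
            (fun q => (hK q.1).derivList _) (fun q => y q.1 + a • h.sum.1))
    refine hist_mono (gameT_mono 𝕜 _ ξ _) n ?_ (hist_of_step (gameT_mono 𝕜 _ ξ _) n 0 _ hstep)
    rintro H ⟨hlen, hH⟩ k f hf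
    obtain ⟨l, hl, g, hg, hfg⟩ := telescope (𝕜 := 𝕜) (η := ω ^ ξ) (δ := δ) (J := J)
      (a := fun _ => a)
      (τ := fun _ => τ / 4 / n) (y := y k) (z := fun m => (H.getD m 0).1)
      (w := fun m => (H.getD m 0).2 (i k)) (n := n) (k := 0) (Nat.zero_le n)
      (fun m _ hm l hl => by
        have := (hH m hm).1 (k, ⟨l, by rw [hl, List.length_take, hlen, min_eq_left hm.le]⟩)
        have e1 : ∑ i ∈ Finset.range m, a • (H.getD i 0).1 = a • (H.take m).sum.1 := by
          rw [list_sum_fst, List.length_take, hlen, min_eq_left hm.le, Finset.smul_sum]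
          exact Finset.sum_congr rfl fun i hi => by rw [getD_take _ (Finset.mem_range.1 hi)]
        rw [e1]
        exact this) hf
    have hsum : ∑ i ∈ Finset.range n, a • (H.getD i 0).1 = a • H.sum.1 := by
      rw [list_sum_fst, hlen, Finset.smul_sum]
    rw [hsum] at hfg
    simp only [Finset.range_zero, Finset.sum_empty, add_zero, Nat.sub_zero, zero_add] at hfg hl
    -- The threshold `j` is reached in at least `M` rounds, so for `j ≠ 0` the functional `g`
    -- survives a derivative of order ω ^ ξ · M at level `j δ`, and `hM` moves it to order ω ^
    -- (ξ+1).
    obtain ⟨j, hjM, hj⟩ := exists_countP_ge hnM l hl hδ.le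
      (fun m => (H.getD m 0).2 (i k)) (fun m hm => (hH m hm).2 (i k)) hcn.le
    rw [← hlen, ← list_sum_snd, hlen] at hj
    obtain ⟨g', hg', hgg'⟩ := hM k j g (by
      by_cases h0 : (j : ℕ) = 0
      · rw [h0]
        simp only [Nat.cast_zero, zero_mul, derivZ_zero]
        exact derivList_subset _ hg
      · rw [derivZ_of_ne (by positivity)]
        refine szlenkDerivatives_anti _ _ ?_ (derivList_subset_szlenkDerivatives hδ l j h0 hg)
        have : (M : Ordinal.{u}) ≤ ((l.countP fun i => j ≤ i : ℕ) : Ordinal.{u}) := by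
          exact_mod_cast hjM h0
        gcongr)
    refine ⟨j, g', hg', ?_⟩
    have hsplit : ∑ m ∈ Finset.range n, (‖a‖ * ((H.getD m 0).2 (i k) *
        (((l.getD m 0 : Fin (J + 1)) + 1) * δ)) + τ / 4 / n) =
        ‖a‖ * ∑ m ∈ Finset.range n, ((H.getD m 0).2 (i k) *
          (((l.getD m 0 : Fin (J + 1)) + 1) * δ)) + τ / 4 := by
      rw [Finset.sum_add_distrib, ← Finset.mul_sum, Finset.sum_const, Finset.card_range,
        _root_.nsmul_eq_mul, mul_div_cancel₀ _ hn0.ne']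
    rw [hsplit] at hfg
    have := mul_le_mul_of_nonneg_left hj (norm_nonneg a)
    rw [mul_add] at this
    linarith
  | limit ξ hξ ih =>
    have hlim : Order.IsSuccLimit ((ω : Ordinal.{u}) ^ ξ) :=
      isSuccLimit_opow one_lt_omega0 hξ
    have : Nonempty (Set.Iio ξ) := ⟨⟨0, hξ.bot_lt⟩⟩
    -- Order ω ^ ζ for some ζ < ξ is already close enough; the game for ζ + 1 yields order ω ^
    -- (ζ+1), which is larger.
    obtain ⟨⟨ζ, hζ⟩, hM⟩ := exists_order_close (I := Set.Iio ξ)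
      (β := fun ζ => ω ^ (ζ : Ordinal.{u}))
      (fun k => (hK k).wcompact) y
      (fun n m h => opow_le_opow_right omega0_pos h) hlim
      (fun b hb => by
        obtain ⟨ζ, hζ, h⟩ := (lt_opow_of_isSuccLimit omega0_ne_zero hξ).1 hb
        exact ⟨⟨ζ, hζ⟩, h.le⟩) (half_pos hτ) δ J
    rw [gameT_limit _ _ hξ]
    refine ⟨ζ, hζ, gameT_mono 𝕜 _ _ _ _ _ (fun v hv k f hf => ?_)
      (ih _ (hξ.add_one_lt hζ) hc (half_pos hτ) i K hK y)⟩
    obtain ⟨j, g, hg, h⟩ := hv k f hf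
    obtain ⟨g', hg', h'⟩ := hM k j g (by
      by_cases hj : (j : ℝ) * δ = 0
      · simpa only [hj, derivZ_zero] using hg
      · simp only [derivZ_of_ne hj] at hg ⊢
        exact szlenkDerivatives_anti _ _
          (opow_le_opow_right omega0_pos (lt_add_one ζ).le) hg)
    exact ⟨j, g', hg', by linarith⟩

end Upper

/-! ### Lower bounds: a winning strategy for the opponent in terms of derivatives -/

section Lower

variable {𝕜 : Type*} [RCLike 𝕜] {X : Type u} [NormedAddCommGroup X] [NormedSpace 𝕜 X]

theorem weakNhds_basis {U : Set X} (hU : U ∈ weakNhds 𝕜 X) :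
    ∃ (F : Finset (StrongDual 𝕜 X)) (τ : ℝ), 0 < τ ∧ ∀ x, (∀ h ∈ F, ‖h x‖ < τ) → x ∈ U := by
  classical
  rw [weakNhds, mem_iInf] at hU
  obtain ⟨I, hI, V, hV, rfl⟩ := hU
  have : ∀ i : I, ∃ τ : ℝ, 0 < τ ∧ ∀ x, ‖i.1 x‖ < τ → x ∈ V i := by
    intro i
    obtain ⟨t, ht, hti⟩ := mem_comap.1 (hV i)
    obtain ⟨τ, hτ, h⟩ := Metric.mem_nhds_iff.1 ht
    exact ⟨τ, hτ, fun x hx => hti (h (by simpa using hx))⟩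
  choose τ hτ hτV using this
  have : Fintype I := hI.fintype
  obtain ⟨τ', hτ', hle⟩ : ∃ τ' : ℝ, 0 < τ' ∧ ∀ i, τ' ≤ τ i := by
    rcases isEmpty_or_nonempty I with h | h
    · exact ⟨1, one_pos, fun i => (h.false i).elim⟩
    · obtain ⟨i, hi⟩ := Finite.exists_min τ
      exact ⟨τ i, hτ i, hi⟩
  refine ⟨hI.toFinset, τ', hτ', fun x hx => Set.mem_iInter.2 fun i => hτV i x ?_⟩
  exact (hx i (hI.mem_toFinset.2 i.2)).trans_le (hle i)

/-- Functionals g far from f but weak-star close to it have witnesses x_g in the ball with Re (g -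
f)(x_g) > ε/2. These witnesses need not be weakly null, but half the difference of two of them on
which finitely many given functionals nearly agree is nearly annihilated by these functionals and
stays in the ball. The estimates lose less than a factor 8, and this 8 persists in all lower bounds.
-/
theorem frequently_of_mem_szlenkDerivative {K : Set (StrongDual 𝕜 X)} {ε : ℝ} (hε : 0 < ε)
    {f : StrongDual 𝕜 X} (hf : f ∈ szlenkDerivative ε K) {V : Set (WeakDual 𝕜 X)}
    (hV : V ∈ 𝓝 (StrongDual.toWeakDual f)) :
    ∃ᶠ x in weakNhds 𝕜 X, ‖x‖ ≤ 1 ∧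
      ∃ g ∈ K, StrongDual.toWeakDual g ∈ V ∧ ε / 8 < RCLike.re (g x) := by
  classical
  rw [frequently_iff]
  intro U hU
  obtain ⟨F₀, τ₀, hτ₀, hFU₀⟩ := weakNhds_basis hU
  set F := insert f F₀ with hF
  set τ := min τ₀ (ε / 100) with hτdef
  have hτ : 0 < τ := lt_min hτ₀ (by positivity)
  rw [mem_szlenkDerivative hε.le] at hf
  -- Of two functionals at distance more than ε, one is at distance more than ε/2 from `f`; hence
  -- `f` is a weak-star cluster point of such functionals.
  set G : Filter (WeakDual 𝕜 X) := 𝓝 (StrongDual.toWeakDual f) ⊓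
    𝓟 (StrongDual.toWeakDual '' {g | g ∈ K ∧ ε / 2 < ‖g - f‖}) with hG
  have hne : G.NeBot := by
    rw [hG, inf_principal_neBot_iff]
    intro W hW
    obtain ⟨g, hg, g', hg', h1, h2, h3⟩ := hf.2 W hW
    have : ‖g - g'‖ ≤ ‖g - f‖ + ‖g' - f‖ := by
      rw [show g - g' = (g - f) - (g' - f) by abel]
      exact norm_sub_le _ _
    rcases lt_or_ge (ε / 2) ‖g - f‖ with h | h
    · exact ⟨_, h1, g, ⟨hg, h⟩, rfl⟩
    · exact ⟨_, h2, g', ⟨hg', by linarith⟩, rfl⟩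
  have hx : ∀ g : WeakDual 𝕜 X, ∃ x : X, ‖x‖ ≤ 1 ∧
      (ε / 2 < ‖StrongDual.toWeakDual.symm g - f‖ →
        ε / 2 < RCLike.re ((StrongDual.toWeakDual.symm g - f) x)) := by
    intro g
    by_cases h : ε / 2 < ‖StrongDual.toWeakDual.symm g - f‖
    · obtain ⟨x, hx1, hx2⟩ :=
        (StrongDual.toWeakDual.symm g - f).exists_lt_apply_of_lt_opNorm h
      set v := (StrongDual.toWeakDual.symm g - f) x with hv
      obtain ⟨c, hc, hcv⟩ : ∃ c : 𝕜, ‖c‖ = 1 ∧ ‖v‖ = c * v :=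
        RCLike.exists_norm_eq_mul_self v
      refine ⟨c • x, by rw [norm_smul, hc, one_mul]; exact hx1.le, fun _ => ?_⟩
      rw [map_smul, _root_.smul_eq_mul, ← hv, ← hcv, RCLike.ofReal_re]
      exact hx2
    · exact ⟨0, by simp, fun h' => absurd h' h⟩
  choose x hx1 hx2 using hx
  let ψ : WeakDual 𝕜 X → (F → 𝕜) := fun g h => h.1 (x g)
  set R : ℝ := ∑ h ∈ F, ‖h‖
  have hψ : ∀ g, ψ g ∈ Metric.closedBall (0 : F → 𝕜) R := by
    intro g
    rw [mem_closedBall_zero_iff, pi_norm_le_iff_of_nonneg (by positivity)]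
    intro h
    calc ‖h.1 (x g)‖ ≤ ‖h.1‖ * ‖x g‖ := h.1.le_opNorm _
      _ ≤ ‖h.1‖ * 1 := by gcongr; exact hx1 g
      _ ≤ R := by
        rw [mul_one]
        exact Finset.single_le_sum (f := fun h => ‖h‖) (fun _ _ => norm_nonneg _) h.2
  -- The values of the functionals in `F` at the witnesses stay in a compact set. Around a cluster
  -- point there are first `g₁` and then `g`, chosen later so that it is also close to `f` at the
  -- witness of `g₁`.
  obtain ⟨q, -, hq⟩ := (isCompact_closedBall (0 : F → 𝕜) R).exists_mapClusterPt
    (f := G) (u := ψ) (tendsto_principal.2 (Eventually.of_forall hψ))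
  have hfreq : ∃ᶠ g in G, ψ g ∈ Metric.ball q τ :=
    hq.frequently (Metric.ball_mem_nhds q hτ)
  have hmem : ∀ᶠ g in G, ε / 2 < ‖StrongDual.toWeakDual.symm g - f‖ ∧
      StrongDual.toWeakDual.symm g ∈ K := by
    refine mem_inf_of_right (mem_principal.2 ?_)
    rintro _ ⟨g, hg, rfl⟩
    exact ⟨by simpa using hg.2, by simpa using hg.1⟩
  obtain ⟨g₁, hg₁, hg₁'⟩ := (hfreq.and_eventually hmem).exists
  have hnear : ∀ᶠ g in G, |RCLike.re (g (x g₁)) - RCLike.re (f (x g₁))| < ε / 100 := by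
    refine mem_inf_of_left ?_
    have := ((continuous_weakDual_re (𝕜 := 𝕜) (x g₁)).tendsto (StrongDual.toWeakDual f))
    exact this.eventually (Metric.ball_mem_nhds _ (by positivity))
  have hVe : ∀ᶠ g in G, g ∈ V := mem_inf_of_left hV
  obtain ⟨g, ⟨⟨hg, hgε, hgK⟩, hgn⟩, hgV⟩ :=
    (((hfreq.and_eventually hmem).and_eventually hnear).and_eventually hVe).exists
  -- As `f ∈ F`, f(z) is negligible, and 2 Re g(z) is up to small errors Re (g - f)(x_g) > ε/2.
  set z : X := ((1 / 2 : ℝ) : 𝕜) • (x g - x g₁) with hz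
  have hzF : ∀ h ∈ F, ‖h z‖ < τ := by
    intro h hh
    have h1 : ‖h (x g) - h (x g₁)‖ < 2 * τ := by
      have h2 : dist (ψ g) (ψ g₁) < τ + τ :=
        (dist_triangle_right _ _ q).trans_lt (add_lt_add hg hg₁)
      have h3 := (dist_le_pi_dist (ψ g) (ψ g₁) ⟨h, hh⟩).trans_lt h2
      rw [dist_eq_norm] at h3
      linarith
    rw [hz, map_smul, map_sub, norm_smul, RCLike.norm_ofReal, abs_of_pos (by norm_num)]
    linarith
  refine ⟨z, hFU₀ z fun h hh => (hzF h (Finset.mem_insert_of_mem hh)).trans_le (min_le_left _ _),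
    ?_, StrongDual.toWeakDual.symm g, hgK, by simpa using hgV, ?_⟩
  · rw [hz, norm_smul, RCLike.norm_ofReal, abs_of_pos (by norm_num)]
    have := norm_sub_le (x g) (x g₁)
    linarith [hx1 g, hx1 g₁]
  · have h1 := hx2 g hgε
    have h2 := (hzF f (Finset.mem_insert_self _ _)).trans_le (min_le_right _ _)
    have h3 := abs_lt.1 ((RCLike.abs_re_le_norm _).trans_lt h2)
    have h4 := abs_lt.1 hgn
    have e1 : RCLike.re (f z) = 1 / 2 * (RCLike.re (f (x g)) - RCLike.re (f (x g₁))) := by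
      rw [hz, map_smul, map_sub, _root_.smul_eq_mul, RCLike.re_ofReal_mul, map_sub]
    have e2 : RCLike.re ((StrongDual.toWeakDual.symm g) z) =
        1 / 2 * (RCLike.re (g (x g)) - RCLike.re (g (x g₁))) := by
      rw [hz, map_smul, map_sub, _root_.smul_eq_mul, RCLike.re_ofReal_mul, map_sub]
      rfl
    have e3 : RCLike.re ((StrongDual.toWeakDual.symm g - f) (x g)) =
        RCLike.re (g (x g)) - RCLike.re (f (x g)) := by
      rw [_root_.sub_apply, map_sub]
      rfl
    rw [e2]
    rw [e3] at h1
    rw [e1] at h3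
    linarith

variable (𝕜) in
/-- One step of the game that records the vector. -/
noncomputable def vecStep (c : ℝ) (x : X) : X := (c : 𝕜) • x

/-- A vector on which the functional takes a value above the threshold; for the threshold zero, the
vector zero. -/
def Above (c : ℝ) (g : StrongDual 𝕜 X) (ε : ℝ) (z : X) : Prop :=
  (ε = 0 → z = 0) ∧ (ε ≠ 0 → c * ε / 8 < RCLike.re (g z))

/-- The opponent may always play the vector zero, which lies in every weak neighbourhood of zero.
This handles levels with threshold 0. -/
theorem gameS_of_zero (ξ : Ordinal.{u}) (c : ℝ) (Q : X → Prop) (hQ : Q 0) :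
    gameS 𝕜 (vecStep 𝕜) ξ c Q := by
  induction ξ using Ordinal.limitRecOn generalizing c Q with
  | zero =>
    rw [gameS_zero, frequently_iff]
    intro U hU
    obtain ⟨F, τ, hτ, h⟩ := weakNhds_basis hU
    exact ⟨0, h 0 (by simpa using fun _ _ => hτ), by simp, by simpa [vecStep] using hQ⟩
  | add_one ξ ih =>
    rw [gameS_succ]
    intro n _
    have : ∀ (n : ℕ) (c : ℝ) (Q : List X → Prop), (∀ h, (∀ v ∈ h, v = 0) → Q h) →
        hist (gameS 𝕜 (vecStep 𝕜) ξ c) n Q := by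
      intro n c
      induction n with
      | zero => exact fun Q hQ => hQ [] (by simp)
      | succ n ihn =>
        exact fun Q hQ => ih c _ (ihn _ fun h hh => hQ _ (by simpa using hh))
    refine this n _ _ fun h hh => ?_
    rw [List.sum_eq_zero hh]
    exact hQ
  | limit ξ hξ ih =>
    rw [gameS_limit _ _ hξ]
    exact fun ζ hζ => ih _ (hξ.add_one_lt hζ) c Q hQ

/-- The outermost derivative is used first: one block yields `z` and a functional that is large at
`z` and still lies in the remaining iterated derivative. The next block starts from this functional.
-/
theorem hist_gameS_of_step {ξ : Ordinal.{u}} {c : ℝ}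
    (hstep : ∀ (K : Set (StrongDual 𝕜 X)) (ε : ℝ), 0 < ε →
      ∀ f ∈ szlenkDerivatives ε K (ω ^ ξ), ∀ V ∈ 𝓝 (StrongDual.toWeakDual f), ∀ Q : X → Prop,
        (∀ g ∈ K, StrongDual.toWeakDual g ∈ V → ∀ z, c * ε / 8 < RCLike.re (g z) → Q z) →
          gameS 𝕜 (vecStep 𝕜) ξ c Q)
    (l : List ℝ) (hl : ∀ ε ∈ l, 0 ≤ ε) (K : Set (StrongDual 𝕜 X)) {f : StrongDual 𝕜 X}
    (hf : f ∈ derivList (ω ^ ξ) l K) {V : Set (WeakDual 𝕜 X)}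
    (hV : V ∈ 𝓝 (StrongDual.toWeakDual f)) (Q : List X → Prop)
    (hQ : ∀ g ∈ K, StrongDual.toWeakDual g ∈ V → ∀ h, List.Forall₂ (Above c g) l h → Q h) :
    hist (gameS 𝕜 (vecStep 𝕜) ξ c) l.length Q := by
  induction l generalizing f V Q with
  | nil => exact hQ f hf (mem_of_mem_nhds hV) [] .nil
  | cons ε l ih =>
    rw [List.forall_mem_cons] at hl
    rw [derivList_cons] at hf
    rcases eq_or_ne ε 0 with rfl | hε
    · rw [derivZ_zero] at hf
      refine gameS_of_zero ξ c _ (ih hl.2 hf hV _ fun g hg hgV h hh => hQ g hg hgV _ (.cons ?_ hh))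
      exact ⟨fun _ => rfl, fun h => absurd rfl h⟩
    · rw [derivZ_of_ne hε] at hf
      refine hstep _ ε (hl.1.lt_of_ne' hε) f hf (interior V) (interior_mem_nhds.2 hV) _
        fun g hg hgV z hz => ?_
      -- Being large at `z` is a weak-star open condition. It is added to the neighbourhood, so that
      -- the functionals of all later blocks stay large at the earlier vectors.
      have hz' : {h : WeakDual 𝕜 X | c * ε / 8 < RCLike.re (h z)} ∈
          𝓝 (StrongDual.toWeakDual g) :=
        (isOpen_lt continuous_const (continuous_weakDual_re z)).mem_nhds hz
      refine ih hl.2 hg (inter_mem (mem_interior_iff_mem_nhds.1 hgV) hz') _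
        fun g' hg' hgV' h hh => hQ g' hg' hgV'.1 _ (.cons ?_ hh)
      exact ⟨fun h => absurd h hε, fun _ => hgV'.2⟩

theorem derivList_replicate {η : Ordinal.{u}} {ε : ℝ} (hε : ε ≠ 0) (K : Set (StrongDual 𝕜 X))
    (n : ℕ) : derivList η (List.replicate n ε) K = szlenkDerivatives ε K (η * n) := by
  induction n with
  | zero => simp [derivList_nil, szlenkDerivatives_zero]
  | succ n ih =>
    rw [List.replicate_succ, derivList_cons, derivZ_of_ne hε, ih, ← szlenkDerivatives_add,
      Nat.cast_add, Nat.cast_one, mul_add, mul_one]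

/-- As ω ^ ξ · n ≤ ω ^ (ξ+1), a functional in the derivative of order ω ^ (ξ+1) survives `n`
derivatives of order ω ^ ξ, whatever `n` is prescribed; the `n` blocks contribute more than (c/n)
ε/8 each. At a limit, order ω ^ ξ contains all orders ω ^ (ζ+1) with ζ < ξ. -/
theorem gameS_of_mem_szlenkDerivatives (ξ : Ordinal.{u}) {c : ℝ} (hc : 0 < c)
    (K : Set (StrongDual 𝕜 X)) (ε : ℝ) (hε : 0 < ε) (f : StrongDual 𝕜 X)
    (hf : f ∈ szlenkDerivatives ε K (ω ^ ξ)) (V : Set (WeakDual 𝕜 X))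
    (hV : V ∈ 𝓝 (StrongDual.toWeakDual f)) (Q : X → Prop)
    (hQ : ∀ g ∈ K, StrongDual.toWeakDual g ∈ V → ∀ z, c * ε / 8 < RCLike.re (g z) → Q z) :
    gameS 𝕜 (vecStep 𝕜) ξ c Q := by
  induction ξ using Ordinal.limitRecOn generalizing c K ε f V Q with
  | zero =>
    rw [opow_zero, szlenkDerivatives_one] at hf
    rw [gameS_zero]
    refine (frequently_of_mem_szlenkDerivative hε hf hV).mono ?_
    rintro x ⟨hx, g, hg, hgV, h⟩
    refine ⟨hx, hQ g hg hgV _ ?_⟩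
    rw [vecStep, map_smul, _root_.smul_eq_mul, RCLike.re_ofReal_mul, mul_div_assoc]
    gcongr
  | add_one ξ ih =>
    rw [gameS_succ]
    intro n hn
    have hn0 : (0 : ℝ) < n := by exact_mod_cast hn
    have hcn : 0 < c / n := by positivity
    have hle : ω ^ ξ * (n : Ordinal.{u}) ≤ ω ^ (ξ + 1) := by
      rw [opow_add, opow_one]
      gcongr
      exact (natCast_lt_omega0 n).le
    have hf' := szlenkDerivatives_anti _ _ hle hf
    rw [← derivList_replicate hε.ne'] at hf'
    have := hist_gameS_of_step (fun K ε hε' f hf V hV Q hQ => ?_) (List.replicate n ε)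
      (by simp [hε.le]) K hf' hV (fun h => Q h.sum) (fun g hg hgV h hh => ?_) (ξ := ξ)
      (c := c / n)
    · rwa [List.length_replicate] at this
    · exact ih hcn K ε hε' f hf V hV Q hQ
    · refine hQ g hg hgV _ ?_
      have key : ∀ (m : ℕ) (h : List X), List.Forall₂ (Above (c / n) g) (List.replicate m ε) h →
          (m = 0 → h.sum = 0) ∧ (m ≠ 0 → m * (c / n * ε / 8) < RCLike.re (g h.sum)) := by
        intro m
        induction m with
        | zero => rintro _ ⟨⟩; simp
        | succ m ihm =>
          intro h hh
          rw [List.replicate_succ] at hh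
          cases hh with
          | cons hz hh =>
            rename_i z h
            refine ⟨by simp, fun _ => ?_⟩
            have h1 := hz.2 hε.ne'
            rw [List.sum_cons, map_add, map_add]
            push_cast
            rcases eq_or_ne m 0 with hm | hm
            · rw [(ihm h hh).1 hm, hm]
              simpa using h1
            · have := (ihm h hh).2 hm
              linarith
      have := (key n h hh).2 (by omega)
      have e : n * (c / n * ε / 8) = c * ε / 8 := by field_simp
      linarith
  | limit ξ hξ ih =>
    rw [gameS_limit _ _ hξ]
    intro ζ hζ
    refine ih _ (hξ.add_one_lt hζ) hc K ε hε f
      (szlenkDerivatives_anti _ _ (opow_le_opow_right omega0_pos (hξ.add_one_lt hζ).le) hf) V hV Q hQ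

/-- If the iterated derivative is non-empty, then the opponent can ensure that a functional in `K`
is large on all levels. -/
theorem hist_gameS_of_mem_derivList (ξ : Ordinal.{u}) (l : List ℝ) (hl : ∀ ε ∈ l, 0 ≤ ε)
    (K : Set (StrongDual 𝕜 X)) (hK : (derivList (ω ^ ξ) l K).Nonempty) :
    hist (gameS 𝕜 (vecStep 𝕜) ξ 1) l.length fun h =>
      ∃ g ∈ K, List.Forall₂ (fun ε z => ε / 8 ≤ RCLike.re (g z)) l h := by
  obtain ⟨f, hf⟩ := hK
  refine hist_gameS_of_step (gameS_of_mem_szlenkDerivatives ξ one_pos) l hl K hf univ_mem _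
    fun g hg _ h hh => ⟨g, hg, hh.imp fun ε z hz => ?_⟩
  rcases eq_or_ne ε 0 with h0 | h0
  · simp [h0, hz.1 h0]
  · simpa using (hz.2 h0).le

end Lower

/-! ### Combinatorics of the trees -/

section Trees

theorem prefix_append_cases {α : Type*} {s a b : List α} (h : s <+: a ++ b) :
    s <+: a ∨ ∃ c, c ≠ [] ∧ c <+: b ∧ s = a ++ c := by
  obtain ⟨r, hr⟩ := h
  rcases List.append_eq_append_iff.1 hr with ⟨a', ha, -⟩ | ⟨c, hc, hb⟩
  · exact Or.inl ⟨a', ha.symm⟩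
  · rcases eq_or_ne c [] with rfl | hne
    · exact Or.inl ⟨[], by simp [hc]⟩
    · exact Or.inr ⟨c, hne, ⟨r, hb.symm⟩, hc⟩

theorem shift_append (δ : Ordinal.{u}) (s t : List Ordinal.{u}) :
    shift δ (s ++ t) = shift δ s ++ shift δ t := by simp [shift]

theorem shift_injective (δ : Ordinal.{u}) : Function.Injective (shift δ) :=
  List.map_injective_iff.2 fun _ _ h => add_left_cancel h

theorem prefix_shift {δ : Ordinal.{u}} {s t : List Ordinal.{u}} :
    s <+: shift δ t ↔ ∃ r, r <+: t ∧ s = shift δ r := by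
  constructor
  · intro h
    exact ⟨t.take s.length, List.take_prefix _ _, by
      rw [shift, List.map_take]; exact (List.prefix_iff_eq_take.1 h)⟩
  · rintro ⟨r, ⟨q, rfl⟩, rfl⟩
    exact ⟨shift δ q, (shift_append _ _ _).symm⟩

theorem shift_prefix_shift {δ : Ordinal.{u}} {s t : List Ordinal.{u}} :
    shift δ s <+: shift δ t ↔ s <+: t := by
  rw [prefix_shift]
  constructor
  · rintro ⟨r, hr, h⟩
    rwa [shift_injective δ h]
  · exact fun h => ⟨s, h, rfl⟩

theorem mem_shift_iff {δ a : Ordinal.{u}} {s : List Ordinal.{u}} :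
    a ∈ shift δ s ↔ ∃ b ∈ s, a = δ + b := by
  simp [shift, eq_comm]

theorem block_one (δ : Ordinal.{u}) (G : Set (List Ordinal.{u})) (n : ℕ) {t : List Ordinal.{u}} :
    t ∈ block δ G (n + 1) 1 ↔ ∃ a ∈ G, t = shift (δ * n) a := by
  constructor
  · rintro ⟨v, hv, -, rfl⟩
    exact ⟨v 0, hv 0 one_pos, by simp⟩
  · rintro ⟨a, ha, rfl⟩
    exact ⟨fun _ => a, fun _ _ => ha, fun j hj => absurd hj (by omega), by simp⟩

theorem block_succ (δ : Ordinal.{u}) (G : Set (List Ordinal.{u})) (n i : ℕ)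
    {t : List Ordinal.{u}} :
    t ∈ block δ G (n + 1) (i + 2) ↔
      ∃ a ∈ maxs G, ∃ b ∈ block δ G n (i + 1), t = shift (δ * n) a ++ b := by
  constructor
  · rintro ⟨v, hv, hv', rfl⟩
    refine ⟨v 0, hv' 0 (by omega), _, ⟨fun j => v (j + 1), fun j hj => hv _ (by omega),
      fun j hj => hv' _ (by omega), rfl⟩, ?_⟩
    rw [List.range_succ_eq_map, List.flatMap_cons, List.flatMap_map]
    simp
  · rintro ⟨a, ha, _, ⟨v, hv, hv', rfl⟩, rfl⟩
    refine ⟨fun j => Nat.casesOn j a v, fun j hj => ?_, fun j hj => ?_, ?_⟩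
    · cases j with
      | zero => exact ha.1
      | succ j => exact hv j (by omega)
    · cases j with
      | zero => exact ha
      | succ j => exact hv' j (by omega)
    · rw [List.range_succ_eq_map (n := i + 1), List.flatMap_cons, List.flatMap_map]
      simp

theorem blocks_zero (δ : Ordinal.{u}) (G : Set (List Ordinal.{u})) : blocks δ G 0 = ∅ := by
  ext t
  simp only [blocks, Set.mem_ofPred_eq, Set.mem_empty_iff_false, iff_false]
  rintro ⟨i, h1, h2, -⟩
  omega

/-- With n + 1 blocks the first one is shifted by δ · n, and removing it leaves a sequence of the
same kind for n. All inductions over the levels use this recursion. -/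
theorem mem_blocks_succ (δ : Ordinal.{u}) (G : Set (List Ordinal.{u})) (n : ℕ)
    {t : List Ordinal.{u}} :
    t ∈ blocks δ G (n + 1) ↔ (∃ a ∈ G, t = shift (δ * n) a) ∨
      ∃ a ∈ maxs G, ∃ b ∈ blocks δ G n, t = shift (δ * n) a ++ b := by
  constructor
  · rintro ⟨i, h1, h2, ht⟩
    rcases i with _ | _ | i
    · omega
    · exact Or.inl ((block_one δ G n).1 ht)
    · obtain ⟨a, ha, b, hb, rfl⟩ := (block_succ δ G n i).1 ht
      exact Or.inr ⟨a, ha, b, ⟨i + 1, by omega, by omega, hb⟩, rfl⟩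
  · rintro (h | ⟨a, ha, b, ⟨i, h1, h2, hb⟩, rfl⟩)
    · exact ⟨1, le_rfl, by omega, (block_one δ G n).2 h⟩
    · obtain ⟨i, rfl⟩ : ∃ k, i = k + 1 := ⟨i - 1, by omega⟩
      exact ⟨i + 2, by omega, by omega, (block_succ δ G n i).2 ⟨a, ha, b, hb, rfl⟩⟩

/-- Closed under non-empty initial segments. -/
def PrefixClosed {β : Type*} (T : Set (List β)) : Prop :=
  ∀ t ∈ T, ∀ s, s <+: t → s ≠ [] → s ∈ T

theorem prefixClosed_blocks {δ : Ordinal.{u}} {G : Set (List Ordinal.{u})} (hG : PrefixClosed G)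
    (n : ℕ) : PrefixClosed (blocks δ G n) := by
  induction n with
  | zero => simp [PrefixClosed, blocks_zero]
  | succ n ih =>
    intro t ht s hst hs
    have hone : ∀ a ∈ G, s <+: shift (δ * n) a → s ∈ blocks δ G (n + 1) := by
      intro a ha h
      obtain ⟨r, hr, rfl⟩ := prefix_shift.1 h
      exact (mem_blocks_succ δ G n).2 (Or.inl ⟨r, hG a ha r hr (by rintro rfl; exact hs rfl), rfl⟩)
    rcases (mem_blocks_succ δ G n).1 ht with ⟨a, ha, rfl⟩ | ⟨a, ha, b, hb, rfl⟩
    · exact hone a ha hst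
    · rcases prefix_append_cases hst with h | ⟨c, hc, hcb, rfl⟩
      · exact hone a ha.1 h
      · exact (mem_blocks_succ δ G n).2 (Or.inr ⟨a, ha, c, ih b hb c hcb hc, rfl⟩)

theorem prefixClosed_gammaOne (ξ : Ordinal.{u}) : PrefixClosed (gammaOne ξ) := by
  induction ξ using Ordinal.limitRecOn with
  | zero =>
    rw [gammaOne_zero]
    rintro t rfl s hs hne
    rcases s with _ | ⟨a, s⟩
    · exact absurd rfl hne
    · rw [List.cons_prefix_cons, List.prefix_nil] at hs
      simp [hs.1, hs.2]
  | add_one ξ ih =>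
    rw [gammaOne_succ]
    rintro t ⟨n, hn, ht⟩ s hs hne
    exact ⟨n, hn, prefixClosed_blocks ih n t ht s hs hne⟩
  | limit ξ hξ ih =>
    rw [gammaOne_limit hξ]
    rintro t ⟨ζ, hζ, a, ha, rfl⟩ s hs hne
    obtain ⟨r, hr, rfl⟩ := prefix_shift.1 hs
    exact ⟨ζ, hζ, r, ih _ (hξ.add_one_lt hζ) a ha r hr (by rintro rfl; exact hne rfl), rfl⟩

theorem prefixClosed_gamma (ξ : Ordinal.{u}) (n : ℕ) : PrefixClosed (gamma ξ n) :=
  prefixClosed_blocks (prefixClosed_gammaOne ξ) n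

theorem gamma_zero (ξ : Ordinal.{u}) : gamma ξ 0 = ∅ := blocks_zero _ _

theorem mem_gamma_succ {ξ : Ordinal.{u}} {n : ℕ} {t : List Ordinal.{u}} :
    t ∈ gamma ξ (n + 1) ↔ (∃ a ∈ gammaOne ξ, t = shift (ω ^ ξ * n) a) ∨
      ∃ a ∈ maxs (gammaOne ξ), ∃ b ∈ gamma ξ n, t = shift (ω ^ ξ * n) a ++ b :=
  mem_blocks_succ _ _ _

theorem level_one {ξ : Ordinal.{u}} {n : ℕ} {t : List Ordinal.{u}} :
    t ∈ level ξ (n + 1) 1 ↔ ∃ a ∈ gammaOne ξ, t = shift (ω ^ ξ * n) a := block_one _ _ _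

theorem level_succ {ξ : Ordinal.{u}} {n i : ℕ} {t : List Ordinal.{u}} :
    t ∈ level ξ (n + 1) (i + 2) ↔ ∃ a ∈ maxs (gammaOne ξ), ∃ b ∈ level ξ n (i + 1),
      t = shift (ω ^ ξ * n) a ++ b := block_succ _ _ _ _

theorem level_subset_gamma {ξ : Ordinal.{u}} {n i : ℕ} (hi : i < n) :
    level ξ n (i + 1) ⊆ gamma ξ n := fun _ ht => ⟨i + 1, by omega, by omega, ht⟩

theorem gamma_bounds {ξ : Ordinal.{u}} {n : ℕ} {t : List Ordinal.{u}} (ht : t ∈ gamma ξ n) :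
    t ≠ [] ∧ (∀ a ∈ t, a < ω ^ ξ * n) ∧ ω ^ ξ * ((n - 1 : ℕ) : Ordinal.{u}) ≤ t.headD 0 := by
  obtain ⟨i, hi, hin, ht⟩ := ht
  exact block_bounds (gammaOne_bounds ξ) hi hin ht

theorem gammaOne_nonempty (ξ : Ordinal.{u}) : (gammaOne ξ).Nonempty := by
  induction ξ using Ordinal.limitRecOn with
  | zero => simp [gammaOne_zero]
  | add_one ξ ih =>
    obtain ⟨a, ha⟩ := ih
    rw [gammaOne_succ]
    exact ⟨_, 1, le_rfl, mem_gamma_succ.2 (Or.inl ⟨a, ha, rfl⟩)⟩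
  | limit ξ hξ ih =>
    obtain ⟨a, ha⟩ := ih (0 + 1) (hξ.add_one_lt hξ.bot_lt)
    rw [gammaOne_limit hξ]
    exact ⟨_, 0, hξ.bot_lt, a, ha, rfl⟩

theorem gamma_nonempty (ξ : Ordinal.{u}) (n : ℕ) : (gamma ξ (n + 1)).Nonempty := by
  obtain ⟨a, ha⟩ := gammaOne_nonempty ξ
  exact ⟨_, mem_gamma_succ.2 (Or.inl ⟨a, ha, rfl⟩)⟩

/-- The first block can be read off from the entries: it consists of those that are at least δ. This
makes the decomposition into blocks unique. -/
theorem filter_le_shift_append {δ : Ordinal.{u}} (a : List Ordinal.{u}) {b : List Ordinal.{u}}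
    (hb : ∀ x ∈ b, x < δ) :
    (shift δ a ++ b).filter (fun x => decide (δ ≤ x)) = shift δ a ∧
      (shift δ a ++ b).filter (fun x => decide (x < δ)) = b := by
  rw [List.filter_append, List.filter_append]
  have h1 : (shift δ a).filter (fun x => decide (δ ≤ x)) = shift δ a := by
    rw [List.filter_eq_self]
    intro x hx
    obtain ⟨y, -, rfl⟩ := mem_shift_iff.1 hx
    simp
  have h2 : b.filter (fun x => decide (δ ≤ x)) = [] := by
    rw [List.filter_eq_nil_iff]
    intro x hx
    simpa using hb x hx
  have h3 : (shift δ a).filter (fun x => decide (x < δ)) = [] := by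
    rw [List.filter_eq_nil_iff]
    intro x hx
    obtain ⟨y, -, rfl⟩ := mem_shift_iff.1 hx
    simp
  have h4 : b.filter (fun x => decide (x < δ)) = b := by
    rw [List.filter_eq_self]
    intro x hx
    simpa using hb x hx
  exact ⟨by rw [h1, h2, List.append_nil], by rw [h3, h4, List.nil_append]⟩

theorem prefix_of_shift_append {δ : Ordinal.{u}} {a b a' b' : List Ordinal.{u}}
    (hb : ∀ x ∈ b, x < δ) (hb' : ∀ x ∈ b', x < δ)
    (h : shift δ a ++ b <+: shift δ a' ++ b') : a <+: a' ∧ b <+: b' := by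
  have h1 := h.filter (fun x => decide (δ ≤ x))
  have h2 := h.filter (fun x => decide (x < δ))
  rw [(filter_le_shift_append a hb).1, (filter_le_shift_append a' hb').1] at h1
  rw [(filter_le_shift_append a hb).2, (filter_le_shift_append a' hb').2] at h2
  exact ⟨shift_prefix_shift.1 h1, h2⟩

theorem eq_of_shift_append {δ : Ordinal.{u}} {a b a' b' : List Ordinal.{u}}
    (hb : ∀ x ∈ b, x < δ) (hb' : ∀ x ∈ b', x < δ)
    (h : shift δ a ++ b = shift δ a' ++ b') : a = a' ∧ b = b' := by
  have h1 := prefix_of_shift_append hb hb' ⟨[], by rw [List.append_nil, h]⟩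
  have h2 := prefix_of_shift_append hb' hb ⟨[], by rw [List.append_nil, h]⟩
  exact ⟨h1.1.eq_of_length_le h2.1.length_le, h1.2.eq_of_length_le h2.2.length_le⟩

/-- For `n = 0` no block follows; for `n ≠ 0` a single block can always be prolonged, so both parts
of the decomposition must be maximal. -/
theorem mem_maxs_gamma_succ {ξ : Ordinal.{u}} {n : ℕ} {t : List Ordinal.{u}} :
    t ∈ maxs (gamma ξ (n + 1)) ↔ ∃ a ∈ maxs (gammaOne ξ), ∃ b,
      (n = 0 ∧ b = [] ∨ n ≠ 0 ∧ b ∈ maxs (gamma ξ n)) ∧ t = shift (ω ^ ξ * n) a ++ b := by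
  have hlt : ∀ {b}, (n = 0 ∧ b = [] ∨ n ≠ 0 ∧ b ∈ maxs (gamma ξ n)) → ∀ x ∈ b, x < ω ^ ξ * n := by
    rintro b (⟨-, rfl⟩ | ⟨-, hb⟩)
    · simp
    · exact (gamma_bounds hb.1).2.1
  constructor
  · rintro ⟨ht, hmax⟩
    rcases mem_gamma_succ.1 ht with ⟨a, ha, rfl⟩ | ⟨a, ha, b, hb, rfl⟩
    · have ham : a ∈ maxs (gammaOne ξ) := by
        refine ⟨ha, fun s hs has => ?_⟩
        exact shift_injective _ (hmax _ (mem_gamma_succ.2 (Or.inl ⟨s, hs, rfl⟩))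
          (shift_prefix_shift.2 has))
      refine ⟨a, ham, [], Or.inl ⟨?_, rfl⟩, by simp⟩
      -- Otherwise some member of the non-empty Γ_{ξ,n} could be appended.
      by_contra hn
      obtain ⟨m, rfl⟩ := Nat.exists_eq_succ_of_ne_zero hn
      obtain ⟨b, hb⟩ := gamma_nonempty ξ m
      have := hmax _ (mem_gamma_succ.2 (Or.inr ⟨a, ham, b, hb, rfl⟩)) (List.prefix_append _ _)
      exact (gamma_bounds hb).1 (by simpa using this)
    · refine ⟨a, ha, b, Or.inr ⟨?_, hb, fun s hs hbs => ?_⟩, rfl⟩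
      · rintro rfl
        simp [gamma_zero] at hb
      · have := hmax _ (mem_gamma_succ.2 (Or.inr ⟨a, ha, s, hs, rfl⟩))
          ((List.prefix_append_right_inj _).2 hbs)
        exact List.append_cancel_left this
  · rintro ⟨a, ha, b, hb, rfl⟩
    have hblt := hlt hb
    constructor
    · rcases hb with ⟨-, rfl⟩ | ⟨-, hb⟩
      · exact mem_gamma_succ.2 (Or.inl ⟨a, ha.1, by simp⟩)
      · exact mem_gamma_succ.2 (Or.inr ⟨a, ha, b, hb.1, rfl⟩)
    · intro s hs h
      rcases mem_gamma_succ.1 hs with ⟨a', ha', rfl⟩ | ⟨a', ha', b', hb', rfl⟩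
      · have h' := prefix_of_shift_append (b' := []) hblt (by simp) (by simpa using h)
        rw [ha.2 a' ha' h'.1, List.prefix_nil.1 h'.2, List.append_nil]
      · have h' := prefix_of_shift_append hblt (gamma_bounds hb').2.1 h
        rw [ha.2 a' ha'.1 h'.1]
        rcases hb with ⟨rfl, -⟩ | ⟨-, hb⟩
        · simp [gamma_zero] at hb'
        · rw [hb.2 b' hb' h'.2]

theorem level_unique {ξ : Ordinal.{u}} {n i j : ℕ} {t : List Ordinal.{u}} (hi : i < n)
    (hj : j < n) (h : t ∈ level ξ n (i + 1)) (h' : t ∈ level ξ n (j + 1)) : i = j := by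
  have hmix : ∀ {n i : ℕ} {t : List Ordinal.{u}}, i + 1 < n + 1 → t ∈ level ξ (n + 1) 1 →
      t ∉ level ξ (n + 1) (i + 2) := by
    intro n i t hi h h'
    obtain ⟨a, -, rfl⟩ := level_one.1 h
    obtain ⟨a', -, b, hb, h⟩ := level_succ.1 h'
    have hb' := gamma_bounds (level_subset_gamma (by omega) hb)
    have := (eq_of_shift_append (b := []) (by simp) hb'.2.1 (by simpa using h)).2
    exact hb'.1 this.symm
  induction n generalizing i j t with
  | zero => omega
  | succ n ih =>
    rcases i with _ | i <;> rcases j with _ | j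
    · rfl
    · exact absurd h' (hmix hj h)
    · exact absurd h (hmix hi h')
    · obtain ⟨a, -, b, hb, rfl⟩ := level_succ.1 h
      obtain ⟨a', -, b', hb', e⟩ := level_succ.1 h'
      have := (eq_of_shift_append (gamma_bounds (level_subset_gamma (by omega) hb)).2.1
        (gamma_bounds (level_subset_gamma (by omega) hb')).2.1 e).2
      rw [ih (by omega) (by omega) hb (this ▸ hb')]

theorem exists_level {ξ : Ordinal.{u}} {n : ℕ} {t : List Ordinal.{u}} (ht : t ∈ gamma ξ n) :
    ∃ i < n, t ∈ level ξ n (i + 1) := by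
  obtain ⟨i, h1, h2, ht⟩ := ht
  obtain ⟨i, rfl⟩ : ∃ k, i = k + 1 := ⟨i - 1, by omega⟩
  exact ⟨i, by omega, ht⟩

theorem weight_shift {ξ : Ordinal.{u}} (n : ℕ) {a : List Ordinal.{u}} (ha : a ∈ gammaOne ξ) :
    weight ξ (shift (ω ^ ξ * n) a) = weightOne ξ a := by
  have := weight_eq ξ (n := n + 1) (i := 0) (by omega) (fun _ => a) (fun _ _ => ha)
  simpa using this

theorem weight_shift_append {ξ : Ordinal.{u}} {n : ℕ} {a b : List Ordinal.{u}}
    (ha : a ∈ gammaOne ξ) (hb : b ∈ gamma ξ n) :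
    weight ξ (shift (ω ^ ξ * n) a ++ b) = weight ξ b := by
  obtain ⟨i, hi, v, hv, -, rfl⟩ := exists_level hb
  rw [weight_eq ξ (by omega) v (fun j hj => hv j (by omega))]
  have := weight_eq ξ (n := n + 1) (i := i + 1) (by omega) (fun j => Nat.casesOn j a v) (by
    intro j hj
    cases j with
    | zero => exact ha
    | succ j => exact hv j (by omega))
  rw [List.range_succ_eq_map (n := i + 1), List.flatMap_cons, List.flatMap_map] at this
  simpa using this

/-- The leading entry of a member of Γ_{ξ,n} lies in [ω ^ ξ (n-1), ω ^ ξ n), which determines n. The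
union Γ_{ξ+1,1} of the Γ_{ξ,n} is therefore a disjoint union of unrelated trees. -/
theorem gamma_index_unique {ξ : Ordinal.{u}} {n m : ℕ} {s t : List Ordinal.{u}}
    (hs : s ∈ gamma ξ n) (ht : t ∈ gamma ξ m) (h : s <+: t) : n = m := by
  have key : ∀ {n m : ℕ} {s t : List Ordinal.{u}}, s ∈ gamma ξ n → t ∈ gamma ξ m →
      s.headD 0 = t.headD 0 → n ≤ m := by
    intro n m s t hs ht h
    have h1 := gamma_bounds hs
    have h2 := gamma_bounds ht
    have h3 : t.headD 0 < ω ^ ξ * m := by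
      obtain ⟨b, l, rfl⟩ := List.exists_cons_of_ne_nil h2.1
      exact h2.2.1 _ (by simp)
    have h4 : ((n - 1 : ℕ) : Ordinal.{u}) < m :=
      lt_of_mul_lt_mul_left' ((h1.2.2.trans_eq h).trans_lt h3)
    have h5 : n - 1 < m := by exact_mod_cast h4
    omega
  have he : s.headD 0 = t.headD 0 := by
    obtain ⟨b, l, rfl⟩ := List.exists_cons_of_ne_nil (gamma_bounds hs).1
    obtain ⟨r, rfl⟩ := h
    simp
  exact le_antisymm (key hs ht he) (key ht hs he.symm)

theorem mem_maxs_gammaOne_succ {ξ : Ordinal.{u}} {t : List Ordinal.{u}} :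
    t ∈ maxs (gammaOne (ξ + 1)) ↔ ∃ n, 1 ≤ n ∧ t ∈ maxs (gamma ξ n) := by
  rw [gammaOne_succ]
  constructor
  · rintro ⟨⟨n, hn, ht⟩, hmax⟩
    exact ⟨n, hn, ht, fun s hs => hmax s ⟨n, hn, hs⟩⟩
  · rintro ⟨n, hn, ht, hmax⟩
    refine ⟨⟨n, hn, ht⟩, ?_⟩
    rintro s ⟨m, hm, hs⟩ h
    obtain rfl := gamma_index_unique ht hs h
    exact hmax s hs h

/-- The base ω logarithm of the leading entry of ω ^ ζ + s is ζ. -/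
theorem shift_index_unique {ζ ζ' : Ordinal.{u}} {s t : List Ordinal.{u}}
    (hs : s ∈ gammaOne (ζ + 1)) (ht : t ∈ gammaOne (ζ' + 1))
    (h : shift (ω ^ ζ) s <+: shift (ω ^ ζ') t) : ζ = ζ' := by
  have hlog : ∀ {ζ : Ordinal.{u}} {s : List Ordinal.{u}}, s ∈ gammaOne (ζ + 1) →
      Ordinal.log ω ((shift (ω ^ ζ) s).headD 0) = ζ := by
    intro ζ s hs
    have h := gammaOne_bounds _ s hs
    obtain ⟨b, l, rfl⟩ := List.exists_cons_of_ne_nil h.1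
    have h1 : (ω : Ordinal.{u}) ^ ζ < ω ^ (ζ + 1) :=
      (opow_lt_opow_iff_right one_lt_omega0).2 (lt_add_one ζ)
    have h2 : (ω : Ordinal.{u}) ^ ζ + b < ω ^ (ζ + 1) :=
      (isPrincipal_add_omega0_opow (ζ + 1)) h1 (h.2 b (by simp))
    have hne : (ω : Ordinal.{u}) ^ ζ + b ≠ 0 :=
      ((opow_pos ζ omega0_pos).trans_le le_self_add).ne'
    simp only [shift, List.map_cons, List.headD_cons]
    apply le_antisymm
    · have := (Ordinal.lt_opow_iff_log_lt one_lt_omega0 hne).1 h2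
      exact Order.lt_add_one_iff.1 this
    · exact (Ordinal.opow_le_iff_le_log one_lt_omega0 hne).1 le_self_add
  rw [← hlog hs, ← hlog ht]
  obtain ⟨b, l, rfl⟩ := List.exists_cons_of_ne_nil (gammaOne_bounds _ s hs).1
  obtain ⟨r, hr⟩ := h
  rw [← hr]
  simp [shift]

theorem mem_maxs_gammaOne_limit {ξ : Ordinal.{u}} (hξ : Order.IsSuccLimit ξ)
    {t : List Ordinal.{u}} :
    t ∈ maxs (gammaOne ξ) ↔ ∃ ζ < ξ, ∃ s ∈ maxs (gammaOne (ζ + 1)), t = shift (ω ^ ζ) s := by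
  rw [gammaOne_limit hξ]
  constructor
  · rintro ⟨⟨ζ, hζ, s, hs, rfl⟩, hmax⟩
    refine ⟨ζ, hζ, s, ⟨hs, fun s' hs' h => ?_⟩, rfl⟩
    exact shift_injective _ (hmax _ ⟨ζ, hζ, s', hs', rfl⟩ (shift_prefix_shift.2 h))
  · rintro ⟨ζ, hζ, s, ⟨hs, hmax⟩, rfl⟩
    refine ⟨⟨ζ, hζ, s, hs, rfl⟩, ?_⟩
    rintro _ ⟨ζ', hζ', s', hs', rfl⟩ h
    obtain rfl := shift_index_unique hs hs' h
    rw [hmax s' hs' (shift_prefix_shift.1 h)]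

theorem mem_maxs_withIndex {T : Set (List Ordinal.{u})} {D : Type u} [Nonempty D]
    {t : List (Ordinal.{u} × D)} :
    t ∈ maxs (withIndex T D) ↔ t.map Prod.fst ∈ maxs T := by
  constructor
  · rintro ⟨ht, hmax⟩
    refine ⟨ht, fun s hs h => ?_⟩
    obtain ⟨r, rfl⟩ := h
    have := hmax (t ++ r.map fun a => (a, Classical.arbitrary D))
      (by simpa [withIndex, Function.comp_def] using hs) (List.prefix_append _ _)
    have hr : r = [] := by simpa using this
    simp [hr]
  · rintro ⟨ht, hmax⟩
    refine ⟨ht, ?_⟩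
    rintro s hs ⟨r, rfl⟩
    have := hmax _ hs (by simp)
    have hr : r = [] := by simpa using this
    simp [hr]

end Trees

/-! ### From games to trees -/

section Bridge

variable {D : Type u}

/-- The sequence `δ + t` with the directed set coordinates unchanged. -/
def shiftD (δ : Ordinal.{u}) (t : List (Ordinal.{u} × D)) : List (Ordinal.{u} × D) :=
  t.map fun p => (δ + p.1, p.2)

theorem map_fst_shiftD (δ : Ordinal.{u}) (t : List (Ordinal.{u} × D)) :
    (shiftD δ t).map Prod.fst = shift δ (t.map Prod.fst) := by
  simp [shiftD, shift, Function.comp_def]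

theorem length_shiftD (δ : Ordinal.{u}) (t : List (Ordinal.{u} × D)) :
    (shiftD δ t).length = t.length := by simp [shiftD]

theorem take_shiftD (δ : Ordinal.{u}) (t : List (Ordinal.{u} × D)) (k : ℕ) :
    (shiftD δ t).take k = shiftD δ (t.take k) := by simp [shiftD, List.map_take]

theorem shiftD_append (δ : Ordinal.{u}) (s t : List (Ordinal.{u} × D)) :
    shiftD δ (s ++ t) = shiftD δ s ++ shiftD δ t := by simp [shiftD]

/-- Removes the shift. -/
noncomputable def unshiftD (δ : Ordinal.{u}) (t : List (Ordinal.{u} × D)) :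
    List (Ordinal.{u} × D) :=
  t.map fun p => (p.1 - δ, p.2)

theorem unshiftD_shiftD (δ : Ordinal.{u}) (t : List (Ordinal.{u} × D)) :
    unshiftD δ (shiftD δ t) = t := by
  simp [unshiftD, shiftD, Function.comp_def, Ordinal.add_sub_cancel]

theorem exists_shiftD {δ : Ordinal.{u}} {t : List (Ordinal.{u} × D)} {a : List Ordinal.{u}}
    (h : t.map Prod.fst = shift δ a) : ∃ s, t = shiftD δ s ∧ s.map Prod.fst = a := by
  refine ⟨unshiftD δ t, ?_, ?_⟩
  · rw [shiftD, unshiftD, List.map_map]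
    conv_lhs => rw [← List.map_id t]
    refine List.map_congr_left fun p hp => ?_
    obtain ⟨b, -, hb⟩ := mem_shift_iff.1 (h ▸ List.mem_map_of_mem hp)
    simp only [Function.comp_apply, id]
    rw [hb, Ordinal.add_sub_cancel, ← hb]
  · have : (unshiftD δ t).map Prod.fst = (t.map Prod.fst).map (fun b => b - δ) := by
      simp [unshiftD, Function.comp_def]
    rw [this, h]
    simp [shift, Function.comp_def, Ordinal.add_sub_cancel]

theorem exists_shiftD_append {δ : Ordinal.{u}} {t : List (Ordinal.{u} × D)}
    {a b : List Ordinal.{u}} (h : t.map Prod.fst = shift δ a ++ b) :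
    ∃ s r, t = shiftD δ s ++ r ∧ s.map Prod.fst = a ∧ r.map Prod.fst = b := by
  obtain ⟨t₁, t₂, rfl, h1, h2⟩ := List.map_eq_append_iff.1 h
  obtain ⟨s, rfl, hs⟩ := exists_shiftD h1
  exact ⟨s, t₂, rfl, hs, h2⟩

variable {X V : Type*} [AddCommMonoid V] (e : ℝ → X → V)

/-- The weighted sum along a branch. -/
noncomputable def branchSum (c : ℝ) (P : List Ordinal.{u} → ℝ) (x : List (Ordinal.{u} × D) → X)
    (t : List (Ordinal.{u} × D)) : V :=
  ∑ k ∈ Finset.Icc 1 t.length, e (c * P ((t.take k).map Prod.fst)) (x (t.take k))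

/-- The weighted sum along the part of a branch in the level `i` of `Γ_{ξ,n}`. -/
noncomputable def levelSum (c : ℝ) (ξ : Ordinal.{u}) (n i : ℕ) (x : List (Ordinal.{u} × D) → X)
    (t : List (Ordinal.{u} × D)) : V :=
  open Classical in
  ∑ k ∈ (Finset.Icc 1 t.length).filter (fun k => t.take k ∈ withIndex (level ξ n i) D),
    e (c * weight ξ ((t.take k).map Prod.fst)) (x (t.take k))

theorem take_mem_of_mem {T : Set (List Ordinal.{u})} (hT : PrefixClosed T)
    {t : List (Ordinal.{u} × D)} (ht : t.map Prod.fst ∈ T) {k : ℕ} (h1 : 1 ≤ k)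
    (h2 : k ≤ t.length) : (t.take k).map Prod.fst ∈ T := by
  refine hT _ ht _ ((List.take_prefix k t).map _) fun h => ?_
  have := congrArg List.length h
  simp only [List.length_map, List.length_take, List.length_nil] at this
  omega

/-- `b` is empty or in `Γ_{ξ,n}`. -/
def EmptyOrMem (T : Set (List Ordinal.{u})) (t : List (Ordinal.{u} × D)) : Prop :=
  t = [] ∨ t.map Prod.fst ∈ T

/-- The initial segments in the first level are those contained in the first block, whatever
follows. -/
theorem levelSum_one (c : ℝ) {ξ : Ordinal.{u}} {n : ℕ} (x : List (Ordinal.{u} × D) → X)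
    {s r : List (Ordinal.{u} × D)} (hs : s.map Prod.fst ∈ gammaOne ξ)
    (hr : EmptyOrMem (gamma ξ n) r) :
    levelSum e c ξ (n + 1) 1 x (shiftD (ω ^ ξ * n) s ++ r) =
      branchSum e c (weightOne ξ) (fun q => x (shiftD (ω ^ ξ * n) q)) s := by
  classical
  have htake : ∀ k, k ≤ s.length →
      (shiftD (ω ^ ξ * n) s ++ r).take k = shiftD (ω ^ ξ * n) (s.take k) := by
    intro k hk
    rw [List.take_append_of_le_length (by rwa [length_shiftD]), take_shiftD]
  unfold levelSum branchSum
  have hset : (Finset.Icc 1 (shiftD (ω ^ ξ * n) s ++ r).length).filter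
      (fun k => (shiftD (ω ^ ξ * n) s ++ r).take k ∈ withIndex (level ξ (n + 1) 1) D) =
      Finset.Icc 1 s.length := by
    ext k
    simp only [Finset.mem_filter, Finset.mem_Icc, List.length_append, length_shiftD]
    constructor
    · rintro ⟨⟨h1, h2⟩, h3⟩
      refine ⟨h1, ?_⟩
      by_contra hk
      obtain ⟨j, rfl⟩ : ∃ j, k = (shiftD (ω ^ ξ * n) s).length + j :=
        ⟨k - s.length, by rw [length_shiftD]; omega⟩
      rw [length_shiftD] at h2 hk
      rw [List.take_length_add_append, withIndex, Set.mem_ofPred_eq, List.map_append,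
        map_fst_shiftD] at h3
      obtain ⟨a, -, ha⟩ := level_one.1 h3
      rcases hr with rfl | hr
      · simp only [List.length_nil] at h2
        omega
      · have hb := gamma_bounds (take_mem_of_mem (prefixClosed_gamma ξ n) hr (k := j)
          (by omega) (by omega))
        have := (eq_of_shift_append (b' := []) hb.2.1 (by simp) (by simpa using ha)).2
        exact hb.1 this
    · rintro ⟨h1, h2⟩
      refine ⟨⟨h1, by omega⟩, ?_⟩
      rw [htake k h2, withIndex, Set.mem_ofPred_eq, map_fst_shiftD]
      exact level_one.2 ⟨_, take_mem_of_mem (prefixClosed_gammaOne ξ) hs h1 h2, rfl⟩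
  rw [hset]
  refine Finset.sum_congr rfl fun k hk => ?_
  rw [Finset.mem_Icc] at hk
  rw [htake k hk.2, map_fst_shiftD,
    weight_shift n (take_mem_of_mem (prefixClosed_gammaOne ξ) hs hk.1 hk.2)]

/-- The initial segments in a later level are those that contain the first block and a non-empty
part of the rest; the weight depends on the last block alone. -/
theorem levelSum_succ (c : ℝ) {ξ : Ordinal.{u}} {n i : ℕ} (hi : i < n)
    (x : List (Ordinal.{u} × D) → X)
    {s r : List (Ordinal.{u} × D)} (hs : s.map Prod.fst ∈ maxs (gammaOne ξ))
    (hr : r.map Prod.fst ∈ gamma ξ n) :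
    levelSum e c ξ (n + 1) (i + 2) x (shiftD (ω ^ ξ * n) s ++ r) =
      levelSum e c ξ n (i + 1) (fun q => x (shiftD (ω ^ ξ * n) s ++ q)) r := by
  classical
  have htake : ∀ k, (shiftD (ω ^ ξ * n) s ++ r).take (s.length + k) =
      shiftD (ω ^ ξ * n) s ++ r.take k := by
    intro k
    rw [← length_shiftD (ω ^ ξ * n) s, List.take_length_add_append]
  have hmem : ∀ k, 1 ≤ k → k ≤ r.length →
      (shiftD (ω ^ ξ * n) s ++ r.take k ∈ withIndex (level ξ (n + 1) (i + 2)) D ↔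
        r.take k ∈ withIndex (level ξ n (i + 1)) D) := by
    intro k h1 h2
    have hb := gamma_bounds (take_mem_of_mem (prefixClosed_gamma ξ n) hr h1 h2)
    rw [withIndex, Set.mem_ofPred_eq, List.map_append, map_fst_shiftD, level_succ]
    constructor
    · rintro ⟨a, -, b, hb', h⟩
      have := (eq_of_shift_append hb.2.1
        (gamma_bounds (level_subset_gamma hi hb')).2.1 h).2
      rw [withIndex, Set.mem_ofPred_eq, this]
      exact hb'
    · intro h
      exact ⟨_, hs, _, h, rfl⟩
  unfold levelSum
  symm
  refine Finset.sum_nbij (fun k => s.length + k) ?_ ?_ ?_ ?_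
  · intro k hk
    rw [Finset.mem_filter, Finset.mem_Icc] at hk ⊢
    rw [htake, List.length_append, length_shiftD]
    exact ⟨by omega, (hmem k hk.1.1 hk.1.2).2 hk.2⟩
  · exact fun k _ j _ h => Nat.add_left_cancel h
  · intro k hk
    rw [Finset.mem_coe, Finset.mem_filter, Finset.mem_Icc, List.length_append,
      length_shiftD] at hk
    have hlt : s.length < k := by
      by_contra hk'
      have hk' := not_lt.1 hk'
      have h3 := hk.2
      rw [List.take_append_of_le_length (by rwa [length_shiftD]), take_shiftD, withIndex,
        Set.mem_ofPred_eq, map_fst_shiftD] at h3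
      obtain ⟨a, -, b, hb', h⟩ := level_succ.1 h3
      have hb := gamma_bounds (level_subset_gamma hi hb')
      exact hb.1 (eq_of_shift_append (b := []) (by simp) hb.2.1 (by simpa using h)).2.symm
    obtain ⟨j, rfl⟩ : ∃ j, k = s.length + j := ⟨k - s.length, by omega⟩
    rw [htake] at hk
    refine ⟨j, ?_, rfl⟩
    rw [Finset.mem_coe, Finset.mem_filter, Finset.mem_Icc]
    exact ⟨by omega, (hmem j (by omega) (by omega)).1 hk.2⟩
  · intro k hk
    rw [Finset.mem_filter, Finset.mem_Icc] at hk
    rw [htake, List.map_append, map_fst_shiftD, weight_shift_append hs.1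
      (take_mem_of_mem (prefixClosed_gamma ξ n) hr hk.1.1 hk.1.2)]

theorem sum_levelSum (c : ℝ) {ξ : Ordinal.{u}} {n : ℕ} (x : List (Ordinal.{u} × D) → X)
    {t : List (Ordinal.{u} × D)} (ht : t.map Prod.fst ∈ gamma ξ n) :
    ((List.range n).map fun i => levelSum e c ξ n (i + 1) x t).sum =
      branchSum e c (weight ξ) x t := by
  classical
  have : ((List.range n).map fun i => levelSum e c ξ n (i + 1) x t).sum =
      ∑ i ∈ Finset.range n, levelSum e c ξ n (i + 1) x t := by
    rfl
  rw [this]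
  unfold levelSum branchSum
  simp only [Finset.sum_filter]
  rw [Finset.sum_comm]
  refine Finset.sum_congr rfl fun k hk => ?_
  rw [Finset.mem_Icc] at hk
  obtain ⟨i, hi, hti⟩ := exists_level (take_mem_of_mem (prefixClosed_gamma ξ n) ht hk.1 hk.2)
  rw [Finset.sum_eq_single i]
  · exact if_pos hti
  · intro j hj hji
    exact if_neg fun h => hji (level_unique (Finset.mem_range.1 hj) hi h hti)
  · intro h
    exact absurd (Finset.mem_range.2 hi) h

theorem branchSum_succ (c : ℝ) {ξ : Ordinal.{u}} {n : ℕ} (x : List (Ordinal.{u} × D) → X)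
    {t : List (Ordinal.{u} × D)} (ht : t.map Prod.fst ∈ gamma ξ n) :
    branchSum e c (weightOne (ξ + 1)) x t = branchSum e (c / n) (weight ξ) x t := by
  refine Finset.sum_congr rfl fun k hk => ?_
  rw [Finset.mem_Icc] at hk
  rw [weightOne_succ ξ (take_mem_of_mem (prefixClosed_gamma ξ n) ht hk.1 hk.2)]
  congr 1
  ring

theorem branchSum_limit (c : ℝ) {ξ ζ : Ordinal.{u}} (hξ : Order.IsSuccLimit ξ) (hζ : ζ < ξ)
    (x : List (Ordinal.{u} × D) → X) {s : List (Ordinal.{u} × D)}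
    (hs : s.map Prod.fst ∈ gammaOne (ζ + 1)) :
    branchSum e c (weightOne ξ) x (shiftD (ω ^ ζ) s) =
      branchSum e c (weightOne (ζ + 1)) (fun q => x (shiftD (ω ^ ζ) q)) s := by
  unfold branchSum
  rw [length_shiftD]
  refine Finset.sum_congr rfl fun k hk => ?_
  rw [Finset.mem_Icc] at hk
  rw [take_shiftD, map_fst_shiftD, weightOne_limit hξ hζ
    (take_mem_of_mem (prefixClosed_gammaOne _) hs hk.1 hk.2)]

end Bridge

/-! ### Strategies and branches -/

section Strategies

variable {𝕜 : Type*} [RCLike 𝕜] {X : Type u} [NormedAddCommGroup X] [NormedSpace 𝕜 X]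

section Subtrees

variable {D : Type u} {T T' : Set (List Ordinal.{u})} {x : List (Ordinal.{u} × D) → X}

theorem InBall.comp (hx : InBall T D x) {φ : List (Ordinal.{u} × D) → List (Ordinal.{u} × D)}
    (hφ : ∀ t, t.map Prod.fst ∈ T' → (φ t).map Prod.fst ∈ T) : InBall T' D fun t => x (φ t) :=
  fun t ht => hx _ (hφ t ht)

theorem WeaklyNull.comp [Preorder D] (hx : WeaklyNull 𝕜 T D x)
    {φ φ' : List (Ordinal.{u} × D) → List (Ordinal.{u} × D)} {ψ : Ordinal.{u} → Ordinal.{u}}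
    (hφ : ∀ s ζ v, φ (s ++ [(ζ, v)]) = φ' s ++ [(ψ ζ, v)])
    (hT : ∀ s ζ, s.map Prod.fst ++ [ζ] ∈ T' → (φ' s).map Prod.fst ++ [ψ ζ] ∈ T) :
    WeaklyNull 𝕜 T' D fun t => x (φ t) := by
  intro s ζ hs f
  simp only [hφ]
  exact hx _ _ (hT s ζ hs) f

theorem WeaklyNull.comp_shiftD [Preorder D] (hx : WeaklyNull 𝕜 T D x) (δ : Ordinal.{u})
    (hT : ∀ a ∈ T', shift δ a ∈ T) : WeaklyNull 𝕜 T' D fun t => x (shiftD δ t) :=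
  hx.comp (φ' := shiftD δ) (ψ := fun a => δ + a) (fun s ζ v => by simp [shiftD]) fun s ζ hs => by
    rw [map_fst_shiftD]
    simpa [shift] using hT _ hs

theorem InBall.comp_shiftD (hx : InBall T D x) (δ : Ordinal.{u})
    (hT : ∀ a ∈ T', shift δ a ∈ T) : InBall T' D fun t => x (shiftD δ t) :=
  hx.comp fun t ht => by
    rw [map_fst_shiftD]
    exact hT _ ht

theorem filter_shiftD_append {δ : Ordinal.{u}} (s : List (Ordinal.{u} × D))
    {r : List (Ordinal.{u} × D)} (hr : ∀ a ∈ r.map Prod.fst, a < δ) :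
    (shiftD δ s ++ r).filter (fun p => decide (δ ≤ p.1)) = shiftD δ s ∧
      (shiftD δ s ++ r).filter (fun p => decide (p.1 < δ)) = r := by
  have hr' : ∀ p ∈ r, p.1 < δ := fun p hp => hr _ (List.mem_map_of_mem hp)
  have h1 : (shiftD δ s).filter (fun p => decide (δ ≤ p.1)) = shiftD δ s := by
    rw [List.filter_eq_self]
    intro p hp
    obtain ⟨q, -, rfl⟩ := List.mem_map.1 hp
    simp
  have h2 : r.filter (fun p => decide (δ ≤ p.1)) = [] := by
    rw [List.filter_eq_nil_iff]
    intro p hp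
    simpa using hr' p hp
  have h3 : (shiftD δ s).filter (fun p => decide (p.1 < δ)) = [] := by
    rw [List.filter_eq_nil_iff]
    intro p hp
    obtain ⟨q, -, rfl⟩ := List.mem_map.1 hp
    simp
  have h4 : r.filter (fun p => decide (p.1 < δ)) = r := by
    rw [List.filter_eq_self]
    intro p hp
    simpa using hr' p hp
  rw [List.filter_append, List.filter_append, h1, h2, h3, h4]
  simp

end Subtrees

variable {V : Type*} [AddCommMonoid V] {e : ℝ → X → V}

/-- Below a fixed maximal first block the tree is again a weakly null tree in the ball over Γ_{ξ,n},
on which the remaining rounds are played. The one-block statement is a hypothesis so that this can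
be used within the induction on ξ that proves it. -/
theorem exists_branch_of_hist_of_step {ξ : Ordinal.{u}} {c : ℝ} {D : Type u} [Preorder D]
    (hone : ∀ Q : V → Prop, gameT 𝕜 e ξ c Q → ∀ x : List (Ordinal.{u} × D) → X,
      InBall (gammaOne ξ) D x → WeaklyNull 𝕜 (gammaOne ξ) D x →
        ∃ t, t.map Prod.fst ∈ maxs (gammaOne ξ) ∧ Q (branchSum e c (weightOne ξ) x t))
    (n : ℕ) (Q : List V → Prop) (hQ : hist (gameT 𝕜 e ξ c) (n + 1) Q)
    (x : List (Ordinal.{u} × D) → X) (hb : InBall (gamma ξ (n + 1)) D x)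
    (hw : WeaklyNull 𝕜 (gamma ξ (n + 1)) D x) :
    ∃ t, t.map Prod.fst ∈ maxs (gamma ξ (n + 1)) ∧
      Q ((List.range (n + 1)).map fun i => levelSum e c ξ (n + 1) (i + 1) x t) := by
  induction n generalizing Q x with
  | zero =>
    have hT : ∀ a ∈ gammaOne ξ, shift (ω ^ ξ * ((0 : ℕ) : Ordinal.{u})) a ∈ gamma ξ (0 + 1) :=
      fun a ha => mem_gamma_succ.2 (Or.inl ⟨a, ha, rfl⟩)
    obtain ⟨t, ht, hQt⟩ := hone _ hQ _ (hb.comp_shiftD _ hT) (hw.comp_shiftD _ hT)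
    refine ⟨shiftD _ t, mem_maxs_gamma_succ.2 ⟨_, ht, [], Or.inl ⟨rfl, rfl⟩,
      by rw [map_fst_shiftD, List.append_nil]⟩, ?_⟩
    have := levelSum_one e c x ht.1 (r := []) (n := 0) (Or.inl rfl)
    rw [List.append_nil] at this
    have h2 : Q [levelSum e c ξ (0 + 1) 1 x (shiftD (ω ^ ξ * ((0 : ℕ) : Ordinal.{u})) t)] := by
      rw [this]
      exact hQt
    simpa using h2
  | succ n ih =>
    have hT : ∀ a ∈ gammaOne ξ,
        shift (ω ^ ξ * ((n + 1 : ℕ) : Ordinal.{u})) a ∈ gamma ξ (n + 1 + 1) :=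
      fun a ha => mem_gamma_succ.2 (Or.inl ⟨a, ha, rfl⟩)
    obtain ⟨t, ht, hQt⟩ := hone _ hQ _ (hb.comp_shiftD _ hT) (hw.comp_shiftD _ hT)
    set δ := ω ^ ξ * ((n + 1 : ℕ) : Ordinal.{u}) with hδ
    have hT' : ∀ b ∈ gamma ξ (n + 1), (shiftD δ t).map Prod.fst ++ b ∈ gamma ξ (n + 1 + 1) := by
      intro b hb
      rw [map_fst_shiftD]
      exact mem_gamma_succ.2 (Or.inr ⟨_, ht, b, hb, rfl⟩)
    obtain ⟨r, hr, hQr⟩ := ih _ hQt (fun q => x (shiftD δ t ++ q))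
      (hb.comp fun q hq => by rw [List.map_append]; exact hT' _ hq)
      (hw.comp (φ' := fun q => shiftD δ t ++ q) (ψ := id) (fun s ζ v => by simp) fun s ζ hs => by
        rw [List.map_append, List.append_assoc]
        exact hT' _ hs)
    refine ⟨shiftD δ t ++ r, mem_maxs_gamma_succ.2 ⟨_, ht, _, Or.inr ⟨by omega, hr⟩,
      by rw [List.map_append, map_fst_shiftD]⟩, ?_⟩
    rw [List.range_succ_eq_map, List.map_cons, List.map_map,
      levelSum_one e c x ht.1 (Or.inr hr.1)]
    convert hQr using 2
    refine List.map_congr_left fun i hi => ?_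
    exact levelSum_succ e c (List.mem_range.1 hi) x ht hr.1

/-- A winning strategy against all trees gives good branches. -/
theorem exists_branch_of_gameT (ξ : Ordinal.{u}) (c : ℝ) {D : Type u} [Preorder D]
    [IsDirectedOrder D] [Nonempty D] (Q : V → Prop) (hQ : gameT 𝕜 e ξ c Q)
    (x : List (Ordinal.{u} × D) → X) (hb : InBall (gammaOne ξ) D x)
    (hw : WeaklyNull 𝕜 (gammaOne ξ) D x) :
    ∃ t, t.map Prod.fst ∈ maxs (gammaOne ξ) ∧ Q (branchSum e c (weightOne ξ) x t) := by
  induction ξ using Ordinal.limitRecOn generalizing c Q x with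
  | zero =>
    rw [gameT_zero] at hQ
    -- The only round: the net converges weakly to zero and hence enters the chosen weak
    -- neighbourhood.
    have hnull : Tendsto (fun v : D => x ([] ++ [(0, v)])) atTop (weakNhds 𝕜 X) :=
      (tendsto_weakNhds 𝕜).2 (hw [] 0 (by simp [gammaOne_zero]))
    obtain ⟨v, hv⟩ := (hnull.eventually hQ).exists
    have hmem : [(0 : Ordinal.{u})] ∈ gammaOne (0 : Ordinal.{u}) := by simp [gammaOne_zero]
    refine ⟨[(0, v)], ⟨by simpa using hmem, ?_⟩, ?_⟩
    · intro s hs _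
      rw [gammaOne_zero] at hs
      simpa using hs
    · have := hv (hb _ (by simpa [withIndex] using hmem))
      simpa [branchSum, weightOne_zero] using this
  | add_one ξ ih =>
    rw [gameT_succ] at hQ
    obtain ⟨n, hn, hQ⟩ := hQ
    obtain ⟨n, rfl⟩ : ∃ k, n = k + 1 := ⟨n - 1, by omega⟩
    have hsub : gamma ξ (n + 1) ⊆ gammaOne (ξ + 1) := fun t ht => by
      rw [gammaOne_succ]
      exact ⟨_, hn, ht⟩
    obtain ⟨t, ht, hQt⟩ := exists_branch_of_hist_of_step (ih _) n _ hQ x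
      (fun t ht => hb t (hsub ht)) (fun s ζ hs => hw s ζ (hsub hs))
    refine ⟨t, mem_maxs_gammaOne_succ.2 ⟨_, hn, ht⟩, ?_⟩
    rwa [sum_levelSum e _ x ht.1, ← branchSum_succ e c x ht.1] at hQt
  | limit ξ hξ ih =>
    rw [gameT_limit _ _ hξ] at hQ
    obtain ⟨ζ, hζ, hQ⟩ := hQ
    have hT : ∀ a ∈ gammaOne (ζ + 1), shift (ω ^ ζ) a ∈ gammaOne ξ := fun a ha => by
      rw [gammaOne_limit hξ]
      exact ⟨ζ, hζ, a, ha, rfl⟩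
    obtain ⟨t, ht, hQt⟩ := ih _ (hξ.add_one_lt hζ) c Q hQ _ (hb.comp_shiftD _ hT)
      (hw.comp_shiftD _ hT)
    refine ⟨shiftD (ω ^ ζ) t, (mem_maxs_gammaOne_limit hξ).2
      ⟨ζ, hζ, _, ht, map_fst_shiftD _ _⟩, ?_⟩
    rwa [branchSum_limit e c hξ hζ x ht.1]

theorem exists_branch_of_hist {ξ : Ordinal.{u}} {c : ℝ} {D : Type u} [Preorder D]
    [IsDirectedOrder D] [Nonempty D] (n : ℕ) (Q : List V → Prop)
    (hQ : hist (gameT 𝕜 e ξ c) (n + 1) Q)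
    (x : List (Ordinal.{u} × D) → X) (hb : InBall (gamma ξ (n + 1)) D x)
    (hw : WeaklyNull 𝕜 (gamma ξ (n + 1)) D x) :
    ∃ t, t.map Prod.fst ∈ maxs (gamma ξ (n + 1)) ∧
      Q ((List.range (n + 1)).map fun i => levelSum e c ξ (n + 1) (i + 1) x t) :=
  exists_branch_of_hist_of_step (exists_branch_of_gameT ξ c) n Q hQ x hb hw

/-! ### The opponent's strategies as trees -/

variable (𝕜 X) in
/-- The weak neighbourhoods of zero, directed by reverse inclusion. -/
def WeakIndex : Type u := {U : Set X // U ∈ weakNhds 𝕜 X}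

instance : Preorder (WeakIndex 𝕜 X) where
  le U W := W.1 ⊆ U.1
  le_refl _ := Set.Subset.rfl
  le_trans _ _ _ h h' := h'.trans h

instance : IsDirectedOrder (WeakIndex 𝕜 X) :=
  ⟨fun U W => ⟨⟨U.1 ∩ W.1, inter_mem U.2 W.2⟩, Set.inter_subset_left, Set.inter_subset_right⟩⟩

instance : Nonempty (WeakIndex 𝕜 X) := ⟨⟨Set.univ, univ_mem⟩⟩

theorem eventually_subset_weakIndex {s : Set X} (hs : s ∈ weakNhds 𝕜 X) :
    ∀ᶠ U : WeakIndex 𝕜 X in atTop, U.1 ⊆ s := by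
  let U₀ : WeakIndex 𝕜 X := ⟨s, hs⟩
  exact (eventually_ge_atTop U₀).mono fun U hU => hU

/-- A tree `x₁` realises the first round; every maximal branch `s` of it gets its own tree `x₂ s`
for the remaining rounds, and these trees are glued together. -/
theorem exists_tree_of_hist_of_step {ξ : Ordinal.{u}} {c : ℝ} {D : Type u} [Preorder D]
    (hone : ∀ Q : V → Prop, gameS 𝕜 e ξ c Q → ∃ x : List (Ordinal.{u} × D) → X,
      InBall (gammaOne ξ) D x ∧ WeaklyNull 𝕜 (gammaOne ξ) D x ∧
        ∀ t, t.map Prod.fst ∈ maxs (gammaOne ξ) → Q (branchSum e c (weightOne ξ) x t))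
    (n : ℕ) (Q : List V → Prop) (hQ : hist (gameS 𝕜 e ξ c) n Q) (hn : n ≠ 0) :
    ∃ x : List (Ordinal.{u} × D) → X, InBall (gamma ξ n) D x ∧
      WeaklyNull 𝕜 (gamma ξ n) D x ∧ ∀ t, t.map Prod.fst ∈ maxs (gamma ξ n) →
        Q ((List.range n).map fun i => levelSum e c ξ n (i + 1) x t) := by
  classical
  induction n generalizing Q with
  | zero => exact absurd rfl hn
  | succ n ih =>
    obtain ⟨x₁, hb₁, hw₁, hQ₁⟩ := hone _ hQ
    have hx₂ : ∀ s : List (Ordinal.{u} × D), ∃ x₂ : List (Ordinal.{u} × D) → X,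
        s.map Prod.fst ∈ maxs (gammaOne ξ) → n ≠ 0 →
          InBall (gamma ξ n) D x₂ ∧ WeaklyNull 𝕜 (gamma ξ n) D x₂ ∧
            ∀ t, t.map Prod.fst ∈ maxs (gamma ξ n) →
              Q (branchSum e c (weightOne ξ) x₁ s ::
                (List.range n).map fun i => levelSum e c ξ n (i + 1) x₂ t) := by
      intro s
      by_cases h : s.map Prod.fst ∈ maxs (gammaOne ξ) ∧ n ≠ 0
      · obtain ⟨x₂, h2⟩ := ih _ (hQ₁ s h.1) h.2
        exact ⟨x₂, fun _ _ => h2⟩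
      · exact ⟨fun _ => 0, fun h1 h2 => absurd ⟨h1, h2⟩ h⟩
    choose x₂ hx₂ using hx₂
    set δ := ω ^ ξ * (n : Ordinal.{u}) with hδ
    -- A sequence is split by comparing its ordinals with δ: the large ones form the first block,
    -- the small ones the continuation. Without continuation `x₁` applies, otherwise `x₂`.
    set x : List (Ordinal.{u} × D) → X := fun q =>
      if q.filter (fun p => decide (p.1 < δ)) = [] then
        x₁ (unshiftD δ (q.filter fun p => decide (δ ≤ p.1)))
      else x₂ (unshiftD δ (q.filter fun p => decide (δ ≤ p.1)))
        (q.filter fun p => decide (p.1 < δ)) with hx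
    have hxs : ∀ s, x (shiftD δ s) = x₁ s := by
      intro s
      have := filter_shiftD_append (δ := δ) s (r := []) (by simp)
      rw [List.append_nil] at this
      simp only [hx]
      rw [if_pos this.2, this.1, unshiftD_shiftD]
    have hxr : ∀ s r, r.map Prod.fst ∈ gamma ξ n → x (shiftD δ s ++ r) = x₂ s r := by
      intro s r hr
      have hr' := gamma_bounds hr
      have := filter_shiftD_append s hr'.2.1
      simp only [hx]
      rw [if_neg, this.1, this.2, unshiftD_shiftD]
      rw [this.2]
      rintro rfl
      exact hr'.1 rfl
    have hn0 : ∀ {b}, b ∈ gamma ξ n → n ≠ 0 := by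
      rintro b hb rfl
      simp [gamma_zero] at hb
    refine ⟨x, ?_, ?_, ?_⟩
    · intro t ht
      rcases mem_gamma_succ.1 ht with ⟨a, ha, h⟩ | ⟨a, ha, b, hb, h⟩
      · obtain ⟨s, rfl, rfl⟩ := exists_shiftD h
        rw [hxs]
        exact hb₁ s ha
      · obtain ⟨s, r, rfl, rfl, rfl⟩ := exists_shiftD_append h
        rw [hxr s r hb]
        exact (hx₂ s ha (hn0 hb)).1 r hb
    · intro s ζ hs f
      rcases mem_gamma_succ.1 hs with ⟨a, ha, h⟩ | ⟨a, ha, b, hb, h⟩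
      · obtain ⟨a₀, b₀, rfl, h1, h2⟩ := List.append_eq_map_iff.1 h
        obtain ⟨s, rfl, rfl⟩ := exists_shiftD h1.symm
        obtain ⟨ζ', rfl, rfl⟩ := List.map_eq_singleton_iff.1 h2
        have := hw₁ s ζ' ha f
        refine this.congr fun v => ?_
        rw [← hxs, shiftD_append]
        rfl
      · rcases List.eq_nil_or_concat b with rfl | ⟨b₀, ζ', rfl⟩
        · exact absurd rfl (gamma_bounds hb).1
        · rw [List.concat_eq_append] at hb
          rw [List.concat_eq_append, ← List.append_assoc] at h
          obtain ⟨h1, h2⟩ := List.append_inj' h rfl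
          obtain rfl : ζ = ζ' := by simpa using h2
          obtain ⟨s, r, rfl, rfl, rfl⟩ := exists_shiftD_append h1
          have := (hx₂ s ha (hn0 hb)).2.1 r ζ hb f
          refine this.congr fun v => ?_
          rw [List.append_assoc, hxr]
          simpa using hb
    · intro t ht
      obtain ⟨a, ha, b, hb, h⟩ := mem_maxs_gamma_succ.1 ht
      obtain ⟨s, r, rfl, rfl, rfl⟩ := exists_shiftD_append h
      rw [List.range_succ_eq_map, List.map_cons, List.map_map]
      rcases hb with ⟨rfl, hr⟩ | ⟨hn', hr⟩
      · have h1 := levelSum_one e c x ha.1 (r := r) (n := 0) (Or.inl (by simpa using hr))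
        have h2 := hQ₁ s ha
        rw [h1]
        simp only [← hδ, hxs]
        simpa [hist] using h2
      · rw [levelSum_one e c x ha.1 (Or.inr hr.1)]
        simp only [← hδ, hxs]
        convert (hx₂ s ha hn').2.2 r hr using 2
        refine List.map_congr_left fun i hi => ?_
        refine (levelSum_succ e c (List.mem_range.1 hi) x ha hr.1).trans ?_
        refine Finset.sum_congr rfl fun k hk => ?_
        rw [Finset.mem_filter, Finset.mem_Icc] at hk
        exact congrArg _ (hxr s (r.take k)
          (take_mem_of_mem (prefixClosed_gamma ξ n) hr.1 hk.1.1 hk.1.2))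

/-- A winning strategy of the opponent gives a weakly null tree. -/
theorem exists_tree_of_gameS (ξ : Ordinal.{u}) (c : ℝ) (Q : V → Prop) (hQ : gameS 𝕜 e ξ c Q) :
    ∃ x : List (Ordinal.{u} × WeakIndex 𝕜 X) → X, InBall (gammaOne ξ) (WeakIndex 𝕜 X) x ∧
      WeaklyNull 𝕜 (gammaOne ξ) (WeakIndex 𝕜 X) x ∧
        ∀ t, t.map Prod.fst ∈ maxs (gammaOne ξ) → Q (branchSum e c (weightOne ξ) x t) := by
  classical
  induction ξ using Ordinal.limitRecOn generalizing c Q with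
  | zero =>
    rw [gameS_zero] at hQ
    -- One good vector is chosen in each weak neighbourhood; indexed by the neighbourhoods
    -- themselves, these form a weakly null net.
    have : ∀ U : WeakIndex 𝕜 X, ∃ x ∈ U.1, ‖x‖ ≤ 1 ∧ Q (e c x) := fun U => by
      obtain ⟨x, hxU, hx⟩ := frequently_iff.1 hQ U.2
      exact ⟨x, hxU, hx⟩
    choose y hyU hy hQy using this
    have hone : ∀ t : List (Ordinal.{u} × WeakIndex 𝕜 X),
        t.map Prod.fst ∈ gammaOne (0 : Ordinal.{u}) → ∃ U, t = [(0, U)] := by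
      intro t ht
      rw [gammaOne_zero, Set.mem_singleton_iff, List.map_eq_singleton_iff] at ht
      obtain ⟨⟨a, U⟩, rfl, h⟩ := ht
      obtain rfl : a = 0 := h
      exact ⟨U, rfl⟩
    refine ⟨fun t => (t.head?.map fun p => y p.2).getD 0, ?_, ?_, ?_⟩
    · intro t ht
      obtain ⟨U, rfl⟩ := hone t ht
      exact hy U
    · intro s ζ hs f
      obtain rfl : s = [] := by
        rw [gammaOne_zero, Set.mem_singleton_iff] at hs
        have := congrArg List.length hs
        simpa using this
      rw [Metric.tendsto_nhds]
      intro ε hε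
      have hU₀ := eventually_norm_apply_lt 𝕜 f hε
      filter_upwards [eventually_subset_weakIndex hU₀] with U hU
      have : ‖f (y U)‖ < ε := hU (hyU U)
      simpa using this
    · intro t ht
      obtain ⟨U, rfl⟩ := hone t ht.1
      simpa [branchSum, weightOne_zero] using hQy U
  | add_one ξ ih =>
    rw [gameS_succ] at hQ
    have : ∀ n : ℕ, ∃ x : List (Ordinal.{u} × WeakIndex 𝕜 X) → X, 1 ≤ n →
        InBall (gamma ξ n) (WeakIndex 𝕜 X) x ∧ WeaklyNull 𝕜 (gamma ξ n) (WeakIndex 𝕜 X) x ∧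
          ∀ t, t.map Prod.fst ∈ maxs (gamma ξ n) →
            Q ((List.range n).map fun i => levelSum e (c / n) ξ n (i + 1) x t).sum := by
      intro n
      by_cases hn : 1 ≤ n
      · obtain ⟨x, hx⟩ := exists_tree_of_hist_of_step (ih _) n _ (hQ n hn) (by omega)
        exact ⟨x, fun _ => hx⟩
      · exact ⟨fun _ => 0, fun h => absurd h hn⟩
    choose y hy using this
    -- The trees for the different `n` are put side by side; this is consistent because `n` is
    -- determined by the sequence.
    set x : List (Ordinal.{u} × WeakIndex 𝕜 X) → X := fun q =>
      if h : ∃ n, q.map Prod.fst ∈ gamma ξ n then y h.choose q else 0 with hx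
    have hxy : ∀ {n q}, q.map Prod.fst ∈ gamma ξ n → x q = y n q := by
      intro n q hq
      have h : ∃ n, q.map Prod.fst ∈ gamma ξ n := ⟨n, hq⟩
      simp only [hx]
      rw [dif_pos h, gamma_index_unique h.choose_spec hq List.prefix_rfl]
    refine ⟨x, ?_, ?_, ?_⟩
    · intro t ht
      rw [withIndex, gammaOne_succ] at ht
      obtain ⟨n, hn, ht⟩ := ht
      rw [hxy ht]
      exact (hy n hn).1 t ht
    · intro s ζ hs f
      rw [gammaOne_succ] at hs
      obtain ⟨n, hn, hs⟩ := hs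
      refine ((hy n hn).2.1 s ζ hs f).congr fun v => ?_
      rw [hxy (n := n)]
      simpa using hs
    · intro t ht
      obtain ⟨n, hn, ht⟩ := mem_maxs_gammaOne_succ.1 ht
      have := (hy n hn).2.2 t ht
      rw [sum_levelSum e _ _ ht.1] at this
      rw [branchSum_succ e c x ht.1]
      convert this using 1
      refine Finset.sum_congr rfl fun k hk => ?_
      rw [Finset.mem_Icc] at hk
      rw [hxy (take_mem_of_mem (prefixClosed_gamma ξ n) ht.1 hk.1 hk.2)]
  | limit ξ hξ ih =>
    rw [gameS_limit _ _ hξ] at hQ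
    have : ∀ ζ : Ordinal.{u}, ∃ x : List (Ordinal.{u} × WeakIndex 𝕜 X) → X, ζ < ξ →
        InBall (gammaOne (ζ + 1)) (WeakIndex 𝕜 X) x ∧
          WeaklyNull 𝕜 (gammaOne (ζ + 1)) (WeakIndex 𝕜 X) x ∧
            ∀ t, t.map Prod.fst ∈ maxs (gammaOne (ζ + 1)) →
              Q (branchSum e c (weightOne (ζ + 1)) x t) := by
      intro ζ
      by_cases hζ : ζ < ξ
      · obtain ⟨x, hx⟩ := ih _ (hξ.add_one_lt hζ) c Q (hQ ζ hζ)
        exact ⟨x, fun _ => hx⟩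
      · exact ⟨fun _ => 0, fun h => absurd h hζ⟩
    choose y hy using this
    set x : List (Ordinal.{u} × WeakIndex 𝕜 X) → X := fun q =>
      if h : ∃ ζ, ∃ s, s.map Prod.fst ∈ gammaOne (ζ + 1) ∧ q = shiftD (ω ^ ζ) s then
        y h.choose (unshiftD (ω ^ h.choose) q) else 0 with hx
    have hxy : ∀ {ζ s}, s.map Prod.fst ∈ gammaOne (ζ + 1) → x (shiftD (ω ^ ζ) s) = y ζ s := by
      intro ζ s hs
      have h : ∃ ζ', ∃ s', s'.map Prod.fst ∈ gammaOne (ζ' + 1) ∧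
        shiftD (ω ^ ζ) s = shiftD (ω ^ ζ') s' := ⟨ζ, s, hs, rfl⟩
      have hζ : h.choose = ζ := by
        obtain ⟨s', hs', he⟩ := h.choose_spec
        refine shift_index_unique hs' hs ?_
        have he' := congrArg (List.map Prod.fst) he
        rw [map_fst_shiftD, map_fst_shiftD] at he'
        exact ⟨[], (List.append_nil _).trans he'.symm⟩
      simp only [hx]
      rw [dif_pos h, hζ, unshiftD_shiftD]
    refine ⟨x, ?_, ?_, ?_⟩
    · intro t ht
      rw [withIndex, gammaOne_limit hξ] at ht
      obtain ⟨ζ, hζ, a, ha, h⟩ := ht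
      obtain ⟨s, rfl, rfl⟩ := exists_shiftD h
      rw [hxy ha]
      exact (hy ζ hζ).1 s ha
    · intro s ζ' hs f
      rw [gammaOne_limit hξ] at hs
      obtain ⟨ζ, hζ, a, ha, h⟩ := hs
      obtain ⟨a₀, b₀, rfl, h1, h2⟩ := List.append_eq_map_iff.1 h
      obtain ⟨s, rfl, rfl⟩ := exists_shiftD h1.symm
      obtain ⟨ζ', rfl, rfl⟩ := List.map_eq_singleton_iff.1 h2
      refine ((hy ζ hζ).2.1 s ζ' ha f).congr fun v => ?_
      rw [← hxy (by simpa using ha), shiftD_append]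
      rfl
    · intro t ht
      obtain ⟨ζ, hζ, a, ha, h⟩ := (mem_maxs_gammaOne_limit hξ).1 ht
      obtain ⟨s, rfl, rfl⟩ := exists_shiftD h
      rw [branchSum_limit e c hξ hζ x ha.1]
      convert (hy ζ hζ).2.2 s ha using 1
      refine Finset.sum_congr rfl fun k hk => ?_
      rw [Finset.mem_Icc] at hk
      exact congrArg _ (hxy (take_mem_of_mem (prefixClosed_gammaOne _) ha.1 hk.1 hk.2))

theorem exists_tree_of_hist {ξ : Ordinal.{u}} {c : ℝ} {n : ℕ} (hn : n ≠ 0) (Q : List V → Prop)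
    (hQ : hist (gameS 𝕜 e ξ c) n Q) :
    ∃ x : List (Ordinal.{u} × WeakIndex 𝕜 X) → X, InBall (gamma ξ n) (WeakIndex 𝕜 X) x ∧
      WeaklyNull 𝕜 (gamma ξ n) (WeakIndex 𝕜 X) x ∧ ∀ t, t.map Prod.fst ∈ maxs (gamma ξ n) →
        Q ((List.range n).map fun i => levelSum e c ξ n (i + 1) x t) :=
  exists_tree_of_hist_of_step (exists_tree_of_gameS ξ c) n Q hQ hn

end Strategies

/-! ### Finite-dimensional `ℓ_q`-norms -/

section EllNorm

variable {ι : Type*} [Fintype ι]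

/-- The `ℓ_q`-norm of a finite family of real numbers. -/
noncomputable def ellNorm (q : ℝ≥0∞) (b : ι → ℝ) : ℝ := ‖(WithLp.toLp q b : PiLp q fun _ : ι => ℝ)‖

theorem ellNorm_top (b : ι → ℝ) : ellNorm ∞ b = ⨆ i, |b i| := by
  simp [ellNorm, PiLp.norm_eq_ciSup]

theorem toReal_pos_of_one_le {q : ℝ≥0∞} (hq : 1 ≤ q) (hq' : q ≠ ∞) : 0 < q.toReal :=
  ENNReal.toReal_pos (zero_lt_one.trans_le hq).ne' hq'

theorem ellNorm_eq {q : ℝ≥0∞} (hq : 1 ≤ q) (hq' : q ≠ ∞) (b : ι → ℝ) :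
    ellNorm q b = (∑ i, |b i| ^ q.toReal) ^ (1 / q.toReal) := by
  simp [ellNorm, PiLp.norm_eq_sum (toReal_pos_of_one_le hq hq')]

theorem norm_toLp_eq_ellNorm {𝕜 : Type*} [RCLike 𝕜] {q : ℝ≥0∞} (hq : 1 ≤ q) (a : ι → 𝕜) :
    ‖(WithLp.toLp q a : PiLp q fun _ : ι => 𝕜)‖ = ellNorm q fun i => ‖a i‖ := by
  rcases eq_or_ne q ∞ with rfl | h
  · simp [ellNorm, PiLp.norm_eq_ciSup]
  · simp [ellNorm, PiLp.norm_eq_sum (toReal_pos_of_one_le hq h)]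

variable {q : ℝ≥0∞} [hq : Fact (1 ≤ q)]

theorem ellNorm_nonneg (b : ι → ℝ) : 0 ≤ ellNorm q b := norm_nonneg _

theorem ellNorm_add_le (b b' : ι → ℝ) :
    ellNorm q (fun i => b i + b' i) ≤ ellNorm q b + ellNorm q b' :=
  norm_add_le (WithLp.toLp q b : PiLp q fun _ : ι => ℝ) (WithLp.toLp q b')

theorem ellNorm_const_mul (c : ℝ) (b : ι → ℝ) :
    ellNorm q (fun i => c * b i) = |c| * ellNorm q b := by
  have := norm_smul c (WithLp.toLp q b : PiLp q fun _ : ι => ℝ)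
  rwa [Real.norm_eq_abs] at this

theorem ellNorm_zero : ellNorm q (fun _ : ι => (0 : ℝ)) = 0 :=
  norm_zero (E := PiLp q fun _ : ι => ℝ)

theorem ellNorm_sum_le {κ : Type*} (s : Finset κ) (b : κ → ι → ℝ) :
    ellNorm q (fun i => ∑ k ∈ s, b k i) ≤ ∑ k ∈ s, ellNorm q (b k) := by
  classical
  induction s using Finset.induction_on with
  | empty => simp [ellNorm_zero]
  | insert k s hk ih =>
    simp only [Finset.sum_insert hk]
    exact (ellNorm_add_le _ _).trans (add_le_add le_rfl ih)

theorem abs_le_ellNorm (b : ι → ℝ) (i : ι) : |b i| ≤ ellNorm q b :=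
  PiLp.norm_apply_le (WithLp.toLp q b : PiLp q fun _ : ι => ℝ) i

theorem ellNorm_mono {b b' : ι → ℝ} (h : ∀ i, |b i| ≤ |b' i|) : ellNorm q b ≤ ellNorm q b' := by
  rcases eq_or_ne q ∞ with rfl | h'
  · rw [ellNorm_top, ellNorm_top]
    exact ciSup_mono (Set.finite_range _).bddAbove h
  · rw [ellNorm_eq hq.out h', ellNorm_eq hq.out h']
    have := toReal_pos_of_one_le hq.out h'
    refine Real.rpow_le_rpow (by positivity) (Finset.sum_le_sum fun i _ => ?_) (by positivity)
    exact Real.rpow_le_rpow (abs_nonneg _) (h i) this.le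

theorem ellNorm_mono' {b b' : ι → ℝ} (h0 : ∀ i, 0 ≤ b i) (h : ∀ i, b i ≤ b' i) :
    ellNorm q b ≤ ellNorm q b' :=
  ellNorm_mono fun i => by
    rw [abs_of_nonneg (h0 i), abs_of_nonneg ((h0 i).trans (h i))]; exact h i

theorem ellNorm_le_sum (b : ι → ℝ) : ellNorm q b ≤ ∑ i, |b i| := by
  classical
  have h1 : ∀ k, ellNorm q (fun i => if i = k then b i else 0) ≤ |b k| := by
    intro k
    rcases eq_or_ne q ∞ with rfl | h'
    · rw [ellNorm_top]
      refine Real.iSup_le (fun i => ?_) (abs_nonneg _)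
      split_ifs with h
      · rw [h]
      · simp
    · have := toReal_pos_of_one_le hq.out h'
      rw [ellNorm_eq hq.out h', Finset.sum_eq_single k]
      · simp [← Real.rpow_mul (abs_nonneg _), mul_inv_cancel₀ this.ne']
      · intro i _ hi
        simp [hi, Real.zero_rpow this.ne']
      · simp
  calc ellNorm q b = ellNorm q fun i => ∑ k, if i = k then b i else 0 := by simp
    _ ≤ _ := (ellNorm_sum_le _ _).trans (Finset.sum_le_sum fun k _ => h1 k)

theorem ellNorm_eq_zero {b : ι → ℝ} (h : ellNorm q b = 0) (i : ι) : b i = 0 :=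
  abs_eq_zero.1 (le_antisymm ((abs_le_ellNorm b i).trans h.le) (abs_nonneg _))

theorem ellNorm_rpow (hq' : q ≠ ∞) (b : ι → ℝ) :
    ellNorm q b ^ q.toReal = ∑ i, |b i| ^ q.toReal := by
  have := toReal_pos_of_one_le hq.out hq'
  rw [ellNorm_eq hq.out hq', ← Real.rpow_mul (by positivity), one_div_mul_cancel this.ne',
    Real.rpow_one]

/-- Minkowski's inequality for mixed norms. -/
theorem ellNorm_ellNorm_le {γ : ℝ≥0∞} [hγ : Fact (1 ≤ γ)] (hγq : γ ≤ q) {σ : Type*} [Fintype σ]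
    (a : ι → ℝ) (w : ι → σ → ℝ) (hw : ∀ i, ellNorm q (w i) ≤ 1) :
    ellNorm q (fun s => ellNorm γ fun i => a i * w i s) ≤ ellNorm γ a := by
  rcases eq_or_ne q ∞ with rfl | hq'
  · rw [ellNorm_top]
    refine Real.iSup_le (fun s => ?_) (ellNorm_nonneg _)
    rw [abs_of_nonneg (ellNorm_nonneg _)]
    refine ellNorm_mono fun i => ?_
    rw [abs_mul]
    exact mul_le_of_le_one_right (abs_nonneg _) ((abs_le_ellNorm (q := ∞) (w i) s).trans (hw i))
  have hγ' : γ ≠ ∞ := ne_top_of_le_ne_top hq' hγq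
  have hγ0 := toReal_pos_of_one_le hγ.out hγ'
  have hq0 := toReal_pos_of_one_le hq.out hq'
  -- After raising to the power γ, the claim is the triangle inequality in ℓ_d with d = q/γ ≥ 1.
  set d : ℝ≥0∞ := ENNReal.ofReal (q.toReal / γ.toReal) with hd
  have hdr : d.toReal = q.toReal / γ.toReal := ENNReal.toReal_ofReal (by positivity)
  have hd1 : 1 ≤ d := by
    rw [hd, ← ENNReal.ofReal_one]
    refine ENNReal.ofReal_le_ofReal ((one_le_div hγ0).2 (ENNReal.toReal_mono hq' hγq))
  have : Fact (1 ≤ d) := ⟨hd1⟩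
  have hd' : d ≠ ∞ := ENNReal.ofReal_ne_top
  have hd0 := toReal_pos_of_one_le hd1 hd'
  have key : ellNorm q (fun s => ellNorm γ fun i => a i * w i s) ^ γ.toReal =
      ellNorm d (fun s => ∑ i, |a i * w i s| ^ γ.toReal) := by
    rw [ellNorm_eq hq.out hq', ellNorm_eq hd1 hd', ← Real.rpow_mul (by positivity), hdr]
    congr 1
    · refine Finset.sum_congr rfl fun s _ => ?_
      rw [← ellNorm_rpow hγ', abs_of_nonneg (ellNorm_nonneg _),
        abs_of_nonneg (Real.rpow_nonneg (ellNorm_nonneg _) _), ← Real.rpow_mul (ellNorm_nonneg _)]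
      congr 1
      field_simp
    · field_simp
  have h2 : ∀ i, ellNorm d (fun s => |a i * w i s| ^ γ.toReal) ≤ |a i| ^ γ.toReal := by
    intro i
    have : (fun s => |a i * w i s| ^ γ.toReal) =
        fun s => |a i| ^ γ.toReal * |w i s| ^ γ.toReal := by
      funext s
      rw [abs_mul, Real.mul_rpow (abs_nonneg _) (abs_nonneg _)]
    rw [this, ellNorm_const_mul, abs_of_nonneg (by positivity)]
    refine mul_le_of_le_one_right (by positivity) ?_
    have h3 : ellNorm d (fun s => |w i s| ^ γ.toReal) = ellNorm q (w i) ^ γ.toReal := by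
      rw [ellNorm_eq hq.out hq', ellNorm_eq hd1 hd', ← Real.rpow_mul (by positivity), hdr]
      congr 1
      · refine Finset.sum_congr rfl fun s _ => ?_
        rw [abs_of_nonneg (by positivity), ← Real.rpow_mul (abs_nonneg _)]
        congr 1
        field_simp
      · field_simp
    rw [h3]
    exact Real.rpow_le_one (ellNorm_nonneg _) (hw i) hγ0.le
  refine (Real.rpow_le_rpow_iff (ellNorm_nonneg _) (ellNorm_nonneg _) hγ0).1 ?_
  rw [key, ellNorm_rpow hγ']
  exact (ellNorm_sum_le _ _).trans (Finset.sum_le_sum fun i _ => h2 i)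

end EllNorm

/-! ### Operators -/

section Operators

variable {𝕜 : Type*} [RCLike 𝕜] {X : Type u} [NormedAddCommGroup X] [NormedSpace 𝕜 X]
  {Y : Type u} [NormedAddCommGroup Y] [NormedSpace 𝕜 Y]

theorem re_apply_le_of_mem_adjointBall {A : X →L[𝕜] Y} {f : StrongDual 𝕜 X}
    (hf : f ∈ adjointBall A) (v : X) : RCLike.re (f v) ≤ ‖A v‖ := by
  obtain ⟨g, hg, rfl⟩ := hf
  rw [mem_closedBall_zero_iff] at hg
  exact (RCLike.re_le_norm _).trans (g.le_of_opNorm_le_of_le hg le_rfl |>.trans (one_mul _).le)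

theorem exists_mem_adjointBall (A : X →L[𝕜] Y) (v : X) :
    ∃ f ∈ adjointBall A, RCLike.re (f v) = ‖A v‖ := by
  obtain ⟨g, hg, h⟩ := exists_dual_vector'' 𝕜 (A v)
  refine ⟨g.comp A, ⟨g, by simpa using hg, rfl⟩, ?_⟩
  simp [h]

theorem supportFn_adjointBall (A : X →L[𝕜] Y) (v : X) : supportFn (adjointBall A) v = ‖A v‖ := by
  obtain ⟨f, hf, h⟩ := exists_mem_adjointBall A v
  have : Nonempty (adjointBall A) := ⟨⟨f, hf⟩⟩
  refine le_antisymm (ciSup_le fun g => re_apply_le_of_mem_adjointBall g.2 v) ?_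
  rw [← h]
  exact le_ciSup (f := fun g : adjointBall A => RCLike.re (g.1 v))
    ⟨‖A v‖, by rintro _ ⟨g, rfl⟩; exact re_apply_le_of_mem_adjointBall g.2 v⟩ ⟨f, hf⟩

/-- The set is the image of the dual ball, compact by Banach–Alaoglu, under the weak-star continuous
adjoint. -/
theorem wcompact_adjointBall (A : X →L[𝕜] Y) : WCompact (adjointBall A) := by
  have h1 : IsCompact (WeakDual.toStrongDual ⁻¹' Metric.closedBall (0 : StrongDual 𝕜 Y) 1) :=
    WeakDual.isCompact_closedBall 0 1
  have h2 : Continuous fun f : WeakDual 𝕜 Y =>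
      StrongDual.toWeakDual ((WeakDual.toStrongDual f).comp A) :=
    WeakDual.continuous_of_continuous_eval fun x => WeakDual.eval_continuous (A x)
  suffices h3 : StrongDual.toWeakDual '' adjointBall A = (fun f : WeakDual 𝕜 Y =>
      StrongDual.toWeakDual ((WeakDual.toStrongDual f).comp A)) ''
        (WeakDual.toStrongDual ⁻¹' Metric.closedBall (0 : StrongDual 𝕜 Y) 1) by
    rw [WCompact, h3]
    exact h1.image h2
  ext f
  simp only [adjointBall, Set.mem_image]
  constructor
  · rintro ⟨_, ⟨g, hg, rfl⟩, rfl⟩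
    exact ⟨StrongDual.toWeakDual g, hg, rfl⟩
  · rintro ⟨g, hg, rfl⟩
    exact ⟨_, ⟨WeakDual.toStrongDual g, hg, rfl⟩, rfl⟩

theorem norm_le_of_mem_adjointBall {A : X →L[𝕜] Y} {f : StrongDual 𝕜 X} (hf : f ∈ adjointBall A) :
    ‖f‖ ≤ ‖A‖ := by
  obtain ⟨g, hg, rfl⟩ := hf
  rw [mem_closedBall_zero_iff] at hg
  exact (g.opNorm_comp_le A).trans (mul_le_of_le_one_left (norm_nonneg _) hg)

theorem norm_sub_le_of_mem_adjointBall {A : X →L[𝕜] Y} {f g : StrongDual 𝕜 X}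
    (hf : f ∈ adjointBall A) (hg : g ∈ adjointBall A) : ‖f - g‖ ≤ 2 * ‖A‖ :=
  (norm_sub_le f g).trans (by
    linarith [norm_le_of_mem_adjointBall hf, norm_le_of_mem_adjointBall hg])

theorem controlled_adjointBall (A : X →L[𝕜] Y) {d : ℝ} (hd : 2 * ‖A‖ ≤ d) :
    Controlled (adjointBall A) (fun x => ‖x‖) d where
  wcompact := wcompact_adjointBall A
  norm_sub_le := fun _ hf _ hg => (norm_sub_le_of_mem_adjointBall hf hg).trans hd
  apply_le := fun f _ g _ x => (f - g).le_opNorm x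

theorem convex_adjointBall (A : X →L[𝕜] Y) {f g : StrongDual 𝕜 X} (hf : f ∈ adjointBall A)
    (hg : g ∈ adjointBall A) {s t : 𝕜} (h : ‖s‖ + ‖t‖ ≤ 1) : s • f + t • g ∈ adjointBall A := by
  obtain ⟨f, hf, rfl⟩ := hf
  obtain ⟨g, hg, rfl⟩ := hg
  refine ⟨s • f + t • g, ?_, by ext; simp⟩
  rw [mem_closedBall_zero_iff] at *
  calc ‖s • f + t • g‖ ≤ ‖s‖ * ‖f‖ + ‖t‖ * ‖g‖ :=
        (norm_add_le _ _).trans (by rw [norm_smul, norm_smul])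
    _ ≤ ‖s‖ * 1 + ‖t‖ * 1 := by gcongr
    _ ≤ 1 := by linarith

theorem levelSum_recordStep_fst {ι : Type*} (N : ι → X → ℝ) (ξ : Ordinal.{u}) (n i : ℕ)
    {D : Type u} (x : List (Ordinal.{u} × D) → X) (t : List (Ordinal.{u} × D)) :
    (levelSum (recordStep 𝕜 N) 1 ξ n i x t).1 = blockSum (𝕜 := 𝕜) ξ n i x t := by
  rw [levelSum, Prod.fst_sum]
  simp [recordStep, blockSum]

theorem levelSum_vecStep (ξ : Ordinal.{u}) (n i : ℕ)
    {D : Type u} (x : List (Ordinal.{u} × D) → X) (t : List (Ordinal.{u} × D)) :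
    levelSum (vecStep 𝕜) 1 ξ n i x t = blockSum (𝕜 := 𝕜) ξ n i x t := by
  simp [levelSum, vecStep, blockSum]

/-- Every weakly null tree in the ball has a branch that is controlled level by level, where the
sets to be controlled on a level may depend on the previous levels. -/
theorem exists_adapted_branch {ι : Type u} {N : ι → X → ℝ} (hN : ∀ i x, 0 ≤ N i x ∧ N i x ≤ ‖x‖)
    {δ : ℝ} (hδ : 0 < δ) (J : ℕ) (a : ℕ → 𝕜) (ξ : Ordinal.{u}) {n : ℕ} (hn : n ≠ 0)
    {K : ι → Set (StrongDual 𝕜 X)} (hK : ∀ i, Controlled (K i) (N i) ((J + 1) * δ))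
    (P : ℝ → X × (ι → ℝ) → Prop) (h0 : P 0 0)
    (hadd : ∀ c c' v v', 0 ≤ c → 0 ≤ c' → P c v → P c' v' → P (c + c') (v + v'))
    (he : ∀ c x, 0 ≤ c → ‖x‖ ≤ 1 → P c (recordStep 𝕜 N c x))
    (Φ : List (X × (ι → ℝ)) → Finset ι) (τ : List (X × (ι → ℝ)) → ℝ) (hτ : ∀ h, 0 < τ h)
    {D : Type u} [Preorder D] [IsDirectedOrder D] [Nonempty D] (x : List (Ordinal.{u} × D) → X)
    (hb : InBall (gamma ξ n) D x) (hw : WeaklyNull 𝕜 (gamma ξ n) D x) :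
    ∃ t ∈ maxs (withIndex (gamma ξ n) D), ∃ v : ℕ → X × (ι → ℝ),
      (∀ m < n, (v m).1 = blockSum (𝕜 := 𝕜) ξ n (m + 1) x t) ∧ (∀ m < n, P 1 (v m)) ∧
      ∀ i k, k ≤ n → (∀ m, k ≤ m → m < n → i ∈ Φ ((List.range m).map v)) → ∀ f ∈ K i,
        ∃ l : List (Fin (J + 1)), l.length = n - k ∧ ∃ g ∈ derivList (ω ^ ξ) (gridList δ l) (K i),
          RCLike.re (f (∑ m ∈ Finset.range n, a m • (v m).1)) ≤
            RCLike.re (g (∑ m ∈ Finset.range k, a m • (v m).1)) +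
              ∑ m ∈ Finset.range (n - k),
                (‖a (k + m)‖ * ((v (k + m)).2 i * (((l.getD m 0 : Fin (J + 1)) + 1) * δ)) +
                  τ ((List.range (k + m)).map v)) := by
  -- The round after the history `h` is played at once against all sets with index in `Φ h` and all
  -- lists of thresholds that later rounds may produce; this family is finite.
  have hstep : ∀ h : List (X × (ι → ℝ)), h.length < n →
      gameT 𝕜 (recordStep 𝕜 N) ξ 1 fun v =>
        (∀ q : Φ h × List.Vector (Fin (J + 1)) (n - h.length - 1),
          Drop (ω ^ ξ) δ J (a h.length) (τ h) (derivList (ω ^ ξ) (gridList δ q.2.1) (K q.1))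
            (0 + ∑ m ∈ Finset.range h.length, a m • (h.getD m 0).1) v.1 (v.2 q.1)) ∧ P 1 v := by
    intro h _
    refine gameT_inv 𝕜 _ P h0 hadd he ξ zero_le_one _ ?_
    let e : ULift.{u} (List.Vector (Fin (J + 1)) (n - h.length - 1)) ≃ _ := Equiv.ulift
    refine gameT_mono 𝕜 _ ξ _ _ _ (fun v hv q => hv (q.1, e.symm q.2))
      (gameT_drop hN hδ J (a h.length) ξ
        (κ := Φ h × ULift.{u} (List.Vector (Fin (J + 1)) (n - h.length - 1)))
          one_pos (hτ h) (fun q => q.1.1)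
          (fun q => derivList (ω ^ ξ) (gridList δ q.2.down.1) (K q.1))
          (fun q => (hK q.1).derivList _) fun _ => _)
  obtain ⟨n, rfl⟩ := Nat.exists_eq_succ_of_ne_zero hn
  obtain ⟨t, ht, hlen, hH⟩ := exists_branch_of_hist n _
    (hist_of_step (gameT_mono 𝕜 _ ξ _) (n + 1) 0 _ hstep) x hb hw
  set H := (List.range (n + 1)).map fun i => levelSum (recordStep 𝕜 N) 1 ξ (n + 1) (i + 1) x t
    with hHdef
  set v : ℕ → X × (ι → ℝ) := fun m => H.getD m 0 with hv
  have htake : ∀ m, m < n + 1 → H.take m = (List.range m).map v := by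
    intro m hm
    refine List.ext_getElem (by simp [hlen, hm.le]) fun j h1 h2 => ?_
    simp only [List.length_map, List.length_range] at h2
    simp [hv, List.getD_eq_getElem?_getD, hlen, h2.trans hm]
  refine ⟨t, mem_maxs_withIndex.2 ht, v, fun m hm => ?_, fun m hm => (hH m hm).2, ?_⟩
  · rw [← levelSum_recordStep_fst (𝕜 := 𝕜) N]
    simp [hv, hHdef, List.getD_eq_getElem?_getD, hm]
  · intro i k hk hΦ f hf
    have := telescope (𝕜 := 𝕜) (η := ω ^ ξ) (δ := δ) (J := J) (a := a) (K := K i)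
      (τ := fun m => τ ((List.range m).map v)) (y := 0) (z := fun m => (v m).1)
      (w := fun m => (v m).2 i) (n := n + 1) (k := k) hk
      (fun m hm hm' l hl => by
        have hi := hΦ m hm hm'
        rw [← htake m hm'] at hi
        have := (hH m hm').1 (⟨i, hi⟩, ⟨l, by rw [hl, List.length_take, hlen, min_eq_left hm'.le]⟩)
        simp only [List.length_take, hlen, min_eq_left hm'.le] at this
        rw [← htake m hm']
        convert this using 2
        refine Finset.sum_congr rfl fun j hj => ?_
        rw [getD_take _ (Finset.mem_range.1 hj)]) hf
    simpa only [zero_add] using this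

end Operators

/-! ### The numbers α and θ in terms of iterated derivatives. -/

section Estimates

theorem ellNorm_comp_le {ι κ : Type*} [Fintype ι] [Fintype κ] {q : ℝ≥0∞} [hq : Fact (1 ≤ q)]
    {e : κ → ι} (he : Function.Injective e) (b : ι → ℝ) :
    ellNorm q (fun k => b (e k)) ≤ ellNorm q b := by
  rcases eq_or_ne q ∞ with rfl | h
  · rw [ellNorm_top]
    exact Real.iSup_le (fun k => abs_le_ellNorm b (e k)) (ellNorm_nonneg _)
  · have := toReal_pos_of_one_le hq.out h
    rw [ellNorm_eq hq.out h, ellNorm_eq hq.out h]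
    refine Real.rpow_le_rpow (by positivity) ?_ (by positivity)
    have := Finset.sum_le_univ_sum_of_nonneg (s := Finset.univ.map ⟨e, he⟩)
      (f := fun i => |b i| ^ q.toReal) fun i => by positivity
    simpa [Finset.sum_map] using this

variable {𝕜 : Type*} [RCLike 𝕜] {X : Type u} [NormedAddCommGroup X] [NormedSpace 𝕜 X]
  {Y : Type u} [NormedAddCommGroup Y] [NormedSpace 𝕜 Y] {ξ : Ordinal.{u}} {γ : ℝ≥0∞}

/-- `∑ bᵢ εᵢ ≤ β ‖b‖_γ` whenever the successive derivatives of order `ω ^ ξ` at the levels `εᵢ`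
do not exhaust `K`. -/
def Estimate (K : Set (StrongDual 𝕜 X)) (ξ : Ordinal.{u}) (γ : ℝ≥0∞) (β : ℝ) : Prop :=
  ∀ (n : ℕ) (ε b : Fin n → ℝ), (∀ i, 0 ≤ ε i) → (∀ i, 0 ≤ b i) →
    (derivList (ω ^ ξ) (List.ofFn ε) K).Nonempty → ∑ i, b i * ε i ≤ β * ellNorm γ b

theorem treeInf_le (A : X →L[𝕜] Y) {n : ℕ} (a : Fin n → 𝕜) {D : Type u}
    (x : List (Ordinal.{u} × D) → X) {t : List (Ordinal.{u} × D)}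
    (ht : t ∈ maxs (withIndex (gamma ξ n) D)) :
    treeInf (adjointBall A) ξ n a x ≤
      ‖A (∑ i : Fin n, a i • blockSum (𝕜 := 𝕜) ξ n (i + 1) x t)‖ := by
  rw [← supportFn_adjointBall]
  refine ciInf_le (f := fun t : maxs (withIndex (gamma ξ n) D) => supportFn (adjointBall A)
    (∑ i : Fin n, a i • blockSum (𝕜 := 𝕜) ξ n (i + 1) x t.1)) ⟨0, ?_⟩ ⟨t, ht⟩
  rintro _ ⟨s, rfl⟩
  simp only [supportFn_adjointBall]
  exact norm_nonneg _

/-- Existence of a maximal branch is what the branch theorem says about the zero tree in the trivial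
space. It is needed to bound an infimum over branches from below. -/
theorem nonempty_maxs_gamma (𝕜 : Type*) [RCLike 𝕜] (ξ : Ordinal.{u}) {n : ℕ} (hn : n ≠ 0)
    (D : Type u) [Preorder D] [IsDirectedOrder D] [Nonempty D] :
    Nonempty (maxs (withIndex (gamma ξ n) D)) := by
  obtain ⟨t, ht, -⟩ := exists_adapted_branch (𝕜 := 𝕜) (X := PUnit.{u + 1}) (ι := PEmpty.{u + 1})
    (N := fun _ _ => 0) (δ := 1) (fun i => i.elim) one_pos 0 (fun _ => 0) ξ hn
    (K := fun i => i.elim) (fun i => i.elim) (fun _ _ => True) trivial (fun _ _ _ _ _ _ _ _ => trivial)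
    (fun _ _ _ _ => trivial) (fun _ => ∅) (fun _ => 1) (fun _ => one_pos) (D := D) (fun _ => 0)
    (fun _ _ => by simp) (fun _ _ _ f => by
      rw [show (fun _ => f PUnit.unit : D → 𝕜) = fun _ => 0 from funext fun _ => map_zero f]
      exact tendsto_const_nhds)
  exact ⟨t, ht⟩

/-- If the successive derivatives at the levels `εᵢ` do not exhaust the adjoint ball, then there is
a weakly null tree with large images of the averages. -/
theorem exists_tree_of_derivList (A : X →L[𝕜] Y) {n : ℕ} (hn : n ≠ 0) {ε : Fin n → ℝ}
    (hε : ∀ i, 0 ≤ ε i) (h : (derivList (ω ^ ξ) (List.ofFn ε) (adjointBall A)).Nonempty) :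
    ∃ x : List (Ordinal.{u} × WeakIndex 𝕜 X) → X, InBall (gamma ξ n) (WeakIndex 𝕜 X) x ∧
      WeaklyNull 𝕜 (gamma ξ n) (WeakIndex 𝕜 X) x ∧ ∀ b : Fin n → ℝ, (∀ i, 0 ≤ b i) →
        ∑ i, b i * (ε i / 8) ≤ treeInf (adjointBall A) ξ n (fun i => (b i : 𝕜)) x := by
  have hist := hist_gameS_of_mem_derivList ξ _ (by simpa using hε) _ h
  rw [List.length_ofFn] at hist
  obtain ⟨x, hx1, hx2, hx3⟩ := exists_tree_of_hist hn _ hist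
  refine ⟨x, hx1, hx2, fun b hb => ?_⟩
  have := nonempty_maxs_gamma 𝕜 ξ hn (WeakIndex 𝕜 X)
  refine le_ciInf fun t => ?_
  obtain ⟨g, hg, hgl⟩ := hx3 t.1 (mem_maxs_withIndex.1 t.2)
  rw [supportFn_adjointBall]
  refine le_trans ?_ (re_apply_le_of_mem_adjointBall hg _)
  rw [map_sum, map_sum]
  refine Finset.sum_le_sum fun i _ => ?_
  rw [map_smul, _root_.smul_eq_mul, RCLike.re_ofReal_mul]
  refine mul_le_mul_of_nonneg_left ?_ (hb i)
  have := List.Forall₂.get hgl (i := i) (by simp) (by simp)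
  simpa [levelSum_vecStep] using this

/-- A non-empty iterated derivative produces a weakly null tree on which every branch has norm at
least ∑ bᵢ εᵢ / 8; testing α on this tree gives the estimate. -/
theorem estimate_of_opAlpha_le (hγ : 1 ≤ γ) (A : X →L[𝕜] Y) {M : ℝ} (hM : 0 ≤ M)
    (h : opAlpha A ξ γ ≤ ENNReal.ofReal M) : Estimate (adjointBall A) ξ γ (8 * M) := by
  have : Fact (1 ≤ γ) := ⟨hγ⟩
  intro n ε b hε hb hne
  rcases eq_or_ne n 0 with rfl | hn
  · simpa using mul_nonneg (mul_nonneg (by norm_num) hM) (ellNorm_nonneg (q := γ) b)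
  obtain ⟨x, hx1, hx2, hx3⟩ := exists_tree_of_derivList A hn hε hne
  -- The number α_{ξ,γ,n} is an infimum that need not be attained, so the bound is shown for `M' >
  -- M` and `M'` tends to `M`.
  have key : ∀ M' > M, ∑ i, b i * (ε i / 8) ≤ M' * ellNorm γ b := by
    intro M' hM'
    have h1 : alphaN (adjointBall A) ξ γ n < ENNReal.ofReal M' :=
      ((le_iSup₂ (f := fun n (_ : 1 ≤ n) => alphaN (adjointBall A) ξ γ n) n
        (Nat.one_le_iff_ne_zero.2 hn)).trans h).trans_lt
          ((ENNReal.ofReal_lt_ofReal_iff (hM.trans_lt hM')).2 hM')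
    rw [alphaN, iInf_lt_iff] at h1
    obtain ⟨α, h1⟩ := h1
    rw [iInf_lt_iff] at h1
    obtain ⟨⟨hα0, hα⟩, h1⟩ := h1
    have h2 := hα (WeakIndex 𝕜 X) (fun i => (b i : 𝕜)) x hx1 hx2
    rw [norm_toLp_eq_ellNorm hγ] at h2
    simp only [RCLike.norm_ofReal, abs_of_nonneg (hb _)] at h2
    refine (hx3 b hb).trans (h2.trans ?_)
    have : α < M' := (ENNReal.ofReal_lt_ofReal_iff (hM.trans_lt hM')).1 h1
    exact mul_le_mul_of_nonneg_right this.le (ellNorm_nonneg _)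
  have h1 : ∑ i, b i * (ε i / 8) ≤ M * ellNorm γ b := by
    refine ge_of_tendsto (x := 𝓝[>] M) ?_ (eventually_mem_nhdsWithin.mono key)
    exact ((continuous_id.mul continuous_const).tendsto M).mono_left nhdsWithin_le_nhds
  have h2 : ∑ i, b i * (ε i / 8) = (∑ i, b i * ε i) / 8 := by
    rw [Finset.sum_div]
    exact Finset.sum_congr rfl fun i _ => by ring
  rw [h2] at h1
  linarith

theorem ofReal_le_opTheta (A : X →L[𝕜] Y) {ε : ℝ} (hε : 0 < ε)
    (h : (szlenkDerivatives ε (adjointBall A) (ω ^ ξ)).Nonempty) :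
    ENNReal.ofReal (ε / 8) ≤ opTheta A ξ 1 := by
  obtain ⟨x, hx1, hx2, hx3⟩ := exists_tree_of_derivList (ξ := ξ) A one_ne_zero (ε := fun _ => ε)
    (fun _ => hε.le) (by
      simpa [List.ofFn_succ, derivList_cons, derivList_nil, derivZ_of_ne hε.ne'] using h)
  refine le_iInf₂ fun θ hθ => ENNReal.ofReal_le_ofReal ?_
  have h1 := hx3 (fun _ => 1) fun _ => zero_le_one
  have h2 := hθ.2 (WeakIndex 𝕜 X) x hx1 hx2
  simp only [Nat.cast_one, one_div, inv_one, RCLike.ofReal_one] at h1 h2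
  simpa using h1.trans h2

theorem opAlpha_le (hγ : 1 ≤ γ) (A : X →L[𝕜] Y) {M : ℝ} (hM : 0 ≤ M)
    (h : ∀ (n : ℕ) (D : Type u) [Preorder D] [IsDirectedOrder D] [Nonempty D] (a : Fin n → 𝕜)
      (x : List (Ordinal.{u} × D) → X), n ≠ 0 → InBall (gamma ξ n) D x →
        WeaklyNull 𝕜 (gamma ξ n) D x → ∀ η : ℝ, 0 < η → ∃ t ∈ maxs (withIndex (gamma ξ n) D),
          ‖A (∑ i : Fin n, a i • blockSum (𝕜 := 𝕜) ξ n (i + 1) x t)‖ ≤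
            M * ellNorm γ (fun i => ‖a i‖) + η) :
    opAlpha A ξ γ ≤ ENNReal.ofReal M := by
  have : Fact (1 ≤ γ) := ⟨hγ⟩
  refine iSup₂_le fun n hn => ?_
  refine ENNReal.le_of_forall_pos_le_add fun η hη _ => ?_
  rw [← ENNReal.ofReal_coe_nnreal, ← ENNReal.ofReal_add hM η.coe_nonneg]
  refine iInf₂_le (M + η) ⟨add_pos_of_nonneg_of_pos hM hη, ?_⟩
  intro D _ _ _ a x hb hw
  rw [norm_toLp_eq_ellNorm hγ]
  refine le_of_forall_pos_le_add fun η' hη' => ?_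
  obtain ⟨t, ht, h1⟩ := h n D a x (Nat.one_le_iff_ne_zero.1 hn) hb hw η' hη'
  refine (treeInf_le A a x ht).trans (h1.trans ?_)
  gcongr
  · exact ellNorm_nonneg _
  · exact le_add_of_nonneg_right η.coe_nonneg

theorem opTheta_le (A : X →L[𝕜] Y) {M : ℝ} (hM : 0 < M)
    (h : ∀ (D : Type u) [Preorder D] [IsDirectedOrder D] [Nonempty D]
      (x : List (Ordinal.{u} × D) → X), InBall (gamma ξ 1) D x → WeaklyNull 𝕜 (gamma ξ 1) D x →
        ∃ t ∈ maxs (withIndex (gamma ξ 1) D), ‖A (blockSum (𝕜 := 𝕜) ξ 1 1 x t)‖ ≤ M) :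
    opTheta A ξ 1 ≤ ENNReal.ofReal M := by
  refine iInf₂_le M ⟨hM, ?_⟩
  intro D _ _ _ x hb hw
  obtain ⟨t, ht, h1⟩ := h D x hb hw
  refine (treeInf_le A _ x ht).trans ?_
  simpa using h1

theorem ofFn_getD_eq_gridList {δ : ℝ} {J n : ℕ} (l : List (Fin (J + 1))) (hl : l.length = n) :
    List.ofFn (fun i : Fin n => (((l.getD i 0 : Fin (J + 1)) : ℕ) : ℝ) * δ) = gridList δ l := by
  subst hl
  refine List.ext_getElem (by simp [gridList]) fun j h1 h2 => ?_
  simp only [List.length_ofFn] at h1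
  simp [gridList, List.getD_eq_getElem?_getD]

/-- The bound for a single operator along an adapted branch. -/
theorem norm_le_of_drops (hγ : 1 ≤ γ) (B : X →L[𝕜] Y) {β δ : ℝ} (hβ : 0 ≤ β) (hδ : 0 ≤ δ) {J : ℕ}
    (hest : Estimate (adjointBall B) ξ γ β) {n k : ℕ} (hk : k ≤ n) (a : ℕ → 𝕜) (z : ℕ → X)
    (w τ : ℕ → ℝ) (hw : ∀ m < n, 0 ≤ w m)
    (h : ∀ f ∈ adjointBall B, ∃ l : List (Fin (J + 1)), l.length = n - k ∧
      ∃ g ∈ derivList (ω ^ ξ) (gridList δ l) (adjointBall B),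
        RCLike.re (f (∑ m ∈ Finset.range n, a m • z m)) ≤
          RCLike.re (g (∑ m ∈ Finset.range k, a m • z m)) +
            ∑ m ∈ Finset.range (n - k), (‖a (k + m)‖ *
              (w (k + m) * (((l.getD m 0 : Fin (J + 1)) + 1) * δ)) + τ (k + m))) :
    ‖B (∑ m ∈ Finset.range n, a m • z m)‖ ≤ ‖B (∑ m ∈ Finset.range k, a m • z m)‖ +
      β * ellNorm γ (fun m : Fin n => ‖a m‖ * w m) + δ * ∑ m ∈ Finset.range n, ‖a m‖ * w m +
        ∑ m ∈ Finset.Ico k n, τ m := by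
  have : Fact (1 ≤ γ) := ⟨hγ⟩
  obtain ⟨f, hf, hfe⟩ := exists_mem_adjointBall B (∑ m ∈ Finset.range n, a m • z m)
  obtain ⟨l, hl, g, hg, hle⟩ := h f hf
  rw [hfe] at hle
  have h1 := re_apply_le_of_mem_adjointBall (derivList_subset _ hg)
    (∑ m ∈ Finset.range k, a m • z m)
  -- The functional `g` witnesses that the iterated derivative at the levels l_m δ is non-empty, so
  -- the estimate applies to them. The extra δ in (l_m + 1) δ gives the separate term with δ.
  rw [← ofFn_getD_eq_gridList l hl] at hg
  have h2 := hest (n - k) _ (fun m => ‖a (k + m)‖ * w (k + m))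
    (fun i => mul_nonneg (Nat.cast_nonneg _) hδ)
    (fun i => mul_nonneg (norm_nonneg _) (hw _ (by omega))) ⟨g, hg⟩
  have h3 : ellNorm γ (fun m : Fin (n - k) => ‖a (k + m)‖ * w (k + m)) ≤
      ellNorm γ (fun m : Fin n => ‖a m‖ * w m) :=
    ellNorm_comp_le (e := fun m : Fin (n - k) => (⟨k + m, by omega⟩ : Fin n))
      (fun i j hij => by simpa [Fin.ext_iff] using hij) (fun m : Fin n => ‖a m‖ * w m)
  have h4 : ∑ m ∈ Finset.range (n - k), ‖a (k + m)‖ * w (k + m) ≤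
      ∑ m ∈ Finset.range n, ‖a m‖ * w m := by
    rw [← Finset.sum_Ico_eq_sum_range (fun m => ‖a m‖ * w m)]
    refine Finset.sum_le_sum_of_subset_of_nonneg (fun m hm => ?_) fun m hm _ =>
      mul_nonneg (norm_nonneg _) (hw m (Finset.mem_range.1 hm))
    exact Finset.mem_range.2 (Finset.mem_Ico.1 hm).2
  have h5 : ∑ m ∈ Finset.range (n - k), (‖a (k + m)‖ *
      (w (k + m) * (((l.getD m 0 : Fin (J + 1)) + 1) * δ)) + τ (k + m)) =
      (∑ m : Fin (n - k), ‖a (k + m)‖ * w (k + m) * ((l.getD m 0 : Fin (J + 1)) * δ)) +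
        δ * (∑ m ∈ Finset.range (n - k), ‖a (k + m)‖ * w (k + m)) + ∑ m ∈ Finset.Ico k n, τ m := by
    rw [Finset.sum_Ico_eq_sum_range, Finset.mul_sum,
      Fin.sum_univ_eq_sum_range
        (fun m => ‖a (k + m)‖ * w (k + m) * (((l.getD m 0 : Fin (J + 1)) : ℝ) * δ)) (n - k),
      ← Finset.sum_add_distrib, ← Finset.sum_add_distrib]
    exact Finset.sum_congr rfl fun m _ => by ring
  rw [h5] at hle
  have h6 := mul_le_mul_of_nonneg_left h3 hβ
  have h7 := mul_le_mul_of_nonneg_left h4 hδ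
  linarith

end Estimates

/-! ### Coordinates of direct sums -/

section Coordinates

variable {𝕜 : Type*} [RCLike 𝕜] {X : Type u} [NormedAddCommGroup X] [NormedSpace 𝕜 X]
  {Z : Type u} [NormedAddCommGroup Z] [NormedSpace 𝕜 Z]

theorem continuous_weakDual_comp (T : Z →L[𝕜] X) :
    Continuous fun f : WeakDual 𝕜 X =>
      StrongDual.toWeakDual ((StrongDual.toWeakDual.symm f).comp T) :=
  WeakDual.continuous_of_continuous_eval fun x => WeakDual.eval_continuous (T x)

theorem mapsTo_derivList {φ : StrongDual 𝕜 X → StrongDual 𝕜 Z}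
    (hφ : Continuous fun f : WeakDual 𝕜 X =>
      StrongDual.toWeakDual (φ (StrongDual.toWeakDual.symm f)))
    {L : Set (StrongDual 𝕜 X)} {K : Set (StrongDual 𝕜 Z)}
    (hL : ∀ f ∈ L, ∀ g ∈ L, ‖f - g‖ ≤ ‖φ f - φ g‖) (hLK : Set.MapsTo φ L K)
    (η : Ordinal.{u}) (l : List ℝ) (hl : ∀ ε ∈ l, 0 ≤ ε) :
    Set.MapsTo φ (derivList η l L) (derivList η l K) := by
  induction l with
  | nil => exact hLK
  | cons ε l ih =>
    rw [List.forall_mem_cons] at hl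
    rw [derivList_cons, derivList_cons]
    rcases eq_or_ne ε 0 with rfl | h0
    · simpa only [derivZ_zero] using ih hl.2
    · rw [derivZ_of_ne h0, derivZ_of_ne h0]
      refine image_szlenkDerivatives hφ one_pos hl.1 (one_mul ε).ge (fun f hf g hg => ?_)
        (ih hl.2) η
      rw [one_mul]
      exact hL f (derivList_subset l hf) g (derivList_subset l hg)

theorem Estimate.of_mapsTo {φ : StrongDual 𝕜 X → StrongDual 𝕜 Z}
    (hφ : Continuous fun f : WeakDual 𝕜 X =>
      StrongDual.toWeakDual (φ (StrongDual.toWeakDual.symm f)))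
    {L : Set (StrongDual 𝕜 X)} {K : Set (StrongDual 𝕜 Z)}
    (hL : ∀ f ∈ L, ∀ g ∈ L, ‖f - g‖ ≤ ‖φ f - φ g‖) (hLK : Set.MapsTo φ L K)
    {ξ : Ordinal.{u}} {γ : ℝ≥0∞} {β : ℝ} (hK : Estimate K ξ γ β) : Estimate L ξ γ β :=
  fun n ε b hε hb ⟨f, hf⟩ => hK n ε b hε hb
    ⟨φ f, mapsTo_derivList hφ hL hLK _ _ (by simpa using hε) hf⟩

theorem ellNorm_anti {ι : Type*} [Fintype ι] {q q' : ℝ≥0∞} [hq : Fact (1 ≤ q)] [Fact (1 ≤ q')]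
    (h : q ≤ q') (b : ι → ℝ) : ellNorm q' b ≤ ellNorm q b := by
  rcases eq_or_ne q' ∞ with rfl | hq'
  · rw [ellNorm_top]
    exact Real.iSup_le (abs_le_ellNorm b) (ellNorm_nonneg _)
  have hqt := ne_top_of_le_ne_top hq' h
  have hq0 := toReal_pos_of_one_le hq.out hqt
  have hle : q.toReal ≤ q'.toReal := ENNReal.toReal_mono hq' h
  have hq0' := hq0.trans_le hle
  have hd : 0 ≤ q'.toReal - q.toReal := sub_nonneg.2 hle
  rw [← Real.rpow_le_rpow_iff (ellNorm_nonneg _) (ellNorm_nonneg _) hq0', ellNorm_rpow hq']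
  rcases (ellNorm_nonneg (q := q) b).eq_or_lt with h0 | h0
  · rw [← h0, Real.zero_rpow hq0'.ne']
    exact (Finset.sum_eq_zero fun i _ => by
      rw [ellNorm_eq_zero h0.symm i, abs_zero, Real.zero_rpow hq0'.ne']).le
  · calc ∑ i, |b i| ^ q'.toReal
        ≤ ∑ i, ellNorm q b ^ (q'.toReal - q.toReal) * |b i| ^ q.toReal := by
          refine Finset.sum_le_sum fun i _ => ?_
          rcases (abs_nonneg (b i)).eq_or_lt with hi | hi
          · rw [← hi, Real.zero_rpow hq0'.ne', Real.zero_rpow hq0.ne', mul_zero]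
          · calc |b i| ^ q'.toReal = |b i| ^ (q'.toReal - q.toReal) * |b i| ^ q.toReal := by
                  rw [← Real.rpow_add hi, sub_add_cancel]
              _ ≤ _ := by
                gcongr
                exact abs_le_ellNorm b i
      _ = ellNorm q b ^ q'.toReal := by
          rw [← Finset.mul_sum, ← ellNorm_rpow hqt, ← Real.rpow_add h0, sub_add_cancel]

variable {Λ : Type u} {X Y : Λ → Type u} [∀ l, NormedAddCommGroup (X l)]
  [∀ l, NormedSpace 𝕜 (X l)] [∀ l, NormedAddCommGroup (Y l)] [∀ l, NormedSpace 𝕜 (Y l)]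
  {p r : ℝ≥0∞} [hp : Fact (p = 0 ∨ 1 ≤ p)] [hr : Fact (r = 0 ∨ 1 ≤ r)]

theorem normExp_ne_zero (p : ℝ≥0∞) [Fact (p = 0 ∨ 1 ≤ p)] : normExp p ≠ 0 :=
  (zero_lt_one.trans_le (normExp_fact p).out).ne'

theorem ellNorm_norm_le_norm {q : ℝ≥0∞} [hq : Fact (1 ≤ q)] (y : lp X q) (S : Finset Λ) :
    ellNorm q (fun l : S => ‖y l‖) ≤ ‖y‖ := by
  rcases eq_or_ne q ∞ with rfl | h
  · rw [ellNorm_top]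
    refine Real.iSup_le (fun l => ?_) (norm_nonneg _)
    rw [abs_of_nonneg (norm_nonneg _)]
    exact lp.norm_apply_le_norm ENNReal.top_ne_zero y l
  · have h0 := toReal_pos_of_one_le hq.out h
    rw [← Real.rpow_le_rpow_iff (ellNorm_nonneg _) (norm_nonneg _) h0, ellNorm_rpow h,
      Finset.sum_coe_sort S (fun l => |‖y l‖| ^ q.toReal)]
    simpa using lp.sum_rpow_le_norm_rpow h0 y S

theorem norm_le_of_ellNorm_le_lp {q : ℝ≥0∞} [hq : Fact (1 ≤ q)] (y : lp X q) {M : ℝ} (hM : 0 ≤ M)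
    (h : ∀ S : Finset Λ, ellNorm q (fun l : S => ‖y l‖) ≤ M) : ‖y‖ ≤ M := by
  rcases eq_or_ne q ∞ with rfl | h'
  · refine lp.norm_le_of_forall_le hM fun l => ?_
    have := (abs_le_ellNorm (q := ∞) (fun l' : ({l} : Finset Λ) => ‖y l'‖)
      ⟨l, by simp⟩).trans (h {l})
    simpa using this
  · have h0 := toReal_pos_of_one_le hq.out h'
    refine lp.norm_le_of_forall_sum_le h0 hM fun S => ?_
    have := Real.rpow_le_rpow (ellNorm_nonneg _) (h S) h0.le
    rw [ellNorm_rpow h', Finset.sum_coe_sort S (fun l => |‖y l‖| ^ q.toReal)] at this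
    simpa using this

theorem ellNorm_norm_le (x : directSum 𝕜 X p) (S : Finset Λ) :
    ellNorm (normExp p) (fun l : S => ‖x.1 l‖) ≤ ‖x‖ :=
  ellNorm_norm_le_norm x.1 S

theorem norm_le_of_ellNorm_le (x : directSum 𝕜 X p) {M : ℝ} (hM : 0 ≤ M)
    (h : ∀ S : Finset Λ, ellNorm (normExp p) (fun l : S => ‖x.1 l‖) ≤ M) : ‖x‖ ≤ M :=
  norm_le_of_ellNorm_le_lp x.1 hM h

theorem ellNorm_norm_le' {q : ℝ≥0∞} [Fact (1 ≤ q)] (hpq : normExp p ≤ q) (x : directSum 𝕜 X p)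
    (S : Finset Λ) : ellNorm q (fun l : S => ‖x.1 l‖) ≤ ‖x‖ :=
  (ellNorm_anti hpq _).trans (ellNorm_norm_le x S)

theorem norm_coord_le (x : directSum 𝕜 X p) (l : Λ) : ‖x.1 l‖ ≤ ‖x‖ :=
  lp.norm_apply_le_norm (normExp_ne_zero p) x.1 l

variable (𝕜 X p) in
/-- The coordinate maps of a direct sum. -/
noncomputable def coord (l : Λ) : directSum 𝕜 X p →L[𝕜] X l :=
  (lp.evalCLM 𝕜 X (normExp p) l).comp (directSum 𝕜 X p).subtypeL

theorem coord_apply (l : Λ) (x : directSum 𝕜 X p) : coord 𝕜 X p l x = x.1 l := rfl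

open Classical in
variable (𝕜 X p) in
/-- The inclusions of the summands into a direct sum. -/
noncomputable def single (l : Λ) : X l →L[𝕜] directSum 𝕜 X p :=
  (lp.singleContinuousLinearMap 𝕜 X (normExp p) l).codRestrict (directSum 𝕜 X p) fun x _ => by
    refine tendsto_const_nhds.congr' ?_
    have : ({l}ᶜ : Set Λ) ∈ cofinite := (Set.finite_singleton l).compl_mem_cofinite
    filter_upwards [this] with m hm
    have : m ≠ l := hm
    rw [lp.singleContinuousLinearMap_apply, lp.single_apply, Pi.single_eq_of_ne this, norm_zero]

theorem single_apply_same (l : Λ) (x : X l) : (single 𝕜 X p l x).1 l = x := by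
  classical
  exact (lp.single_apply _ _ _ _).trans (Pi.single_eq_same _ _)

theorem norm_single (l : Λ) (x : X l) : ‖single 𝕜 X p l x‖ = ‖x‖ := by
  classical
  exact lp.norm_single (pos_iff_ne_zero.2 (normExp_ne_zero p)) l x

theorem coord_comp_single (l : Λ) :
    (coord 𝕜 X p l).comp (single 𝕜 X p l) = ContinuousLinearMap.id 𝕜 (X l) := by
  ext x
  exact single_apply_same (𝕜 := 𝕜) (p := p) l x

theorem comp_coord_comp_single {l : Λ} (g : StrongDual 𝕜 (X l)) :
    (g.comp (coord 𝕜 X p l)).comp (single 𝕜 X p l) = g := by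
  rw [ContinuousLinearMap.comp_assoc, coord_comp_single, ContinuousLinearMap.comp_id]

theorem norm_comp_coord {l : Λ} (g : StrongDual 𝕜 (X l)) : ‖g.comp (coord 𝕜 X p l)‖ = ‖g‖ := by
  refine le_antisymm ?_ ?_
  · refine ContinuousLinearMap.opNorm_le_bound _ (norm_nonneg _) fun x => ?_
    exact (g.le_opNorm _).trans (mul_le_mul_of_nonneg_left (norm_coord_le x l) (norm_nonneg _))
  · refine ContinuousLinearMap.opNorm_le_bound g (norm_nonneg (g.comp (coord 𝕜 X p l)))
      fun x => ?_
    have := (g.comp (coord 𝕜 X p l)).le_opNorm (single 𝕜 X p l x)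
    rw [norm_single] at this
    simpa [coord_apply, single_apply_same] using this

theorem mem_adjointBall_comp_coord {l : Λ} {B : X l →L[𝕜] Y l} {f : StrongDual 𝕜 (directSum 𝕜 X p)} :
    f ∈ adjointBall (B.comp (coord 𝕜 X p l)) ↔
      ∃ g ∈ adjointBall B, f = g.comp (coord 𝕜 X p l) := by
  constructor
  · rintro ⟨h, hh, rfl⟩
    exact ⟨_, ⟨h, hh, rfl⟩, rfl⟩
  · rintro ⟨_, ⟨h, hh, rfl⟩, rfl⟩
    exact ⟨h, hh, rfl⟩

/-- The control is by the norm of the coordinate `l`, not by that of the whole vector: the resulting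
bounds must be summed over `l` in an ℓ_q-norm. -/
theorem controlled_comp_coord {l : Λ} (B : X l →L[𝕜] Y l) {d : ℝ} (hd : 2 * ‖B‖ ≤ d) :
    Controlled (adjointBall (B.comp (coord 𝕜 X p l))) (fun x => ‖x.1 l‖) d where
  wcompact := wcompact_adjointBall _
  norm_sub_le := fun f hf g hg => by
    obtain ⟨f', hf', rfl⟩ := mem_adjointBall_comp_coord.1 hf
    obtain ⟨g', hg', rfl⟩ := mem_adjointBall_comp_coord.1 hg
    rw [← ContinuousLinearMap.sub_comp, norm_comp_coord]
    exact (norm_sub_le_of_mem_adjointBall hf' hg').trans hd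
  apply_le := fun f hf g hg x => by
    obtain ⟨f', hf', rfl⟩ := mem_adjointBall_comp_coord.1 hf
    obtain ⟨g', hg', rfl⟩ := mem_adjointBall_comp_coord.1 hg
    rw [← ContinuousLinearMap.sub_comp, norm_comp_coord]
    exact (f' - g').le_opNorm _

/-- Composition with the inclusion of the summand inverts composition with the coordinate map
isometrically on these functionals. -/
theorem Estimate.comp_coord {l : Λ} {B : X l →L[𝕜] Y l} {ξ : Ordinal.{u}} {γ : ℝ≥0∞} {β : ℝ}
    (h : Estimate (adjointBall B) ξ γ β) :
    Estimate (adjointBall (B.comp (coord 𝕜 X p l))) ξ γ β := by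
  refine h.of_mapsTo (φ := fun f => f.comp (single 𝕜 X p l))
    (continuous_weakDual_comp (single 𝕜 X p l)) ?_ ?_
  · intro f hf g hg
    obtain ⟨f', hf', rfl⟩ := mem_adjointBall_comp_coord.1 hf
    obtain ⟨g', hg', rfl⟩ := mem_adjointBall_comp_coord.1 hg
    change _ ≤ ‖(f'.comp (coord 𝕜 X p l)).comp (single 𝕜 X p l) -
      (g'.comp (coord 𝕜 X p l)).comp (single 𝕜 X p l)‖
    rw [← ContinuousLinearMap.sub_comp, norm_comp_coord, comp_coord_comp_single,
      comp_coord_comp_single]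
  · intro f hf
    obtain ⟨f', hf', rfl⟩ := mem_adjointBall_comp_coord.1 hf
    change (f'.comp (coord 𝕜 X p l)).comp (single 𝕜 X p l) ∈ _
    rwa [comp_coord_comp_single]

/-- Off a finite set of coordinates, the members of a direct sum with finite exponent are small. -/
theorem exists_finset_ellNorm_le (hpt : p < ∞) {q : ℝ≥0∞} [Fact (1 ≤ q)] (hpq : normExp p ≤ q)
    (x : directSum 𝕜 X p) {η : ℝ} (hη : 0 < η) :
    ∃ F : Finset Λ, ∀ S : Finset Λ,
      ellNorm q (fun l : S => open Classical in if (l : Λ) ∈ F then 0 else ‖x.1 l‖) ≤ η := by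
  classical
  rcases eq_or_ne p 0 with h0 | h0
  · have hx := x.2 h0
    have hq : q = ∞ := by
      rw [normExp, if_pos h0] at hpq
      exact top_le_iff.1 hpq
    have := (hx.eventually (gt_mem_nhds hη))
    rw [eventually_cofinite] at this
    refine ⟨this.toFinset, fun S => ?_⟩
    rw [hq, ellNorm_top]
    refine Real.iSup_le (fun l => ?_) hη.le
    split_ifs with h
    · simpa using hη.le
    · rw [abs_of_nonneg (norm_nonneg _)]
      by_contra hcon
      exact h (this.mem_toFinset.2 fun hlt => hcon hlt.le)
  · have he : normExp p = p := if_neg h0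
    have hne : normExp p ≠ ∞ := by rw [he]; exact hpt.ne
    have hpos := toReal_pos_of_one_le (normExp_fact p).out hne
    have hs := (lp.memℓp x.1).summable hpos
    obtain ⟨F, hF⟩ := summable_iff_vanishing.1 hs _ (Iio_mem_nhds (Real.rpow_pos_of_pos hη _))
    refine ⟨F, fun S => (ellNorm_anti hpq _).trans ?_⟩
    rw [← Real.rpow_le_rpow_iff (ellNorm_nonneg _) hη.le hpos, ellNorm_rpow hne]
    refine le_trans (le_of_eq ?_) (hF (S \ F) Finset.sdiff_disjoint).le
    rw [Finset.sum_coe_sort S (fun l => |if l ∈ F then 0 else ‖x.1 l‖| ^ (normExp p).toReal),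
      Finset.sdiff_eq_filter, Finset.sum_filter]
    refine Finset.sum_congr rfl fun l _ => ?_
    by_cases h : l ∈ F <;> simp [h, Real.zero_rpow hpos.ne']

end Coordinates

/-! ### Upper estimates for diagonal operators -/

section UpperSums

variable {𝕜 : Type*} [RCLike 𝕜] {Λ : Type u} {X Y : Λ → Type u} [∀ l, NormedAddCommGroup (X l)]
  [∀ l, NormedSpace 𝕜 (X l)] [∀ l, NormedAddCommGroup (Y l)] [∀ l, NormedSpace 𝕜 (Y l)]
  {p r : ℝ≥0∞} [hp : Fact (p = 0 ∨ 1 ≤ p)] [hr : Fact (r = 0 ∨ 1 ≤ r)]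

/-- The coordinates of `v.1` are bounded by those of `v.2`, which are bounded in `ℓ_q`. -/
def Dominated (𝕜 : Type*) [RCLike 𝕜] [∀ l, NormedSpace 𝕜 (X l)] (q : ℝ≥0∞) (c : ℝ)
    (v : directSum 𝕜 X p × (Λ → ℝ)) : Prop :=
  (∀ l, ‖v.1.1 l‖ ≤ v.2 l) ∧ ∀ S : Finset Λ, ellNorm q (fun l : S => v.2 l) ≤ c

theorem Dominated.zero (q : ℝ≥0∞) [Fact (1 ≤ q)] :
    Dominated (X := X) (p := p) 𝕜 q 0 0 :=
  ⟨fun l => by simp, fun S => (ellNorm_zero (q := q)).le⟩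

theorem Dominated.add {q : ℝ≥0∞} [Fact (1 ≤ q)] {c c' : ℝ} {v v' : directSum 𝕜 X p × (Λ → ℝ)}
    (h : Dominated 𝕜 q c v) (h' : Dominated 𝕜 q c' v') : Dominated 𝕜 q (c + c') (v + v') :=
  ⟨fun l => (norm_add_le _ _).trans (add_le_add (h.1 l) (h'.1 l)),
    fun S => (ellNorm_add_le _ _).trans (add_le_add (h.2 S) (h'.2 S))⟩

theorem Dominated.of_norm_le {q : ℝ≥0∞} [Fact (1 ≤ q)] (hpq : normExp p ≤ q) {c : ℝ} (hc : 0 ≤ c)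
    {x : directSum 𝕜 X p} (hx : ‖x‖ ≤ 1) :
    Dominated 𝕜 q c ((c : 𝕜) • x, fun l => c * ‖x.1 l‖) := by
  refine ⟨fun l => ?_, fun S => ?_⟩
  · refine (norm_smul_le (c : 𝕜) (x.1 l)).trans ?_
    rw [RCLike.norm_ofReal, abs_of_nonneg hc]
  · refine (ellNorm_const_mul c fun l : S => ‖x.1 l‖).trans_le ?_
    rw [abs_of_nonneg hc]
    exact mul_le_of_le_one_right hc ((ellNorm_norm_le' hpq x S).trans hx)

theorem exists_grid {δ : ℝ} (hδ : 0 < δ) (C : ℝ) : ∃ J : ℕ, C ≤ (J + 1) * δ := by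
  obtain ⟨J, hJ⟩ := exists_nat_ge (C / δ)
  refine ⟨J, ?_⟩
  rw [div_le_iff₀ hδ] at hJ
  linarith

/-- A sum over an initial segment of rounds is dominated by its last term and by the parts of the
other terms off the given finite sets. -/
theorem sum_range_le_of_not_mem {n k : ℕ} (hk : k ≤ n) {b z w o : ℕ → ℝ} {M : ℝ} (hM : 0 ≤ M)
    (hb : ∀ m, 0 ≤ b m) (hz : ∀ m < n, z m ≤ w m) (hw : ∀ m < n, b m * w m ≤ M)
    (ho : ∀ m, 0 ≤ o m) (hzo : ∀ m, m + 1 < k → z m = o m) :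
    ∑ m ∈ Finset.range k, b m * z m ≤ M + ∑ m ∈ Finset.range n, b m * o m := by
  cases k with
  | zero =>
    simpa using add_nonneg hM (Finset.sum_nonneg fun m _ => mul_nonneg (hb m) (ho m))
  | succ k =>
    rw [Finset.sum_range_succ, add_comm]
    refine add_le_add ?_ ?_
    · exact (mul_le_mul_of_nonneg_left (hz k (by omega)) (hb k)).trans (hw k (by omega))
    · rw [Finset.sum_congr rfl fun m hm => by
        rw [hzo m (by have := Finset.mem_range.1 hm; omega)]]
      exact Finset.sum_le_sum_of_subset_of_nonneg (Finset.range_subset_range.2 (by omega))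
        fun m _ _ => mul_nonneg (hb m) (ho m)

theorem diagOp_univ_apply (h : Admissible p r) (A : ∀ l, X l →L[𝕜] Y l)
    (hA : ∃ C : ℝ, ∀ l, ‖A l‖ ≤ C) (x : directSum 𝕜 X p) (l : Λ) :
    (diagOp h A hA Set.univ x).1 l = A l (x.1 l) := by
  rw [diagOp_apply]
  simp

/-- Infinitely many coordinates cannot be controlled in one round. Each block vector is small off a
finite set of coordinates, and from the next round on these coordinates are controlled. A coordinate
is hence small until one uncontrolled round, which costs at most `C` times a single term, and
afterwards obeys the estimate with β. Both parts are at most a multiple of ‖(a_m w_m(l))_m‖_γ, whose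
ℓ_r-norm over `l` is bounded by Minkowski's inequality. -/
theorem opAlpha_diagOp_le (h : Admissible p r) (A : ∀ l, X l →L[𝕜] Y l)
    (hA : ∃ C : ℝ, ∀ l, ‖A l‖ ≤ C) {ξ : Ordinal.{u}} {γ : ℝ≥0∞} (hγ : 1 ≤ γ)
    (hγr : γ ≤ normExp r) {C β : ℝ} (hC0 : 0 ≤ C) (hC : ∀ l, ‖A l‖ ≤ C) (hβ : 0 ≤ β)
    (hest : ∀ l, Estimate (adjointBall (A l)) ξ γ β) :
    opAlpha (diagOp h A hA Set.univ) ξ γ ≤ ENNReal.ofReal (C + β) := by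
  classical
  have : Fact (1 ≤ γ) := ⟨hγ⟩
  refine opAlpha_le hγ _ (add_nonneg hC0 hβ) fun n D _ _ _ a x hn hb hw η hη => ?_
  set a' : ℕ → 𝕜 := fun m => if hm : m < n then a ⟨m, hm⟩ else 0 with ha'
  have ha : ∀ i : Fin n, a' i = a i := fun i => by simp [ha']
  set s : ℝ := ∑ m ∈ Finset.range n, ‖a' m‖ with hs
  have hs0 : 0 ≤ s := Finset.sum_nonneg fun _ _ => norm_nonneg _
  have hn0 : (0 : ℝ) < n := by exact_mod_cast Nat.pos_of_ne_zero hn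
  set δ : ℝ := η / (3 * (s + 1)) with hδdef
  have hδ : 0 < δ := by positivity
  have hδs : δ * s ≤ η / 3 := by
    rw [hδdef, div_mul_eq_mul_div, div_le_div_iff₀ (by positivity) (by positivity)]
    nlinarith
  set κ : ℝ := η / (3 * (C + 1) * (s + 1)) with hκdef
  have hκ : 0 < κ := by positivity
  have hκs : C * (κ * s) ≤ η / 3 := by
    have : C * (κ * s) = η / 3 * ((C / (C + 1)) * (s / (s + 1))) := by
      rw [hκdef]; field_simp
    rw [this]
    refine mul_le_of_le_one_right (by positivity) (mul_le_one₀ ?_ (by positivity) ?_)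
    · exact (div_le_one (by positivity)).2 (by linarith)
    · exact (div_le_one (by positivity)).2 (by linarith)
  obtain ⟨J, hJ⟩ := exists_grid hδ (2 * C)
  choose F hF using fun z : directSum 𝕜 X p => exists_finset_ellNorm_le h.lt_top h.normExp_le z hκ
  -- The coordinates on which some earlier block vector is not small.
  set Φ : List (directSum 𝕜 X p × (Λ → ℝ)) → Finset Λ := fun H =>
    H.toFinset.biUnion fun v => F v.1 with hΦ
  -- The error of a round occurs once for each controlled coordinate, hence the division by the
  -- number of them. The total is at most η/3, as are the errors from δ and κ.
  set τ : List (directSum 𝕜 X p × (Λ → ℝ)) → ℝ := fun H => η / (3 * n * ((Φ H).card + 1)) with hτdef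
  have hτ : ∀ H, 0 < τ H := fun H => by positivity
  obtain ⟨t, ht, v, hv, hdom, hdrop⟩ := exists_adapted_branch (𝕜 := 𝕜)
    (N := fun l (x : directSum 𝕜 X p) => ‖x.1 l‖)
    (fun l x => ⟨norm_nonneg _, norm_coord_le x l⟩) hδ J a' ξ hn
    (K := fun l => adjointBall ((A l).comp (coord 𝕜 X p l)))
    (fun l => controlled_comp_coord (A l) (by linarith [hC l]))
    (Dominated 𝕜 (normExp r)) (Dominated.zero _) (fun _ _ _ _ _ _ h1 h2 => h1.add h2)
    (fun c x hc hx => Dominated.of_norm_le h.normExp_le hc hx) Φ τ hτ x hb hw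
  refine ⟨t, ht, ?_⟩
  have hsum : ∑ i : Fin n, a i • blockSum (𝕜 := 𝕜) ξ n (i + 1) x t =
      ∑ m ∈ Finset.range n, a' m • (v m).1 := by
    rw [← Fin.sum_univ_eq_sum_range (fun m => a' m • (v m).1) n]
    exact Finset.sum_congr rfl fun i _ => by rw [ha, hv i i.2]
  have hell : ellNorm γ (fun i : Fin n => ‖a i‖) = ellNorm γ fun i : Fin n => ‖a' i‖ := by
    simp only [ha]
  rw [hsum, hell]
  clear_value a'
  set T := ∑ m ∈ Finset.range n, a' m • (v m).1 with hT
  have hw0 : ∀ l, ∀ m < n, 0 ≤ (v m).2 l := fun l m hm =>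
    (norm_nonneg _).trans ((hdom m hm).1 l)
  set o : ℕ → Λ → ℝ := fun m l => if l ∈ F (v m).1 then 0 else ‖(v m).1.1 l‖ with ho
  have ho0 : ∀ m l, 0 ≤ o m l := fun m l => by
    simp only [ho]; split_ifs; exacts [le_rfl, norm_nonneg _]
  set τ' : ℕ → Λ → ℝ := fun m l => if l ∈ Φ ((List.range m).map v)
    then τ ((List.range m).map v) else 0 with hτ'
  have hτ'0 : ∀ m l, 0 ≤ τ' m l := fun m l => by
    simp only [hτ']; split_ifs; exacts [(hτ _).le, le_rfl]
  have hpoint : ∀ l, ‖A l (T.1 l)‖ ≤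
      (C + β) * ellNorm γ (fun m : Fin n => ‖a' m‖ * (v m).2 l) +
        δ * ∑ m ∈ Finset.range n, ‖a' m‖ * (v m).2 l + C * ∑ m ∈ Finset.range n, ‖a' m‖ * o m l +
          ∑ m ∈ Finset.range n, τ' m l := by
    intro l
    -- `k` is the first round before which the coordinate `l` has been noticed, or `n` if this never
    -- happens.
    have hex : ∃ k, k = n ∨ l ∈ Φ ((List.range k).map v) := ⟨n, Or.inl rfl⟩
    set k := Nat.find hex with hkdef
    have hkn : k ≤ n := Nat.find_min' hex (Or.inl rfl)
    have hΦmono : ∀ {i j : ℕ}, i ≤ j → Φ ((List.range i).map v) ⊆ Φ ((List.range j).map v) := by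
      intro i j hij
      refine Finset.biUnion_subset_biUnion_of_subset_left _ fun y hy => ?_
      simp only [List.mem_toFinset, List.mem_map, List.mem_range] at hy ⊢
      obtain ⟨m, hm, rfl⟩ := hy
      exact ⟨m, by omega, rfl⟩
    have hmem : ∀ m, k ≤ m → m < n → l ∈ Φ ((List.range m).map v) := fun m hm hmn =>
      hΦmono hm ((Nat.find_spec hex).resolve_left (by omega))
    have hnot : ∀ m, m + 1 < k → ‖(v m).1.1 l‖ = o m l := by
      intro m hm
      have := Nat.find_min hex hm
      rw [not_or] at this
      simp only [ho]
      rw [if_neg]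
      intro hlF
      refine this.2 (Finset.mem_biUnion.2 ⟨v m, ?_, hlF⟩)
      simp only [List.mem_toFinset, List.mem_map, List.mem_range]
      exact ⟨m, by omega, rfl⟩
    have h1 := norm_le_of_drops hγ ((A l).comp (coord 𝕜 X p l)) hβ hδ.le (hest l).comp_coord hkn a'
      (fun m => (v m).1) (fun m => (v m).2 l) (fun m => τ ((List.range m).map v)) (hw0 l)
      (hdrop l k hkn hmem)
    have h2 : ‖(A l).comp (coord 𝕜 X p l) (∑ m ∈ Finset.range k, a' m • (v m).1)‖ ≤
        C * ∑ m ∈ Finset.range k, ‖a' m‖ * ‖(v m).1.1 l‖ := by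
      rw [ContinuousLinearMap.comp_apply]
      refine ((A l).le_of_opNorm_le (hC l) _).trans (mul_le_mul_of_nonneg_left ?_ hC0)
      rw [map_sum]
      refine (norm_sum_le _ _).trans (Finset.sum_le_sum fun m _ => ?_)
      rw [map_smul, norm_smul, coord_apply]
    -- Among the rounds before `k`, only round `k - 1` can be large at `l`; its term is one entry of
    -- the family and so at most the ℓ_γ-norm of the family.
    have h3 := sum_range_le_of_not_mem hkn (b := fun m => ‖a' m‖) (z := fun m => ‖(v m).1.1 l‖)
      (w := fun m => (v m).2 l) (o := fun m => o m l)
      (ellNorm_nonneg (q := γ) (fun m : Fin n => ‖a' m‖ * (v m).2 l))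
      (fun m => norm_nonneg _) (fun m hm => (hdom m hm).1 l)
      (fun m hm => (le_abs_self _).trans
        (abs_le_ellNorm (q := γ) (fun m : Fin n => ‖a' m‖ * (v m).2 l) ⟨m, hm⟩))
      (fun m => ho0 m l) hnot
    have h4 : ∑ m ∈ Finset.Ico k n, τ ((List.range m).map v) ≤ ∑ m ∈ Finset.range n, τ' m l := by
      have : ∀ m ∈ Finset.Ico k n, τ ((List.range m).map v) = τ' m l := fun m hm => by
        have := Finset.mem_Ico.1 hm
        simp only [hτ']
        rw [if_pos (hmem m this.1 this.2)]
      rw [Finset.sum_congr rfl this]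
      refine Finset.sum_le_sum_of_subset_of_nonneg (fun m hm => ?_) fun m _ _ => hτ'0 m l
      exact Finset.mem_range.2 (Finset.mem_Ico.1 hm).2
    have h5 := mul_le_mul_of_nonneg_left h3 hC0
    have h6 : ‖A l (T.1 l)‖ = ‖(A l).comp (coord 𝕜 X p l) T‖ := rfl
    rw [h6]
    linarith
  refine norm_le_of_ellNorm_le _ (add_nonneg (mul_nonneg (add_nonneg hC0 hβ) (ellNorm_nonneg _))
    hη.le) fun S => ?_
  have hfin : ∀ f : ℕ → ℝ, ∑ m ∈ Finset.range n, ‖a' m‖ * f m = ∑ m : Fin n, ‖a' m‖ * f m :=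
    fun f => (Fin.sum_univ_eq_sum_range (fun m => ‖a' m‖ * f m) n).symm
  simp only [diagOp_univ_apply]
  refine (ellNorm_mono' (ι := S) (fun l => norm_nonneg _) fun l => hpoint l).trans ?_
  refine (ellNorm_add_le _ _).trans ?_
  refine (add_le_add ((ellNorm_add_le _ _).trans (add_le_add (ellNorm_add_le _ _) le_rfl))
    le_rfl).trans ?_
  -- The main term; here γ ≤ r is used, through Minkowski's inequality.
  have e1 : ellNorm (normExp r) (fun l : S => (C + β) *
      ellNorm γ (fun m : Fin n => ‖a' m‖ * (v m).2 l)) ≤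
        (C + β) * ellNorm γ fun m : Fin n => ‖a' m‖ := by
    rw [ellNorm_const_mul, abs_of_nonneg (add_nonneg hC0 hβ)]
    refine mul_le_mul_of_nonneg_left ?_ (add_nonneg hC0 hβ)
    exact ellNorm_ellNorm_le hγr (fun m : Fin n => ‖a' m‖) (fun m (l : S) => (v m).2 l)
      fun m => (hdom m m.2).2 S
  have hlin : ∀ (f : ℕ → Λ → ℝ) (d : ℝ), (∀ m < n, ellNorm (normExp r) (fun l : S => f m l) ≤ d) →
      ellNorm (normExp r) (fun l : S => ∑ m ∈ Finset.range n, ‖a' m‖ * f m l) ≤ d * s := by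
    intro f d hd
    refine (ellNorm_sum_le _ fun m (l : S) => ‖a' m‖ * f m l).trans ?_
    rw [hs, Finset.mul_sum]
    refine Finset.sum_le_sum fun m hm => ?_
    rw [ellNorm_const_mul, abs_of_nonneg (norm_nonneg _), mul_comm]
    exact mul_le_mul_of_nonneg_right (hd m (Finset.mem_range.1 hm)) (norm_nonneg _)
  have e2 : ellNorm (normExp r) (fun l : S => δ * ∑ m ∈ Finset.range n, ‖a' m‖ * (v m).2 l) ≤
      η / 3 := by
    rw [ellNorm_const_mul, abs_of_nonneg hδ.le]
    refine (mul_le_mul_of_nonneg_left (hlin (fun m l => (v m).2 l) 1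
      fun m hm => (hdom m hm).2 S) hδ.le).trans ?_
    rwa [one_mul]
  have e3 : ellNorm (normExp r) (fun l : S => C * ∑ m ∈ Finset.range n, ‖a' m‖ * o m l) ≤
      η / 3 := by
    rw [ellNorm_const_mul, abs_of_nonneg hC0]
    refine (mul_le_mul_of_nonneg_left (hlin o κ fun m _ => ?_) hC0).trans hκs
    convert hF (v m).1 S
  have e4 : ellNorm (normExp r) (fun l : S => ∑ m ∈ Finset.range n, τ' m l) ≤ η / 3 := by
    refine (ellNorm_sum_le _ fun m (l : S) => τ' m l).trans ?_
    have : ∀ m ∈ Finset.range n, ellNorm (normExp r) (fun l : S => τ' m l) ≤ η / (3 * n) := by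
      intro m _
      refine (ellNorm_le_sum _).trans ?_
      rw [Finset.sum_coe_sort S fun l => |τ' m l|]
      have hle : ∑ l ∈ S, |τ' m l| ≤
          ∑ l ∈ Φ ((List.range m).map v), τ ((List.range m).map v) := by
        rw [Finset.sum_congr rfl fun l _ => abs_of_nonneg (hτ'0 m l)]
        simp only [hτ']
        rw [← Finset.sum_filter]
        exact Finset.sum_le_sum_of_subset_of_nonneg
          (fun l hl => (Finset.mem_filter.1 hl).2) fun _ _ _ => (hτ _).le
      refine hle.trans ?_
      rw [Finset.sum_const, _root_.nsmul_eq_mul]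
      simp only [hτdef]
      rw [mul_div_assoc', div_le_div_iff₀ (by positivity) (by positivity)]
      nlinarith [mul_pos hη hn0]
    refine (Finset.sum_le_sum this).trans ?_
    rw [Finset.sum_const, Finset.card_range, _root_.nsmul_eq_mul]
    apply le_of_eq
    field_simp
  linarith

end UpperSums

/-! ### Hölder's inequality, and ℓ_s-membership through finite subfamilies. -/

section Hoelder

variable {ι : Type*} [Fintype ι]

/-- Hölder's inequality. -/
theorem ellNorm_mul_le {γ s q : ℝ≥0∞} [hγ : Fact (1 ≤ γ)] [hs : Fact (1 ≤ s)] [hq : Fact (1 ≤ q)]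
    (hs' : s ≠ ∞) (h : γ⁻¹ + s⁻¹ = q⁻¹) (b u : ι → ℝ) :
    ellNorm q (fun i => b i * u i) ≤ ellNorm s b * ellNorm γ u := by
  rcases eq_or_ne γ ∞ with rfl | hγ'
  · obtain rfl : s = q := by simpa using h
    calc ellNorm s (fun i => b i * u i) ≤ ellNorm s fun i => ellNorm ∞ u * b i := by
          refine ellNorm_mono fun i => ?_
          rw [abs_mul, abs_mul, mul_comm, abs_of_nonneg (ellNorm_nonneg (q := ∞) u)]
          exact mul_le_mul_of_nonneg_right (abs_le_ellNorm u i) (abs_nonneg _)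
      _ = _ := by rw [ellNorm_const_mul, abs_of_nonneg (ellNorm_nonneg (q := ∞) u), mul_comm]
  · have hγ0 := toReal_pos_of_one_le hγ.out hγ'
    have hs0 := toReal_pos_of_one_le hs.out hs'
    have hsne : s⁻¹ ≠ ∞ := ENNReal.inv_ne_top.2 (zero_lt_one.trans_le hs.out).ne'
    have hγne : γ⁻¹ ≠ ∞ := ENNReal.inv_ne_top.2 (zero_lt_one.trans_le hγ.out).ne'
    have hq' : q ≠ ∞ := by
      rintro rfl
      rw [ENNReal.inv_top, add_eq_zero, ENNReal.inv_eq_zero, ENNReal.inv_eq_zero] at h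
      exact hs' h.2
    have hT : s.toReal.HolderTriple γ.toReal q.toReal := by
      refine ⟨?_, hs0, hγ0⟩
      rw [← ENNReal.toReal_inv, ← ENNReal.toReal_inv, ← ENNReal.toReal_inv,
        ← ENNReal.toReal_add hsne hγne, add_comm, h]
    have := NNReal.Lr_le_Lp_mul_Lq Finset.univ (fun i => ‖b i‖₊) (fun i => ‖u i‖₊) hT
    rw [ellNorm_eq hq.out hq', ellNorm_eq hs.out hs', ellNorm_eq hγ.out hγ']
    have := NNReal.coe_le_coe.2 this
    push_cast at this
    simpa only [Real.norm_eq_abs, abs_mul] using this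

theorem memℓp_iff_ellNorm {Λ : Type*} {s : ℝ≥0∞} [hs : Fact (1 ≤ s)] (f : Λ → ℝ) :
    Memℓp f s ↔ ∃ B, ∀ S : Finset Λ, ellNorm s (fun l : S => f l) ≤ B := by
  rcases eq_or_ne s ∞ with rfl | hs'
  · rw [memℓp_infty_iff]
    constructor
    · rintro ⟨B, hB⟩
      refine ⟨max B 0, fun S => ?_⟩
      rw [ellNorm_top]
      exact Real.iSup_le (fun l => (hB ⟨l, rfl⟩).trans (le_max_left _ _)) (le_max_right _ _)
    · rintro ⟨B, hB⟩
      refine ⟨B, ?_⟩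
      rintro _ ⟨l, rfl⟩
      exact (abs_le_ellNorm (q := ∞) (fun l' : ({l} : Finset Λ) => f l') ⟨l, by simp⟩).trans (hB {l})
  · have hs0 := toReal_pos_of_one_le hs.out hs'
    rw [memℓp_gen_iff hs0]
    have key : ∀ S : Finset Λ, ∑ l ∈ S, ‖f l‖ ^ s.toReal =
        ellNorm s (fun l : S => f l) ^ s.toReal := fun S => by
      rw [ellNorm_rpow hs', Finset.sum_coe_sort S fun l => |f l| ^ s.toReal]
      rfl
    constructor
    · intro h
      refine ⟨(∑' l, ‖f l‖ ^ s.toReal) ^ (1 / s.toReal), fun S => ?_⟩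
      rw [← Real.rpow_le_rpow_iff (ellNorm_nonneg _)
        (Real.rpow_nonneg (tsum_nonneg fun _ => by positivity) _) hs0, ← key,
        ← Real.rpow_mul (tsum_nonneg fun _ => by positivity), one_div_mul_cancel hs0.ne',
        Real.rpow_one]
      exact h.sum_le_tsum S fun _ _ => by positivity
    · rintro ⟨B, hB⟩
      refine summable_of_sum_le (c := B ^ s.toReal) (fun _ => by positivity) fun S => ?_
      rw [key]
      exact Real.rpow_le_rpow (ellNorm_nonneg _) (hB S) hs0.le

end Hoelder

/-! ### Upper estimates for exponents γ ≥ r. -/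

section UpperHoelder

variable {𝕜 : Type*} [RCLike 𝕜]

theorem derivList_subset_of_mem {X : Type u} [NormedAddCommGroup X] [NormedSpace 𝕜 X]
    {K : Set (StrongDual 𝕜 X)} {η : Ordinal.{u}} {ε e : ℝ} (hε : 0 < ε) (he : ε ≤ e) {l : List ℝ}
    (hl : e ∈ l) : derivList η l K ⊆ szlenkDerivatives ε K η := by
  induction l with
  | nil => simp at hl
  | cons e' l ih =>
    rw [derivList_cons]
    rcases List.mem_cons.1 hl with rfl | h
    · rw [derivZ_of_ne (hε.trans_le he).ne']
      exact szlenkDerivatives_mono hε.le he (derivList_subset l) η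
    · exact (derivZ_subset _).trans (ih h)

/-- A level above ε would place the iterated derivative inside an empty set. So all levels are at
most ε, and ∑ bᵢ εᵢ ≤ ε ‖b‖₁. -/
theorem estimate_one {X : Type u} [NormedAddCommGroup X] [NormedSpace 𝕜 X]
    {K : Set (StrongDual 𝕜 X)} {ξ : Ordinal.{u}} {ε : ℝ} (hε : 0 < ε)
    (h : szlenkDerivatives ε K (ω ^ ξ) = ∅) : Estimate K ξ 1 ε := by
  intro n e b he hb hne
  have h1 : ∀ i, e i ≤ ε := fun i => by
    by_contra hcon
    have := hne.mono (derivList_subset_of_mem hε (not_le.1 hcon).le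
      (List.mem_ofFn.2 ⟨i, rfl⟩))
    rw [h] at this
    exact Set.not_nonempty_empty this
  have h2 : ellNorm 1 b = ∑ i, b i := by
    rw [ellNorm_eq le_rfl ENNReal.one_ne_top]
    simp [abs_of_nonneg (hb _)]
  rw [h2, Finset.mul_sum]
  exact Finset.sum_le_sum fun i _ => by
    rw [mul_comm]
    exact mul_le_mul_of_nonneg_right (h1 i) (hb i)

variable {Λ : Type u} {X Y : Λ → Type u} [∀ l, NormedAddCommGroup (X l)]
  [∀ l, NormedSpace 𝕜 (X l)] [∀ l, NormedAddCommGroup (Y l)] [∀ l, NormedSpace 𝕜 (Y l)]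
  {p r : ℝ≥0∞} [hp : Fact (p = 0 ∨ 1 ≤ p)] [hr : Fact (r = 0 ∨ 1 ≤ r)]

theorem diagOp_univ_eq_add (h : Admissible p r) (A : ∀ l, X l →L[𝕜] Y l)
    (hA : ∃ C : ℝ, ∀ l, ‖A l‖ ≤ C) (S : Set Λ) :
    diagOp h A hA Set.univ = diagOp h A hA S + diagOp h A hA Sᶜ := by
  ext x l
  change (diagOp h A hA Set.univ x).1 l = (diagOp h A hA S x).1 l + (diagOp h A hA Sᶜ x).1 l
  rw [diagOp_apply, diagOp_apply, diagOp_apply]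
  by_cases hl : l ∈ S <;> simp [hl]

set_option maxHeartbeats 1000000 in
-- The tail off a large finite set `S` has an ℓ₁-estimate with a constant so small that for the
-- given coefficients its contribution is negligible. Only finitely many coordinates remain; they
-- are controlled from the start, and Hölder's inequality with 1/γ + 1/s = 1/r bounds them by ‖β‖_s
-- ‖a‖_γ. The bound is `B` itself, with no contribution from the norms of the `A l`, so that `B = 0`
-- is informative.
theorem opAlpha_diagOp_le_of_hoelder (h : Admissible p r) (A : ∀ l, X l →L[𝕜] Y l)
    (hA : ∃ C : ℝ, ∀ l, ‖A l‖ ≤ C) {ξ : Ordinal.{u}} {γ s : ℝ≥0∞} (hγ : 1 ≤ γ) (hs : 1 ≤ s)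
    (hs' : s ≠ ∞) (hrγ : normExp r ≤ γ) (hγs : γ⁻¹ + s⁻¹ = (normExp r)⁻¹) {β : Λ → ℝ} {B : ℝ}
    (hβ : ∀ l, 0 ≤ β l) (hest : ∀ l, Estimate (adjointBall (A l)) ξ γ (β l))
    (hB : ∀ S : Finset Λ, ellNorm s (fun l : S => β l) ≤ B)
    (hsmall : ∀ ε : ℝ, 0 < ε → ∃ S : Finset Λ,
      szlenkDerivatives ε (adjointBall (diagOp h A hA (S : Set Λ)ᶜ)) (ω ^ ξ) = ∅) :
    opAlpha (diagOp h A hA Set.univ) ξ γ ≤ ENNReal.ofReal B := by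
  classical
  have : Fact (1 ≤ γ) := ⟨hγ⟩
  have : Fact (1 ≤ s) := ⟨hs⟩
  have hB0 : 0 ≤ B := (ellNorm_nonneg _).trans (hB ∅)
  obtain ⟨C, hC⟩ := hA
  have hA : ∃ C : ℝ, ∀ l, ‖A l‖ ≤ C := ⟨C, hC⟩
  refine opAlpha_le hγ _ hB0 fun n D _ _ _ a x hn hb hw η hη => ?_
  set a' : ℕ → 𝕜 := fun m => if hm : m < n then a ⟨m, hm⟩ else 0 with ha'
  have ha : ∀ i : Fin n, a' i = a i := fun i => by simp [ha']
  set σ : ℝ := ∑ m ∈ Finset.range n, ‖a' m‖ with hσ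
  have hσ0 : 0 ≤ σ := Finset.sum_nonneg fun _ _ => norm_nonneg _
  have hn0 : (0 : ℝ) < n := by exact_mod_cast Nat.pos_of_ne_zero hn
  obtain ⟨S, hS⟩ := hsmall (η / (4 * (σ + 1))) (by positivity)
  set δ : ℝ := η / (4 * (σ + 1) * (S.card + 1)) with hδdef
  have hδ : 0 < δ := by positivity
  set τ : ℝ := η / (4 * n * (S.card + 1)) with hτdef
  have hτ : 0 < τ := by positivity
  obtain ⟨J, hJ⟩ := exists_grid hδ (2 * max C ‖diagOp h A hA (S : Set Λ)ᶜ‖)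
  -- The index `none` stands for the tail operator, measured by the full norm; `some l` stands for a
  -- coordinate.
  set N : Option Λ → directSum 𝕜 X p → ℝ := fun i x => i.elim ‖x‖ fun l => ‖x.1 l‖ with hN
  set K : Option Λ → Set (StrongDual 𝕜 (directSum 𝕜 X p)) := fun i =>
    i.elim (adjointBall (diagOp h A hA (S : Set Λ)ᶜ))
      fun l => adjointBall ((A l).comp (coord 𝕜 X p l)) with hK
  obtain ⟨t, ht, v, hv, hdom, hdrop⟩ := exists_adapted_branch (𝕜 := 𝕜) (N := N) (ι := Option Λ)
    (fun i x => by
      cases i with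
      | none => exact ⟨norm_nonneg _, le_rfl⟩
      | some l => exact ⟨norm_nonneg _, norm_coord_le x l⟩) hδ J a' ξ hn (K := K)
    (fun i => by
      cases i with
      | none =>
        exact controlled_adjointBall _
          ((mul_le_mul_of_nonneg_left (le_max_right _ _) zero_le_two).trans hJ)
      | some l =>
        exact controlled_comp_coord (A l)
          ((mul_le_mul_of_nonneg_left ((hC l).trans (le_max_left _ _)) zero_le_two).trans hJ))
    -- Domination is needed in ℓ_γ, which is available since p ≤ r ≤ γ: Hölder's inequality leaves
    -- an ℓ_γ-norm over the coordinates.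
    (fun c v => (0 ≤ v.2 none ∧ v.2 none ≤ c) ∧ Dominated 𝕜 γ c (v.1, fun l => v.2 (some l)))
    ⟨⟨le_rfl, le_rfl⟩, Dominated.zero _⟩
    (fun c c' v v' _ _ h1 h2 =>
      ⟨⟨add_nonneg h1.1.1 h2.1.1, add_le_add h1.1.2 h2.1.2⟩, h1.2.add h2.2⟩)
    (fun c x hc hx => ⟨⟨mul_nonneg hc (norm_nonneg _), mul_le_of_le_one_right hc hx⟩,
      Dominated.of_norm_le (h.normExp_le.trans hrγ) hc hx⟩)
    (fun _ => Finset.insertNone S) (fun _ => τ) (fun _ => hτ) x hb hw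
  refine ⟨t, ht, ?_⟩
  have hsum : ∑ i : Fin n, a i • blockSum (𝕜 := 𝕜) ξ n (i + 1) x t =
      ∑ m ∈ Finset.range n, a' m • (v m).1 := by
    rw [← Fin.sum_univ_eq_sum_range (fun m => a' m • (v m).1) n]
    exact Finset.sum_congr rfl fun i _ => by rw [ha, hv i i.2]
  have hell : ellNorm γ (fun i : Fin n => ‖a i‖) = ellNorm γ fun i : Fin n => ‖a' i‖ := by
    simp only [ha]
  rw [hsum, hell]
  clear_value a'
  set T := ∑ m ∈ Finset.range n, a' m • (v m).1 with hT
  have hw0 : ∀ l, ∀ m < n, 0 ≤ (v m).2 (some l) := fun l m hm =>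
    (norm_nonneg _).trans ((hdom m hm).2.1 l)
  have hwone : ∀ l, ∀ m < n, (v m).2 (some l) ≤ 1 := fun l m hm =>
    (le_abs_self _).trans ((abs_le_ellNorm (q := γ)
      (fun l' : ({l} : Finset Λ) => (v m).2 (some l')) ⟨l, by simp⟩).trans ((hdom m hm).2.2 {l}))
  have hsumle : ∀ w : ℕ → ℝ, (∀ m < n, w m ≤ 1) → ∑ m ∈ Finset.range n, ‖a' m‖ * w m ≤ σ :=
    fun w hw => Finset.sum_le_sum fun m hm =>
      mul_le_of_le_one_right (norm_nonneg _) (hw m (Finset.mem_range.1 hm))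
  have hnτ : ∑ m ∈ Finset.Ico 0 n, τ = n * τ := by simp
  have hδσ : (S.card + 1) * (δ * σ) ≤ η / 4 := by
    have : (S.card + 1) * (δ * σ) = η / 4 * (σ / (σ + 1)) := by
      rw [hδdef]; field_simp
    rw [this]
    exact mul_le_of_le_one_right (by positivity) ((div_le_one (by positivity)).2 (by linarith))
  have hτn : (S.card + 1) * (n * τ) = η / 4 := by
    rw [hτdef]; field_simp
  have hnone : ‖diagOp h A hA (S : Set Λ)ᶜ T‖ ≤ η / 4 + δ * σ + n * τ := by
    have h1 := norm_le_of_drops le_rfl (diagOp h A hA (S : Set Λ)ᶜ) (β := η / (4 * (σ + 1)))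
      (by positivity) hδ.le (estimate_one (by positivity) hS) (Nat.zero_le n) a'
      (fun m => (v m).1) (fun m => (v m).2 none) (fun _ => τ) (fun m hm => (hdom m hm).1.1)
      (hdrop none 0 (Nat.zero_le n) fun m _ _ => by simp)
    rw [hnτ] at h1
    have h2 : ellNorm 1 (fun m : Fin n => ‖a' m‖ * (v m).2 none) ≤ σ := by
      refine (ellNorm_le_sum _).trans ?_
      rw [Fin.sum_univ_eq_sum_range (fun m => |‖a' m‖ * (v m).2 none|) n]
      refine Finset.sum_le_sum fun m hm => ?_
      have := (hdom m (Finset.mem_range.1 hm)).1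
      rw [abs_of_nonneg (mul_nonneg (norm_nonneg _) this.1)]
      exact mul_le_of_le_one_right (norm_nonneg _) this.2
    have h3 := hsumle (fun m => (v m).2 none) fun m hm => (hdom m hm).1.2
    have h4 : η / (4 * (σ + 1)) * ellNorm 1 (fun m : Fin n => ‖a' m‖ * (v m).2 none) ≤ η / 4 := by
      refine (mul_le_mul_of_nonneg_left h2 (by positivity)).trans ?_
      rw [div_mul_eq_mul_div, div_le_div_iff₀ (by positivity) (by positivity)]
      nlinarith
    have h5 := mul_le_mul_of_nonneg_left h3 hδ.le
    simp only [Finset.range_zero, Finset.sum_empty, map_zero, norm_zero, zero_add] at h1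
    linarith
  have hpoint : ∀ l ∈ S, ‖A l (T.1 l)‖ ≤
      β l * ellNorm γ (fun m : Fin n => ‖a' m‖ * (v m).2 (some l)) + (δ * σ + n * τ) := by
    intro l hl
    have h1 := norm_le_of_drops hγ ((A l).comp (coord 𝕜 X p l)) (hβ l) hδ.le (hest l).comp_coord
      (Nat.zero_le n) a' (fun m => (v m).1) (fun m => (v m).2 (some l)) (fun _ => τ) (hw0 l)
      (hdrop (some l) 0 (Nat.zero_le n) fun m _ _ => by simpa using hl)
    rw [hnτ] at h1
    simp only [Finset.range_zero, Finset.sum_empty, map_zero, norm_zero, zero_add] at h1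
    have h3 := mul_le_mul_of_nonneg_left (hsumle (fun m => (v m).2 (some l)) (hwone l)) hδ.le
    have h6 : ‖A l (T.1 l)‖ = ‖(A l).comp (coord 𝕜 X p l) T‖ := rfl
    rw [h6]
    linarith
  have hsome : ‖diagOp h A hA (S : Set Λ) T‖ ≤
      B * ellNorm γ (fun m : Fin n => ‖a' m‖) + S.card * (δ * σ + n * τ) := by
    refine norm_le_of_ellNorm_le _ (add_nonneg (mul_nonneg hB0 (ellNorm_nonneg _))
      (by positivity)) fun S' => ?_
    have h1 : ∀ l : S', ‖(diagOp h A hA (S : Set Λ) T).1 l‖ ≤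
        β l * ellNorm γ (fun m : Fin n => ‖a' m‖ * (v m).2 (some l)) +
          if (l : Λ) ∈ S then δ * σ + n * τ else 0 := by
      intro l
      rw [diagOp_apply]
      by_cases hl : (l : Λ) ∈ S
      · simpa [hl] using hpoint l hl
      · simpa [hl] using mul_nonneg (hβ l) (ellNorm_nonneg (q := γ) _)
    refine (ellNorm_mono' (ι := S') (fun l => norm_nonneg _) h1).trans ?_
    refine (ellNorm_add_le _ _).trans (add_le_add ?_ ?_)
    · refine (ellNorm_mul_le hs' hγs _ _).trans ?_
      refine mul_le_mul (hB S') ?_ (ellNorm_nonneg _) hB0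
      exact ellNorm_ellNorm_le le_rfl (fun m : Fin n => ‖a' m‖)
        (fun m (l : S') => (v m).2 (some l)) fun m => (hdom m m.2).2.2 S'
    · refine (ellNorm_le_sum _).trans ?_
      rw [Finset.sum_coe_sort S' fun l => |if l ∈ S then δ * σ + n * τ else 0|]
      have h0 : 0 ≤ δ * σ + n * τ := by positivity
      have h2 : ∀ l ∈ S', |if l ∈ S then δ * σ + n * τ else 0| =
          if l ∈ S then δ * σ + n * τ else 0 := fun l _ => abs_of_nonneg (by
        split_ifs; exacts [h0, le_rfl])
      rw [Finset.sum_congr rfl h2, ← Finset.sum_filter]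
      refine (Finset.sum_le_sum_of_subset_of_nonneg
        (fun l hl => (Finset.mem_filter.1 hl).2) fun _ _ _ => h0).trans ?_
      rw [Finset.sum_const, _root_.nsmul_eq_mul]
  rw [diagOp_univ_eq_add h A hA (S : Set Λ), _root_.add_apply]
  refine (norm_add_le _ _).trans ((add_le_add hsome hnone).trans ?_)
  -- The errors are at most η/4 from the tail estimate, η/4 from δ and η/4 from τ, each of the last
  -- two occurring `S.card + 1` times.
  nlinarith

end UpperHoelder

/-! ### Finiteness of α and smallness of θ for a single operator. -/

section SingleOperator

variable {𝕜 : Type*} [RCLike 𝕜] {X : Type u} [NormedAddCommGroup X] [NormedSpace 𝕜 X]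
  {Y : Type u} [NormedAddCommGroup Y] [NormedSpace 𝕜 Y] {ξ : Ordinal.{u}} {γ : ℝ≥0∞}

theorem exists_branch_norm_le (hγ : 1 ≤ γ) (A : X →L[𝕜] Y) {β : ℝ} (hβ : 0 ≤ β)
    (hest : Estimate (adjointBall A) ξ γ β) {n : ℕ} (hn : n ≠ 0) {D : Type u} [Preorder D]
    [IsDirectedOrder D] [Nonempty D] (a : Fin n → 𝕜) (x : List (Ordinal.{u} × D) → X)
    (hb : InBall (gamma ξ n) D x) (hw : WeaklyNull 𝕜 (gamma ξ n) D x) {η : ℝ} (hη : 0 < η) :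
    ∃ t ∈ maxs (withIndex (gamma ξ n) D),
      ‖A (∑ i : Fin n, a i • blockSum (𝕜 := 𝕜) ξ n (i + 1) x t)‖ ≤
        β * ellNorm γ (fun i => ‖a i‖) + η := by
  have : Fact (1 ≤ γ) := ⟨hγ⟩
  set a' : ℕ → 𝕜 := fun m => if hm : m < n then a ⟨m, hm⟩ else 0 with ha'
  have ha : ∀ i : Fin n, a' i = a i := fun i => by simp [ha']
  set σ : ℝ := ∑ m ∈ Finset.range n, ‖a' m‖ with hσ
  have hσ0 : 0 ≤ σ := Finset.sum_nonneg fun _ _ => norm_nonneg _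
  have hn0 : (0 : ℝ) < n := by exact_mod_cast Nat.pos_of_ne_zero hn
  have hδ : 0 < η / (2 * (σ + 1)) := by positivity
  obtain ⟨J, hJ⟩ := exists_grid hδ (2 * ‖A‖)
  obtain ⟨t, ht, v, hv, hdom, hdrop⟩ := exists_adapted_branch (𝕜 := 𝕜) (ι := PUnit.{u + 1})
    (N := fun _ (x : X) => ‖x‖) (fun _ x => ⟨norm_nonneg _, le_rfl⟩) hδ J a' ξ hn
    (K := fun _ => adjointBall A) (fun _ => controlled_adjointBall A hJ)
    (fun c v => 0 ≤ v.2 PUnit.unit ∧ v.2 PUnit.unit ≤ c) ⟨le_rfl, le_rfl⟩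
    (fun c c' v v' _ _ h1 h2 => ⟨add_nonneg h1.1 h2.1, add_le_add h1.2 h2.2⟩)
    (fun c x hc hx => ⟨mul_nonneg hc (norm_nonneg _), mul_le_of_le_one_right hc hx⟩)
    (fun _ => Finset.univ) (fun _ => η / (2 * n)) (fun _ => by positivity) x hb hw
  refine ⟨t, ht, ?_⟩
  have hsum : ∑ i : Fin n, a i • blockSum (𝕜 := 𝕜) ξ n (i + 1) x t =
      ∑ m ∈ Finset.range n, a' m • (v m).1 := by
    rw [← Fin.sum_univ_eq_sum_range (fun m => a' m • (v m).1) n]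
    exact Finset.sum_congr rfl fun i _ => by rw [ha, hv i i.2]
  have hell : ellNorm γ (fun i : Fin n => ‖a i‖) = ellNorm γ fun i : Fin n => ‖a' i‖ := by
    simp only [ha]
  rw [hsum, hell]
  have h1 := norm_le_of_drops hγ A hβ hδ.le hest (Nat.zero_le n) a'
    (fun m => (v m).1) (fun m => (v m).2 PUnit.unit) (fun _ => η / (2 * n))
    (fun m hm => (hdom m hm).1) (hdrop PUnit.unit 0 (Nat.zero_le n) fun m _ _ => Finset.mem_univ _)
  have h2 : ellNorm γ (fun m : Fin n => ‖a' m‖ * (v m).2 PUnit.unit) ≤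
      ellNorm γ fun m : Fin n => ‖a' m‖ :=
    ellNorm_mono' (fun m => mul_nonneg (norm_nonneg _) (hdom m m.2).1)
      fun m => mul_le_of_le_one_right (norm_nonneg _) (hdom m m.2).2
  have h3 : ∑ m ∈ Finset.range n, ‖a' m‖ * (v m).2 PUnit.unit ≤ σ :=
    Finset.sum_le_sum fun m hm =>
      mul_le_of_le_one_right (norm_nonneg _) (hdom m (Finset.mem_range.1 hm)).2
  have h4 : η / (2 * (σ + 1)) * σ ≤ η / 2 := by
    rw [show η / (2 * (σ + 1)) * σ = η / 2 * (σ / (σ + 1)) by field_simp]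
    exact mul_le_of_le_one_right (by positivity) ((div_le_one (by positivity)).2 (by linarith))
  have h5 : ∑ m ∈ Finset.Ico 0 n, η / (2 * n) = η / 2 := by
    rw [Finset.sum_const, Nat.card_Ico, Nat.sub_zero, _root_.nsmul_eq_mul]
    field_simp
  have h6 := mul_le_mul_of_nonneg_left h2 hβ
  have h7 := mul_le_mul_of_nonneg_left h3 hδ.le
  simp only [Finset.range_zero, Finset.sum_empty, map_zero, norm_zero, zero_add] at h1
  linarith

theorem opAlpha_le_of_estimate (hγ : 1 ≤ γ) (A : X →L[𝕜] Y) {β : ℝ} (hβ : 0 ≤ β)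
    (hest : Estimate (adjointBall A) ξ γ β) : opAlpha A ξ γ ≤ ENNReal.ofReal β :=
  opAlpha_le hγ A hβ fun _ _ _ _ _ a x hn hb hw _ hη =>
    exists_branch_norm_le hγ A hβ hest hn a x hb hw hη

theorem opTheta_le_of_szlenkDerivatives_eq_empty (A : X →L[𝕜] Y) {ε : ℝ} (hε : 0 < ε)
    (h : szlenkDerivatives ε (adjointBall A) (ω ^ ξ) = ∅) :
    opTheta A ξ 1 ≤ ENNReal.ofReal (2 * ε) := by
  refine opTheta_le A (by positivity) fun D _ _ _ x hb hw => ?_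
  obtain ⟨t, ht, hle⟩ := exists_branch_norm_le le_rfl A hε.le (estimate_one hε h) one_ne_zero
    (fun _ => (1 : 𝕜)) x hb hw hε
  refine ⟨t, ht, ?_⟩
  have h1 : ellNorm 1 (fun _ : Fin 1 => ‖(1 : 𝕜)‖) ≤ 1 := (ellNorm_le_sum _).trans (by simp)
  have h2 := mul_le_mul_of_nonneg_left h1 hε.le
  simp only [Finset.univ_unique, Fin.default_eq_zero, Finset.sum_singleton, one_smul] at hle
  exact hle.trans (by linarith)

/-- The adjoint ball is absolutely convex, so for `f` in the derivative the map g ↦ (g - f)/2 sends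
it into itself. It takes `f` to zero and halves distances. -/
theorem zero_mem_szlenkDerivatives (A : X →L[𝕜] Y) {ε : ℝ} (hε : 0 < ε) {η : Ordinal.{u}}
    (h : (szlenkDerivatives ε (adjointBall A) η).Nonempty) :
    0 ∈ szlenkDerivatives (ε / 2) (adjointBall A) η := by
  obtain ⟨f, hf⟩ := h
  have h2 : ‖(2⁻¹ : 𝕜)‖ = 1 / 2 := by simp
  have hφ : Continuous fun g : WeakDual 𝕜 X => StrongDual.toWeakDual
      ((2⁻¹ : 𝕜) • StrongDual.toWeakDual.symm g + (-2⁻¹ : 𝕜) • f) :=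
    WeakDual.continuous_of_continuous_eval fun x =>
      ((WeakDual.eval_continuous x).const_smul (2⁻¹ : 𝕜)).add continuous_const
  have := image_szlenkDerivatives (φ := fun g => (2⁻¹ : 𝕜) • g + (-2⁻¹ : 𝕜) • f) hφ
    (c := 1 / 2) (ε := ε) (ε' := ε / 2) (by norm_num) (by positivity) (by linarith)
    (L := adjointBall A) (K := adjointBall A)
    (fun g _ g' _ => by
      rw [add_sub_add_right_eq_sub]
      refine (h2 ▸ norm_smul (2⁻¹ : 𝕜) (g - g')).ge.trans (le_of_eq (congrArg _ ?_))
      exact smul_sub _ _ _)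
    (fun g hg => convex_adjointBall A hg (szlenkDerivatives_subset _ _ _ hf)
      (by rw [norm_neg, h2]; norm_num)) η hf
  have h0 : (2⁻¹ : 𝕜) • f + (-2⁻¹ : 𝕜) • f = 0 := by
    ext x
    simp
  rwa [← h0]

end SingleOperator

theorem exists_of_mem_adjointBall {𝕜 : Type*} [RCLike 𝕜] {X : Type u} [NormedAddCommGroup X]
    [NormedSpace 𝕜 X] {Y : Type u} [NormedAddCommGroup Y] [NormedSpace 𝕜 Y] {A : X →L[𝕜] Y}
    {f : StrongDual 𝕜 X} (hf : f ∈ adjointBall A) : ∃ g : StrongDual 𝕜 Y, ‖g‖ ≤ 1 ∧ f = g.comp A := by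
  obtain ⟨g, hg, rfl⟩ := hf
  exact ⟨g, by simpa using hg, rfl⟩

/-! ### Derivatives under affine embeddings. -/

section Affine

variable {𝕜 : Type*} [RCLike 𝕜] {X : Type u} [NormedAddCommGroup X] [NormedSpace 𝕜 X]
  {Z : Type u} [NormedAddCommGroup Z] [NormedSpace 𝕜 Z]

/-- The map g ↦ b g∘T + f₀ is weak-star continuous and multiplies distances by exactly `b`. -/
theorem mapsTo_szlenkDerivatives_affine (T : Z →L[𝕜] X)
    (hT : ∀ g : StrongDual 𝕜 X, ‖g.comp T‖ = ‖g‖) (f₀ : StrongDual 𝕜 Z) {b ε : ℝ} (hb : 0 < b)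
    (hε : 0 ≤ ε) {L : Set (StrongDual 𝕜 X)} {K : Set (StrongDual 𝕜 Z)}
    (h : ∀ g ∈ L, (b : 𝕜) • g.comp T + f₀ ∈ K) (η : Ordinal.{u}) :
    Set.MapsTo (fun g => (b : 𝕜) • g.comp T + f₀) (szlenkDerivatives ε L η)
      (szlenkDerivatives (b * ε) K η) := by
  refine image_szlenkDerivatives (c := b) ?_ hb (by positivity) le_rfl (fun g _ g' _ => ?_) h η
  · exact WeakDual.continuous_of_continuous_eval fun x =>
      ((WeakDual.eval_continuous (T x)).const_smul (b : 𝕜)).add continuous_const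
  · have : (b : 𝕜) • g.comp T + f₀ - ((b : 𝕜) • g'.comp T + f₀) = (b : 𝕜) • (g - g').comp T := by
      ext x
      simp [_root_.mul_sub]
    rw [this, norm_smul, hT, RCLike.norm_ofReal, abs_of_pos hb]

theorem mapsTo_derivList_affine (T : Z →L[𝕜] X)
    (hT : ∀ g : StrongDual 𝕜 X, ‖g.comp T‖ = ‖g‖) (f₀ : StrongDual 𝕜 Z) {b : ℝ} (hb : 0 < b)
    {L : Set (StrongDual 𝕜 X)} {K : Set (StrongDual 𝕜 Z)}
    (h : ∀ g ∈ L, (b : 𝕜) • g.comp T + f₀ ∈ K) (η : Ordinal.{u}) (l : List ℝ)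
    (hl : ∀ ε ∈ l, 0 ≤ ε) :
    Set.MapsTo (fun g => (b : 𝕜) • g.comp T + f₀) (derivList η l L)
      (derivList η (l.map (b * ·)) K) := by
  induction l with
  | nil => exact h
  | cons ε l ih =>
    rw [List.forall_mem_cons] at hl
    rw [derivList_cons, List.map_cons, derivList_cons]
    rcases eq_or_ne ε 0 with rfl | h0
    · simpa only [mul_zero, derivZ_zero] using ih hl.2
    · rw [derivZ_of_ne h0, derivZ_of_ne (mul_ne_zero hb.ne' h0)]
      exact mapsTo_szlenkDerivatives_affine T hT f₀ hb hl.1 (fun g hg => ih hl.2 hg) η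

/-- A copy of `L`, scaled by `b` and centred at `f₀`, lies in `K`, and `f₀` occupies the place of
zero in it. -/
theorem mem_szlenkDerivatives_of_zero_mem (f₀ : StrongDual 𝕜 X) {b ε : ℝ} (hb : 0 < b)
    (hε : 0 ≤ ε) {L K : Set (StrongDual 𝕜 X)} (h : ∀ g ∈ L, (b : 𝕜) • g + f₀ ∈ K)
    {η : Ordinal.{u}} (h0 : 0 ∈ szlenkDerivatives ε L η) : f₀ ∈ szlenkDerivatives (b * ε) K η := by
  have := mapsTo_szlenkDerivatives_affine (ContinuousLinearMap.id 𝕜 X)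
    (fun g => by rw [ContinuousLinearMap.comp_id]) f₀ hb hε (L := L) (K := K)
    (fun g hg => by rw [ContinuousLinearMap.comp_id]; exact h g hg) η h0
  have h1 : (b : 𝕜) • (0 : StrongDual 𝕜 X).comp (ContinuousLinearMap.id 𝕜 X) + f₀ = f₀ := by
    ext x
    simp
  rwa [← h1]

end Affine

/-! ### Lower estimates for diagonal operators -/

section LowerSums

variable {𝕜 : Type*} [RCLike 𝕜] {Λ : Type u} {X Y : Λ → Type u} [∀ l, NormedAddCommGroup (X l)]
  [∀ l, NormedSpace 𝕜 (X l)] [∀ l, NormedAddCommGroup (Y l)] [∀ l, NormedSpace 𝕜 (Y l)]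
  {p r : ℝ≥0∞} [hp : Fact (p = 0 ∨ 1 ≤ p)] [hr : Fact (r = 0 ∨ 1 ≤ r)]

variable (𝕜 Y) in
/-- The projection of a direct sum onto the coordinates in `S`. -/
noncomputable def proj (hrr : Admissible r r) (S : Set Λ) :
    directSum 𝕜 Y r →L[𝕜] directSum 𝕜 Y r :=
  diagOp hrr (fun l => ContinuousLinearMap.id 𝕜 (Y l))
    ⟨1, fun _ => ContinuousLinearMap.norm_id_le⟩ S

theorem proj_apply (hrr : Admissible r r) (S : Set Λ) (y : directSum 𝕜 Y r) (l : Λ) :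
    (proj 𝕜 Y hrr S y).1 l = S.indicator (fun _ => (1 : 𝕜)) l • y.1 l := rfl

theorem proj_add_proj_compl (hrr : Admissible r r) (S : Set Λ) (y : directSum 𝕜 Y r) :
    proj 𝕜 Y hrr S y + proj 𝕜 Y hrr Sᶜ y = y := by
  apply Subtype.ext
  ext l
  change (proj 𝕜 Y hrr S y).1 l + (proj 𝕜 Y hrr Sᶜ y).1 l = y.1 l
  rw [proj_apply, proj_apply]
  by_cases hl : l ∈ S <;> simp [hl]

theorem diagOp_eq_proj_comp (hrr : Admissible r r) (h : Admissible p r) (A : ∀ l, X l →L[𝕜] Y l)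
    (hA : ∃ C : ℝ, ∀ l, ‖A l‖ ≤ C) (S : Set Λ) (x : directSum 𝕜 X p) :
    diagOp h A hA S x = proj 𝕜 Y hrr S (diagOp h A hA Set.univ x) := by
  apply Subtype.ext
  ext l
  rw [proj_apply, diagOp_univ_apply, diagOp_apply]

theorem norm_rpow_proj (hrr : Admissible r r) (hr' : normExp r ≠ ∞) (S : Set Λ)
    (y : directSum 𝕜 Y r) :
    ‖proj 𝕜 Y hrr S y‖ ^ (normExp r).toReal + ‖proj 𝕜 Y hrr Sᶜ y‖ ^ (normExp r).toReal =
      ‖y‖ ^ (normExp r).toReal := by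
  have h0 := toReal_pos_of_one_le (normExp_fact r).out hr'
  refine ((lp.hasSum_norm h0 (proj 𝕜 Y hrr S y).1).add
    (lp.hasSum_norm h0 (proj 𝕜 Y hrr Sᶜ y).1)).unique ?_
  refine (congrArg (HasSum · _) (funext fun l => ?_)).mpr (lp.hasSum_norm h0 y.1)
  rw [proj_apply, proj_apply]
  by_cases hl : l ∈ S <;> simp [hl, Real.zero_rpow h0.ne']

theorem tendsto_proj (hrr : Admissible r r) (y : directSum 𝕜 Y r) :
    Tendsto (fun S : Finset Λ => proj 𝕜 Y hrr (S : Set Λ) y) atTop (𝓝 y) := by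
  rw [Metric.tendsto_nhds]
  intro ε hε
  obtain ⟨F, hF⟩ := exists_finset_ellNorm_le hrr.lt_top le_rfl y (half_pos hε)
  filter_upwards [eventually_ge_atTop F] with S hS
  have h1 : proj 𝕜 Y hrr (S : Set Λ) y - y = -proj 𝕜 Y hrr (S : Set Λ)ᶜ y := by
    rw [sub_eq_iff_eq_add, ← sub_eq_neg_add, eq_sub_iff_add_eq, proj_add_proj_compl]
  rw [dist_eq_norm, h1, norm_neg]
  refine lt_of_le_of_lt (norm_le_of_ellNorm_le _ (half_pos hε).le fun S' => ?_) (half_lt_self hε)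
  refine (ellNorm_mono' (ι := S') (fun l => norm_nonneg _) fun l => ?_).trans (hF S')
  rw [proj_apply]
  by_cases hl : (l : Λ) ∈ S
  · simp only [Set.indicator_of_notMem (show (l : Λ) ∉ (S : Set Λ)ᶜ by simpa using hl), zero_smul,
      norm_zero]
    split_ifs
    exacts [le_rfl, norm_nonneg _]
  · have : (l : Λ) ∉ F := fun h => hl (hS h)
    simp [hl, this]

/-- The r-th powers of the norms of the two parts of y add up to ‖y‖^r, so two functionals living on
complementary sets of coordinates combine by the conjugate exponent ρ; this is Hölder's inequality
for two terms. -/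
theorem norm_smul_proj_add_le (hrr : Admissible r r) (hr' : normExp r ≠ ∞) {ρ : ℝ}
    (hρ : (normExp r).toReal.HolderConjugate ρ) (S : Set Λ) {f g : StrongDual 𝕜 (directSum 𝕜 Y r)}
    (hf : ‖f‖ ≤ 1) (hg : ‖g‖ ≤ 1) {a b t : ℝ} (ha : 0 ≤ a) (hb : 0 ≤ b) (ht : 0 ≤ t)
    (hab : a ^ ρ + b ^ ρ ≤ t ^ ρ) :
    ‖(a : 𝕜) • f.comp (proj 𝕜 Y hrr S) + (b : 𝕜) • g.comp (proj 𝕜 Y hrr Sᶜ)‖ ≤ t := by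
  refine ContinuousLinearMap.opNorm_le_bound _ ht fun y => ?_
  have h0 := hρ.pos
  have h1 : ‖f (proj 𝕜 Y hrr S y)‖ ≤ ‖proj 𝕜 Y hrr S y‖ := by
    simpa using f.le_of_opNorm_le hf (proj 𝕜 Y hrr S y)
  have h2 : ‖g (proj 𝕜 Y hrr Sᶜ y)‖ ≤ ‖proj 𝕜 Y hrr Sᶜ y‖ := by
    simpa using g.le_of_opNorm_le hg (proj 𝕜 Y hrr Sᶜ y)
  have h3 := Real.inner_le_Lp_mul_Lq_of_nonneg (Finset.univ : Finset (Fin 2)) hρ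
    (f := ![‖proj 𝕜 Y hrr S y‖, ‖proj 𝕜 Y hrr Sᶜ y‖]) (g := ![a, b])
    (fun i _ => by fin_cases i <;> simp) (fun i _ => by fin_cases i <;> simp [ha, hb])
  simp only [Fin.sum_univ_two, Matrix.cons_val_zero, Matrix.cons_val_one] at h3
  rw [norm_rpow_proj hrr hr', ← Real.rpow_mul (norm_nonneg _), mul_one_div_cancel h0.ne',
    Real.rpow_one] at h3
  have h4 : (a ^ ρ + b ^ ρ) ^ (1 / ρ) ≤ t := by
    have hρ0 := hρ.symm.pos
    refine (Real.rpow_le_rpow (by positivity) hab (by positivity)).trans ?_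
    rw [← Real.rpow_mul ht, mul_one_div_cancel hρ0.ne', Real.rpow_one]
  calc ‖(a : 𝕜) • f (proj 𝕜 Y hrr S y) + (b : 𝕜) • g (proj 𝕜 Y hrr Sᶜ y)‖
      ≤ ‖proj 𝕜 Y hrr S y‖ * a + ‖proj 𝕜 Y hrr Sᶜ y‖ * b := by
        refine (norm_add_le _ _).trans ?_
        rw [norm_smul, norm_smul, RCLike.norm_ofReal, RCLike.norm_ofReal, abs_of_nonneg ha,
          abs_of_nonneg hb, mul_comm a, mul_comm b]
        gcongr
    _ ≤ ‖y‖ * t := h3.trans (mul_le_mul_of_nonneg_left h4 (norm_nonneg _))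
    _ = t * ‖y‖ := mul_comm _ _

theorem comp_mem_adjointBall_smul {X : Type u} [NormedAddCommGroup X] [NormedSpace 𝕜 X]
    {Y : Type u} [NormedAddCommGroup Y] [NormedSpace 𝕜 Y] (A : X →L[𝕜] Y) {k : StrongDual 𝕜 Y}
    {t : ℝ} (hk : ‖k‖ ≤ t) : k.comp A ∈ adjointBall ((t : 𝕜) • A) := by
  rcases eq_or_ne t 0 with rfl | ht
  · rw [norm_le_zero_iff] at hk
    exact ⟨0, by simp, by ext; simp [hk]⟩
  · have ht0 : 0 ≤ t := (norm_nonneg k).trans hk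
    refine ⟨((t⁻¹ : ℝ) : 𝕜) • k, ?_, ?_⟩
    · rw [mem_closedBall_zero_iff, norm_smul, RCLike.norm_ofReal, abs_of_nonneg (by positivity)]
      rw [inv_mul_le_iff₀ (ht0.lt_of_ne' ht), mul_one]
      exact hk
    · ext x
      have : (t : 𝕜) ≠ 0 := by exact_mod_cast ht
      simp only [ContinuousLinearMap.comp_apply, _root_.smul_apply, map_smul, RCLike.ofReal_inv,
        _root_.smul_eq_mul]
      field_simp

/-- If all tails of a diagonal operator have large derivatives, then dilates of its adjoint ball
are contained in the derivatives of larger dilates. -/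
theorem adjointBall_smul_subset (h : Admissible p r) (hrr : Admissible r r)
    (hr' : normExp r ≠ ∞) {ρ : ℝ} (hρ : (normExp r).toReal.HolderConjugate ρ)
    (A : ∀ l, X l →L[𝕜] Y l) (hA : ∃ C : ℝ, ∀ l, ‖A l‖ ≤ C) {η : Ordinal.{u}} {ε : ℝ} (hε : 0 < ε)
    (hne : ∀ S : Finset Λ,
      (szlenkDerivatives ε (adjointBall (diagOp h A hA (S : Set Λ)ᶜ)) η).Nonempty)
    {a b t : ℝ} (ha : 0 ≤ a) (hb : 0 < b) (ht : 0 ≤ t) (hab : a ^ ρ + b ^ ρ ≤ t ^ ρ) :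
    adjointBall ((a : 𝕜) • diagOp h A hA Set.univ) ⊆
      szlenkDerivatives (b * (ε / 2)) (adjointBall ((t : 𝕜) • diagOp h A hA Set.univ)) η := by
  set T := diagOp h A hA Set.univ with hT
  intro _ hf
  obtain ⟨f, hf₁, rfl⟩ := exists_of_mem_adjointBall hf
  -- The restriction of `f` to `S` leaves room, off `S`, for a copy of the adjoint ball of the tail
  -- scaled by `b`; adding this copy stays inside the dilate by `t`.
  have hmem : ∀ S : Finset Λ, ((a : 𝕜) • f.comp (proj 𝕜 Y hrr (S : Set Λ))).comp T ∈
      szlenkDerivatives (b * (ε / 2)) (adjointBall ((t : 𝕜) • T)) η := by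
    intro S
    set f₀ := ((a : 𝕜) • f.comp (proj 𝕜 Y hrr (S : Set Λ))).comp T
    refine mem_szlenkDerivatives_of_zero_mem f₀ hb (half_pos hε).le (fun g hg => ?_)
      (zero_mem_szlenkDerivatives _ hε (hne S))
    obtain ⟨k, hk, rfl⟩ := exists_of_mem_adjointBall hg
    have := comp_mem_adjointBall_smul T
      (norm_smul_proj_add_le hrr hr' hρ (S : Set Λ) hf₁ hk ha hb.le ht hab)
    convert this using 1
    ext x
    change (b : 𝕜) * k (diagOp h A hA (S : Set Λ)ᶜ x) + (a : 𝕜) * f (proj 𝕜 Y hrr S (T x)) =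
      (a : 𝕜) * f (proj 𝕜 Y hrr S (T x)) + (b : 𝕜) * k (proj 𝕜 Y hrr (S : Set Λ)ᶜ (T x))
    rw [diagOp_eq_proj_comp hrr h A hA, add_comm]
  -- The restrictions converge weak-star to `f` as `S` grows, since `r < ∞`, and derivatives are
  -- weak-star closed.
  have hcl := ((wcompact_adjointBall ((t : 𝕜) • T)).szlenkDerivatives (b * (ε / 2)) η).isClosed
  have hlim : Tendsto (fun S : Finset Λ => StrongDual.toWeakDual
      (((a : 𝕜) • f.comp (proj 𝕜 Y hrr (S : Set Λ))).comp T)) atTop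
        (𝓝 (StrongDual.toWeakDual (f.comp ((a : 𝕜) • T)))) := by
    rw [tendsto_iff_forall_eval_tendsto_topDualPairing]
    intro x
    have h1 := ((f.continuous.tendsto _).comp (tendsto_proj hrr (T x))).const_smul (a : 𝕜)
    change Tendsto (fun S : Finset Λ => (a : 𝕜) * f (proj 𝕜 Y hrr (S : Set Λ) (T x))) atTop
      (𝓝 (f ((a : 𝕜) • T x)))
    rw [map_smul]
    exact h1
  obtain ⟨g, hg, hgf⟩ := hcl.mem_of_tendsto hlim (Eventually.of_forall fun S => ⟨_, hmem S, rfl⟩)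
  rwa [← StrongDual.toWeakDual.injective hgf]

end LowerSums

/-! ### Large tails exclude all exponents larger than r. -/

section LowerIterated

variable {𝕜 : Type*} [RCLike 𝕜] {Λ : Type u} {X Y : Λ → Type u} [∀ l, NormedAddCommGroup (X l)]
  [∀ l, NormedSpace 𝕜 (X l)] [∀ l, NormedAddCommGroup (Y l)] [∀ l, NormedSpace 𝕜 (Y l)]
  {p r : ℝ≥0∞} [hp : Fact (p = 0 ∨ 1 ≤ p)] [hr : Fact (r = 0 ∨ 1 ≤ r)]

/-- After k derivatives the adjoint ball still contains its dilate by (1 - k b^ρ)^{1/ρ}: the passage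
from k to k + 1 costs b^ρ. The choice n b^ρ = 1 leaves the zero functional after n steps. -/
theorem nonempty_derivList_of_forall_tail (h : Admissible p r) (hrr : Admissible r r)
    (hr' : normExp r ≠ ∞) {ρ : ℝ} (hρ : (normExp r).toReal.HolderConjugate ρ)
    (A : ∀ l, X l →L[𝕜] Y l) (hA : ∃ C : ℝ, ∀ l, ‖A l‖ ≤ C) {η : Ordinal.{u}} {ε : ℝ} (hε : 0 < ε)
    (hne : ∀ S : Finset Λ,
      (szlenkDerivatives ε (adjointBall (diagOp h A hA (S : Set Λ)ᶜ)) η).Nonempty)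
    {b : ℝ} (hb : 0 < b) {n : ℕ} (hn : n * b ^ ρ = 1) :
    (derivList η (List.replicate n (b * (ε / 2))) (adjointBall (diagOp h A hA Set.univ))).Nonempty := by
  set T := diagOp h A hA Set.univ
  have hρ0 := hρ.symm.pos
  have hb0 : 0 < b ^ ρ := Real.rpow_pos_of_pos hb _
  have key : ∀ k ≤ n, adjointBall ((((1 - k * b ^ ρ) ^ (1 / ρ) : ℝ) : 𝕜) • T) ⊆
      derivList η (List.replicate k (b * (ε / 2))) (adjointBall T) := by
    intro k hk
    induction k with
    | zero => simp [derivList_nil]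
    | succ k ih =>
      have hk' : ((k + 1 : ℕ) : ℝ) * b ^ ρ ≤ 1 := by
        rw [← hn]
        have : ((k + 1 : ℕ) : ℝ) ≤ n := by exact_mod_cast hk
        gcongr
      push_cast at hk' ⊢
      have h1 : 0 ≤ 1 - ((k : ℝ) + 1) * b ^ ρ := by linarith
      have h2 : 0 ≤ 1 - (k : ℝ) * b ^ ρ := by nlinarith
      rw [List.replicate_succ, derivList_cons, derivZ_of_ne (by positivity)]
      refine (adjointBall_smul_subset h hrr hr' hρ A hA hε hne (Real.rpow_nonneg h1 _) hb
        (Real.rpow_nonneg h2 (1 / ρ)) ?_).trans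
          (szlenkDerivatives_mono (by positivity) le_rfl (ih (by omega)) η)
      rw [← Real.rpow_mul h1, ← Real.rpow_mul h2, one_div_mul_cancel hρ0.ne', Real.rpow_one,
        Real.rpow_one]
      linarith
  exact ⟨_, key n le_rfl ⟨0, by simp, rfl⟩⟩

/-- If all tails of a diagonal operator have large derivatives, then there is no estimate for any
exponent larger than `r`. -/
theorem not_estimate_of_forall_tail (h : Admissible p r) (hrr : Admissible r r) (hr0 : r ≠ 0)
    (hr1 : 1 < r) {γ : ℝ≥0∞} (hrγ : r < γ)
    (A : ∀ l, X l →L[𝕜] Y l) (hA : ∃ C : ℝ, ∀ l, ‖A l‖ ≤ C) {ξ : Ordinal.{u}} {ε : ℝ} (hε : 0 < ε)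
    (hne : ∀ S : Finset Λ,
      (szlenkDerivatives ε (adjointBall (diagOp h A hA (S : Set Λ)ᶜ)) (ω ^ ξ)).Nonempty) (M : ℝ) :
    ¬ Estimate (adjointBall (diagOp h A hA Set.univ)) ξ γ M := by
  intro hest
  have hr' : normExp r = r := if_neg hr0
  have hrt : r ≠ ∞ := hrγ.ne_top
  have hr1' : 1 < r.toReal := by
    rw [← ENNReal.toReal_one]
    exact (ENNReal.toReal_lt_toReal ENNReal.one_ne_top hrt).2 hr1
  have hγ1 : 1 ≤ γ := (hr1.trans hrγ).le
  have : Fact (1 ≤ γ) := ⟨hγ1⟩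
  set ρ := r.toReal.conjExponent
  have hρ : r.toReal.HolderConjugate ρ := Real.HolderConjugate.conjExponent hr1'
  have hρ0 := hρ.symm.pos
  set g : ℝ := γ⁻¹.toReal with hg
  have hgr : g < r.toReal⁻¹ := by
    rw [hg, ← ENNReal.toReal_inv]
    exact (ENNReal.toReal_lt_toReal (ENNReal.inv_ne_top.2 (zero_lt_one.trans_le hγ1).ne')
      (ENNReal.inv_ne_top.2 hr0)).2 (ENNReal.inv_lt_inv.2 hrγ)
  have hone : ∀ n : ℕ, n ≠ 0 → ellNorm γ (fun _ : Fin n => (1 : ℝ)) ≤ (n : ℝ) ^ g := by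
    intro n hn
    rcases eq_or_ne γ ∞ with h' | h'
    · rw [hg, h', ellNorm_top]
      simp only [abs_one, ENNReal.inv_top, ENNReal.toReal_zero, Real.rpow_zero]
      exact Real.iSup_le (fun _ => le_rfl) zero_le_one
    · rw [ellNorm_eq hγ1 h', hg, ENNReal.toReal_inv]
      simp
  have key : ∀ n : ℕ, n ≠ 0 → (n : ℝ) ^ (r.toReal⁻¹ - g) ≤ M / (ε / 2) := by
    intro n hn
    have hn0 : (0 : ℝ) < n := by exact_mod_cast Nat.pos_of_ne_zero hn
    -- This gives n b^ρ = 1 and n b = n^{1/r}, while the vector of ones has ℓ_γ-norm n^{1/γ}; an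
    -- estimate would bound n^{1/r - 1/γ}.
    set b : ℝ := (n : ℝ) ^ (-ρ⁻¹) with hb
    have hb0 : 0 < b := Real.rpow_pos_of_pos hn0 _
    have hnb : n * b ^ ρ = 1 := by
      rw [hb, ← Real.rpow_mul hn0.le, neg_mul, inv_mul_cancel₀ hρ0.ne', Real.rpow_neg_one,
        mul_inv_cancel₀ hn0.ne']
    have h1 := nonempty_derivList_of_forall_tail h hrr (hr'.trans_ne hrt) (by rwa [hr']) A hA hε hne
      hb0 hnb
    have h2 := hest n (fun _ => b * (ε / 2)) (fun _ => 1) (fun _ => by positivity)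
      (fun _ => zero_le_one) (by rwa [List.ofFn_const])
    simp only [one_mul, Finset.sum_const, Finset.card_univ, Fintype.card_fin,
      _root_.nsmul_eq_mul] at h2
    have hM : 0 ≤ M := by
      by_contra hcon
      have h3 : M * ellNorm γ (fun _ : Fin n => (1 : ℝ)) ≤ 0 :=
        mul_nonpos_of_nonpos_of_nonneg (not_le.1 hcon).le (ellNorm_nonneg _)
      have : 0 < (n : ℝ) * (b * (ε / 2)) := by positivity
      linarith
    have h3 := h2.trans (mul_le_mul_of_nonneg_left (hone n hn) hM)
    have h4 : (n : ℝ) * b = (n : ℝ) ^ r.toReal⁻¹ := by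
      rw [hb, ← Real.rpow_one_add' hn0.le]
      · congr 1
        have := hρ.inv_add_inv_eq_inv
        rw [inv_one] at this
        linarith
      · have := hρ.inv_add_inv_eq_inv
        rw [inv_one] at this
        have := inv_pos.2 hρ.pos
        intro h0
        linarith
    rw [Real.rpow_sub hn0, ← h4, div_le_div_iff₀ (by positivity) (by positivity)]
    linarith
  have hlim : Tendsto (fun n : ℕ => (n : ℝ) ^ (r.toReal⁻¹ - g)) atTop atTop :=
    (tendsto_rpow_atTop (sub_pos.2 hgr)).comp tendsto_natCast_atTop_atTop
  obtain ⟨n, hn, hn0⟩ := ((hlim.eventually_gt_atTop (M / (ε / 2))).and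
    (eventually_ne_atTop 0)).exists
  exact absurd (key n hn0) (not_le.2 hn)

end LowerIterated

/-! ### Derivatives of the adjoint ball of a diagonal operator, coordinate by coordinate. -/

section LowerProducts

variable {𝕜 : Type*} [RCLike 𝕜]

theorem derivList_of_forall_eq_zero {X : Type u} [NormedAddCommGroup X] [NormedSpace 𝕜 X]
    {K : Set (StrongDual 𝕜 X)} {η : Ordinal.{u}} {l : List ℝ} (hl : ∀ ε ∈ l, ε = 0) :
    derivList η l K = K := by
  induction l with
  | nil => rfl
  | cons ε l ih =>
    rw [List.forall_mem_cons] at hl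
    rw [derivList_cons, hl.1, derivZ_zero, ih hl.2]

theorem comp_mem_adjointBall {X : Type u} [NormedAddCommGroup X] [NormedSpace 𝕜 X]
    {Y : Type u} [NormedAddCommGroup Y] [NormedSpace 𝕜 Y] (A : X →L[𝕜] Y) {k : StrongDual 𝕜 Y}
    (hk : ‖k‖ ≤ 1) : k.comp A ∈ adjointBall A :=
  ⟨k, by simpa using hk, rfl⟩

theorem Estimate.sum_le {X : Type u} [NormedAddCommGroup X] [NormedSpace 𝕜 X]
    {K : Set (StrongDual 𝕜 X)} {ξ : Ordinal.{u}} {γ : ℝ≥0∞} {M : ℝ} (h : Estimate K ξ γ M)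
    (P : List (ℝ × ℝ)) (hP : ∀ x ∈ P, 0 ≤ x.1 ∧ 0 ≤ x.2)
    (hne : (derivList (ω ^ ξ) (P.map Prod.fst) K).Nonempty) :
    (P.map fun x => x.2 * x.1).sum ≤ M * ellNorm γ fun i : Fin P.length => (P.get i).2 := by
  have := h P.length (fun i => (P.get i).1) (fun i => (P.get i).2) (fun i => (hP _ (P.get_mem i)).1)
    (fun i => (hP _ (P.get_mem i)).2) (by
      convert hne using 2
      refine List.ext_getElem (by simp) fun j h1 h2 => by simp)
  rwa [← Fin.sum_univ_fun_getElem P fun x => x.2 * x.1]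

theorem ellNorm_get_le_one {γ : ℝ≥0∞} [hγ : Fact (1 ≤ γ)] (P : List (ℝ × ℝ))
    (h1 : γ = ∞ → ∀ x ∈ P, |x.2| ≤ 1)
    (h2 : γ ≠ ∞ → (P.map fun x => |x.2| ^ γ.toReal).sum ≤ 1) :
    ellNorm γ (fun i : Fin P.length => (P.get i).2) ≤ 1 := by
  rcases eq_or_ne γ ∞ with h | h
  · subst h
    rw [ellNorm_top]
    exact Real.iSup_le (fun i => h1 rfl _ (P.get_mem i)) zero_le_one
  · have h0 := toReal_pos_of_one_le hγ.out h
    rw [← Real.rpow_le_rpow_iff (ellNorm_nonneg _) zero_le_one h0, ellNorm_rpow h, Real.one_rpow]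
    refine le_of_eq_of_le ?_ (h2 h)
    exact Fin.sum_univ_fun_getElem P fun x => |x.2| ^ γ.toReal

variable {Λ : Type u} {X Y : Λ → Type u} [∀ l, NormedAddCommGroup (X l)]
  [∀ l, NormedSpace 𝕜 (X l)] [∀ l, NormedAddCommGroup (Y l)] [∀ l, NormedSpace 𝕜 (Y l)]
  {p r : ℝ≥0∞} [hp : Fact (p = 0 ∨ 1 ≤ p)] [hr : Fact (r = 0 ∨ 1 ≤ r)]

variable (p) in
/-- The functional `x ↦ ∑ c_λ g_λ(x_λ)`. -/
noncomputable def comb (S : Finset Λ) (c : Λ → ℝ) (g : ∀ l, StrongDual 𝕜 (X l)) :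
    StrongDual 𝕜 (directSum 𝕜 X p) :=
  ∑ l ∈ S, (c l : 𝕜) • (g l).comp (coord 𝕜 X p l)

theorem comb_apply (S : Finset Λ) (c : Λ → ℝ) (g : ∀ l, StrongDual 𝕜 (X l))
    (x : directSum 𝕜 X p) : comb p S c g x = ∑ l ∈ S, (c l : 𝕜) * g l (x.1 l) := by
  simp [comb, coord_apply]

/-- The hypothesis `hc` says that `c` lies in the unit ball of the dual of ℓ_r over `S`. -/
theorem comb_mem (h : Admissible p r) (A : ∀ l, X l →L[𝕜] Y l)
    (hA : ∃ C : ℝ, ∀ l, ‖A l‖ ≤ C) {S : Finset Λ} {c : Λ → ℝ} (hc0 : ∀ l, 0 ≤ c l)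
    (hc : ∀ v : Λ → ℝ, (∀ l, 0 ≤ v l) →
      ∑ l ∈ S, c l * v l ≤ ellNorm (normExp r) fun l : S => v l)
    {g : ∀ l, StrongDual 𝕜 (X l)} (hg : ∀ l ∈ S, g l ∈ adjointBall (A l)) :
    comb p S c g ∈ adjointBall (diagOp h A hA Set.univ) := by
  classical
  have : ∀ l, ∃ k : StrongDual 𝕜 (Y l), ‖k‖ ≤ 1 ∧ (l ∈ S → g l = k.comp (A l)) := fun l => by
    by_cases hl : l ∈ S
    · obtain ⟨k, hk, hgk⟩ := exists_of_mem_adjointBall (hg l hl)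
      exact ⟨k, hk, fun _ => hgk⟩
    · exact ⟨0, by simp, fun h => absurd h hl⟩
  choose k hk hgk using this
  have hmem : (comb r S c k).comp (diagOp h A hA Set.univ) ∈ adjointBall (diagOp h A hA Set.univ) := by
    have hle : ‖comb r S c k‖ ≤ 1 := by
      refine ContinuousLinearMap.opNorm_le_bound _ zero_le_one fun y => ?_
      rw [comb_apply, one_mul]
      refine le_trans ?_ ((hc (fun l => ‖y.1 l‖) fun l => norm_nonneg _).trans (ellNorm_norm_le y S))
      refine (norm_sum_le _ _).trans (Finset.sum_le_sum fun l _ => ?_)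
      rw [norm_mul, RCLike.norm_ofReal, abs_of_nonneg (hc0 l)]
      refine mul_le_mul_of_nonneg_left ?_ (hc0 l)
      exact ((k l).le_of_opNorm_le (hk l) _).trans (one_mul _).le
    exact comp_mem_adjointBall _ hle
  · convert hmem using 1
    ext x
    change _ = comb r S c k (diagOp h A hA Set.univ x)
    rw [comb_apply, comb_apply]
    refine Finset.sum_congr rfl fun l hl => ?_
    rw [diagOp_univ_apply, hgk l hl]
    rfl

/-- With the other coordinates fixed, the combination depends affinely on the functional at `m`,
with factor `c m`. Derivatives of the adjoint ball of `A m` at level ε therefore turn into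
derivatives at level c_m ε. The condition `hg'` concerns only the coordinates still in the list, so
that the induction hypothesis allows an arbitrary functional of the adjoint ball at `m`. -/
theorem comb_mem_derivList (h : Admissible p r) (A : ∀ l, X l →L[𝕜] Y l)
    (hA : ∃ C : ℝ, ∀ l, ‖A l‖ ≤ C) {S : Finset Λ} {c : Λ → ℝ} (hc0 : ∀ l, 0 ≤ c l)
    (hc : ∀ v : Λ → ℝ, (∀ l, 0 ≤ v l) →
      ∑ l ∈ S, c l * v l ≤ ellNorm (normExp r) fun l : S => v l)
    (η : Ordinal.{u}) (L : Λ → List ℝ) (hL : ∀ l, ∀ ε ∈ L l, 0 ≤ ε) (ls : List Λ)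
    (hls : ls.Nodup) (hS : ∀ l ∈ ls, l ∈ S) (g : ∀ l, StrongDual 𝕜 (X l))
    (hg : ∀ l ∈ S, g l ∈ adjointBall (A l))
    (hg' : ∀ l ∈ ls, g l ∈ derivList η (L l) (adjointBall (A l))) :
    comb p S c g ∈ derivList η (ls.flatMap fun l => (L l).map (c l * ·))
      (adjointBall (diagOp h A hA Set.univ)) := by
  classical
  induction ls generalizing g with
  | nil => exact comb_mem h A hA hc0 hc hg
  | cons m ls ih =>
    rw [List.nodup_cons] at hls
    rw [List.forall_mem_cons] at hS hg'
    rw [List.flatMap_cons, derivList_append]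
    rcases (hc0 m).eq_or_lt with hm | hm
    · rw [derivList_of_forall_eq_zero (l := (L m).map (c m * ·)) (by simp [← hm])]
      exact ih hls.2 hS.2 g hg hg'.2
    -- The combination as a function of its coordinate at `m`.
    · have hupd : ∀ g' : StrongDual 𝕜 (X m), comb p S c (Function.update g m g') =
          (c m : 𝕜) • g'.comp (coord 𝕜 X p m) + comb p (S.erase m) c g := by
        intro g'
        rw [comb, comb, ← Finset.add_sum_erase S _ hS.1, Function.update_self]
        refine congrArg _ (Finset.sum_congr rfl fun l hl => ?_)
        rw [Function.update_of_ne (Finset.ne_of_mem_erase hl)]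
      have := mapsTo_derivList_affine (coord 𝕜 X p m) (fun g => norm_comp_coord g)
        (comb p (S.erase m) c g) hm (L := adjointBall (A m))
        (K := derivList η (ls.flatMap fun l => (L l).map (c l * ·))
          (adjointBall (diagOp h A hA Set.univ)))
        (fun g' hg₁ => by
          rw [← hupd]
          refine ih hls.2 hS.2 _ (fun l hl => ?_) fun l hl => ?_
          · rcases eq_or_ne l m with rfl | hne
            · rwa [Function.update_self]
            · rw [Function.update_of_ne hne]
              exact hg l hl
          · rw [Function.update_of_ne (fun hlm : l = m => hls.1 (hlm ▸ hl))]
            exact hg'.2 l hl) η (L m) (hL m) hg'.1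
      simpa only [← hupd, Function.update_eq_self] using this

/-- The estimate for the diagonal operator is tested on the concatenation over `l ∈ S` of the levels
c_l ε_{l,i} with the coefficients t_l b_{l,i}, whose ℓ_γ-norm is at most 1. -/
theorem sum_le_of_estimate (h : Admissible p r) (A : ∀ l, X l →L[𝕜] Y l)
    (hA : ∃ C : ℝ, ∀ l, ‖A l‖ ≤ C) {ξ : Ordinal.{u}} {γ : ℝ≥0∞} [hγ : Fact (1 ≤ γ)] {M : ℝ}
    (hM : 0 ≤ M) (hest : Estimate (adjointBall (diagOp h A hA Set.univ)) ξ γ M)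
    {S : Finset Λ} {c : Λ → ℝ} (hc0 : ∀ l, 0 ≤ c l)
    (hc : ∀ v : Λ → ℝ, (∀ l, 0 ≤ v l) →
      ∑ l ∈ S, c l * v l ≤ ellNorm (normExp r) fun l : S => v l)
    (n : Λ → ℕ) (ε b : ∀ l, Fin (n l) → ℝ) (hε : ∀ l i, 0 ≤ ε l i) (hb : ∀ l i, 0 ≤ b l i)
    (hb1 : ∀ l, ellNorm γ (b l) ≤ 1)
    (hne : ∀ l, (derivList (ω ^ ξ) (List.ofFn (ε l)) (adjointBall (A l))).Nonempty)
    {t : Λ → ℝ} (ht0 : ∀ l, 0 ≤ t l) (ht : ellNorm γ (fun l : S => t l) ≤ 1) :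
    ∑ l ∈ S, t l * (c l * ∑ i, b l i * ε l i) ≤ M := by
  classical
  choose g hg using hne
  set P : List (ℝ × ℝ) := S.toList.flatMap fun l =>
    List.ofFn fun i : Fin (n l) => (c l * ε l i, t l * b l i) with hP
  have hmemP : ∀ x ∈ P, ∃ l ∈ S, ∃ i, x = (c l * ε l i, t l * b l i) := by
    intro x hx
    simp only [hP, List.mem_flatMap, Finset.mem_toList, List.mem_ofFn] at hx
    obtain ⟨l, hl, i, rfl⟩ := hx
    exact ⟨l, hl, i, rfl⟩
  have hsumP : ∀ f : ℝ × ℝ → ℝ, (P.map f).sum = ∑ l ∈ S, ∑ i, f (c l * ε l i, t l * b l i) := by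
    intro f
    rw [hP, List.map_flatMap, List.flatMap_def, List.sum_flatten, List.map_map, ← Finset.sum_map_toList]
    congr 1
    refine List.map_congr_left fun l _ => ?_
    rw [Function.comp_apply, List.map_ofFn, List.sum_ofFn]
    rfl
  have hfst : P.map Prod.fst =
      S.toList.flatMap fun l => (List.ofFn (ε l)).map (c l * ·) := by
    rw [hP, List.map_flatMap]
    congr 1
    funext l
    rw [List.map_ofFn, List.map_ofFn]
    rfl
  have h1 := hest.sum_le P (fun x hx => by
    obtain ⟨l, _, i, rfl⟩ := hmemP x hx
    exact ⟨mul_nonneg (hc0 l) (hε l i), mul_nonneg (ht0 l) (hb l i)⟩) (by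
    rw [hfst]
    exact ⟨_, comb_mem_derivList h A hA hc0 hc _ (fun l => List.ofFn (ε l))
      (fun l => by simpa using hε l) S.toList S.nodup_toList (fun l hl => Finset.mem_toList.1 hl) g
      (fun l _ => derivList_subset _ (hg l)) fun l _ => hg l⟩)
  have h2 : ellNorm γ (fun i : Fin P.length => (P.get i).2) ≤ 1 := by
    refine ellNorm_get_le_one P (fun hγt x hx => ?_) fun hγt => ?_
    · obtain ⟨l, hl, i, rfl⟩ := hmemP x hx
      rw [abs_mul]
      exact mul_le_one₀ ((abs_le_ellNorm (q := γ) (fun l : S => t l) ⟨l, hl⟩).trans ht)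
        (abs_nonneg _) ((abs_le_ellNorm (q := γ) (b l) i).trans (hb1 l))
    · have h0 := toReal_pos_of_one_le hγ.out hγt
      rw [hsumP]
      calc ∑ l ∈ S, ∑ i, |t l * b l i| ^ γ.toReal
          ≤ ∑ l ∈ S, |t l| ^ γ.toReal := by
            refine Finset.sum_le_sum fun l _ => ?_
            have : ∀ i, |t l * b l i| ^ γ.toReal = |t l| ^ γ.toReal * |b l i| ^ γ.toReal := fun i => by
              rw [abs_mul, Real.mul_rpow (abs_nonneg _) (abs_nonneg _)]
            simp only [this]
            rw [← Finset.mul_sum, ← ellNorm_rpow hγt]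
            exact mul_le_of_le_one_right (by positivity)
              (Real.rpow_le_one (ellNorm_nonneg _) (hb1 l) h0.le)
        _ = ellNorm γ (fun l : S => t l) ^ γ.toReal := by
            rw [ellNorm_rpow hγt, Finset.sum_coe_sort S fun l => |t l| ^ γ.toReal]
        _ ≤ 1 := Real.rpow_le_one (ellNorm_nonneg _) ht h0.le
  rw [hsumP] at h1
  calc ∑ l ∈ S, t l * (c l * ∑ i, b l i * ε l i)
      = ∑ l ∈ S, ∑ i, t l * b l i * (c l * ε l i) := by
        refine Finset.sum_congr rfl fun l _ => ?_
        rw [Finset.mul_sum, Finset.mul_sum]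
        exact Finset.sum_congr rfl fun i _ => by ring
    _ ≤ M * 1 := h1.trans (mul_le_mul_of_nonneg_left h2 hM)
    _ = M := mul_one M

/-- Composition with the coordinate map embeds the adjoint ball of `A l` isometrically and weak-star
continuously into that of the diagonal operator. -/
theorem Estimate.of_diagOp (h : Admissible p r) (A : ∀ l, X l →L[𝕜] Y l)
    (hA : ∃ C : ℝ, ∀ l, ‖A l‖ ≤ C) {ξ : Ordinal.{u}} {γ : ℝ≥0∞} {M : ℝ}
    (hest : Estimate (adjointBall (diagOp h A hA Set.univ)) ξ γ M) (l : Λ) :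
    Estimate (adjointBall (A l)) ξ γ M := by
  refine hest.of_mapsTo (φ := fun f => f.comp (coord 𝕜 X p l))
    (continuous_weakDual_comp (coord 𝕜 X p l)) (fun f _ g _ => ?_) fun f hf => ?_
  · rw [← ContinuousLinearMap.sub_comp, norm_comp_coord]
  · obtain ⟨k, hk, rfl⟩ := exists_of_mem_adjointBall hf
    have hmem := comp_mem_adjointBall (diagOp h A hA Set.univ) (k := k.comp (coord 𝕜 Y r l))
      ((norm_comp_coord k).trans_le hk)
    convert hmem using 1
    ext x
    change k (A l (x.1 l)) = k ((diagOp h A hA Set.univ x).1 l)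
    rw [diagOp_univ_apply]

end LowerProducts

/-! ### The constants of the summands belong to ℓ_s. -/

section Summability

variable {𝕜 : Type*} [RCLike 𝕜]

/-- The supremum of ∑ bᵢ εᵢ over admissible data with ‖b‖_γ ≤ 1 is the best constant; data that
reach half of it serve as test data for the diagonal operator. -/
theorem Estimate.exists_optimal {X : Type u} [NormedAddCommGroup X] [NormedSpace 𝕜 X]
    {K : Set (StrongDual 𝕜 X)} {ξ : Ordinal.{u}} {γ : ℝ≥0∞} [hγ : Fact (1 ≤ γ)] {M : ℝ}
    (hM : 0 ≤ M) (hK : K.Nonempty) (hest : Estimate K ξ γ M) :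
    ∃ β, 0 ≤ β ∧ Estimate K ξ γ β ∧ ∃ (n : ℕ) (ε b : Fin n → ℝ), (∀ i, 0 ≤ ε i) ∧ (∀ i, 0 ≤ b i) ∧
      ellNorm γ b ≤ 1 ∧ (derivList (ω ^ ξ) (List.ofFn ε) K).Nonempty ∧
      β ≤ 2 * ∑ i, b i * ε i := by
  set W : Set ℝ := {x | ∃ (n : ℕ) (ε b : Fin n → ℝ), (∀ i, 0 ≤ ε i) ∧ (∀ i, 0 ≤ b i) ∧
    ellNorm γ b ≤ 1 ∧ (derivList (ω ^ ξ) (List.ofFn ε) K).Nonempty ∧ x = ∑ i, b i * ε i} with hW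
  have h0 : (0 : ℝ) ∈ W := by
    refine ⟨0, Fin.elim0, Fin.elim0, fun i => i.elim0, fun i => i.elim0, ?_, by simpa [derivList_nil] using hK,
      by simp⟩
    have : (Fin.elim0 : Fin 0 → ℝ) = fun _ => 0 := Subsingleton.elim _ _
    rw [this, ellNorm_zero]
    exact zero_le_one
  have hbdd : BddAbove W := by
    refine ⟨M, ?_⟩
    rintro x ⟨n, ε, b, hε, hb, hb1, hne, rfl⟩
    exact (hest n ε b hε hb hne).trans (mul_le_of_le_one_right hM hb1)
  have hβ : 0 ≤ sSup W := le_csSup hbdd h0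
  refine ⟨sSup W, hβ, fun n ε b hε hb hne => ?_, ?_⟩
  · rcases (ellNorm_nonneg (q := γ) b).eq_or_lt with hN | hN
    · have : ∀ i, b i = 0 := ellNorm_eq_zero hN.symm
      simp [this, ← hN]
    · have h1 : ∑ i, (b i / ellNorm γ b) * ε i ≤ sSup W := by
        refine le_csSup hbdd ⟨n, ε, fun i => b i / ellNorm γ b, hε,
          fun i => div_nonneg (hb i) hN.le, ?_, hne, rfl⟩
        have : (fun i => b i / ellNorm γ b) = fun i => (ellNorm γ b)⁻¹ * b i := by
          funext i
          rw [div_eq_inv_mul]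
        rw [this, ellNorm_const_mul, abs_of_pos (inv_pos.2 hN), inv_mul_cancel₀ hN.ne']
      calc ∑ i, b i * ε i = (∑ i, (b i / ellNorm γ b) * ε i) * ellNorm γ b := by
            rw [Finset.sum_mul]
            exact Finset.sum_congr rfl fun i _ => by field_simp
        _ ≤ sSup W * ellNorm γ b := by gcongr
  -- If the supremum is 0, nothing lies strictly above half of it from below, and any data with sum
  -- 0 will do.
  · rcases hβ.eq_or_lt with h | h
    · obtain ⟨n, ε, b, hε, hb, hb1, hne, hx⟩ := h0
      exact ⟨n, ε, b, hε, hb, hb1, hne, by rw [← hx, ← h, mul_zero]⟩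
    · obtain ⟨x, ⟨n, ε, b, hε, hb, hb1, hne, rfl⟩, hx⟩ :=
        exists_lt_of_lt_csSup ⟨0, h0⟩ (half_lt_self h)
      exact ⟨n, ε, b, hε, hb, hb1, hne, by linarith⟩

/-- Equality in Hölder's inequality for three exponents. -/
theorem exists_hoelder_witness {Λ : Type*} {γ s r : ℝ≥0∞} [hγ : Fact (1 ≤ γ)] [hs : Fact (1 ≤ s)]
    [hr : Fact (1 ≤ r)] (hs' : s ≠ ∞) (hr1 : 1 < r) (hr' : r ≠ ∞) (h : γ⁻¹ + s⁻¹ = r⁻¹)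
    {β : Λ → ℝ} (hβ : ∀ l, 0 ≤ β l) (S : Finset Λ) :
    ∃ t c : Λ → ℝ, (∀ l, 0 ≤ t l) ∧ (∀ l, 0 ≤ c l) ∧ ellNorm γ (fun l : S => t l) ≤ 1 ∧
      (∀ v : Λ → ℝ, (∀ l, 0 ≤ v l) → ∑ l ∈ S, c l * v l ≤ ellNorm r fun l : S => v l) ∧
      ∑ l ∈ S, t l * (c l * β l) = ellNorm s fun l : S => β l := by
  rcases (ellNorm_nonneg (q := s) fun l : S => β l).eq_or_lt with hN | hN
  · have hz : ∀ l ∈ S, β l = 0 := fun l hl => ellNorm_eq_zero hN.symm ⟨l, hl⟩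
    refine ⟨fun _ => 0, fun _ => 0, fun _ => le_rfl, fun _ => le_rfl, ?_, fun v _ => ?_, ?_⟩
    · rw [ellNorm_zero]
      exact zero_le_one
    · simpa using ellNorm_nonneg _
    · rw [← hN]
      simp
  set N := ellNorm s fun l : S => β l with hNdef
  have hs0 := toReal_pos_of_one_le hs.out hs'
  have hr0 := toReal_pos_of_one_le hr.out hr'
  have hr1' : 1 < r.toReal := by
    rw [← ENNReal.toReal_one]
    exact (ENNReal.toReal_lt_toReal ENNReal.one_ne_top hr').2 hr1
  set ρ := r.toReal.conjExponent
  have hc : r.toReal.HolderConjugate ρ := Real.HolderConjugate.conjExponent hr1'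
  have hg0 : 0 ≤ γ⁻¹.toReal := ENNReal.toReal_nonneg
  have hρ0 : 0 < ρ := hc.symm.pos
  have hexp : γ⁻¹.toReal + s.toReal⁻¹ = r.toReal⁻¹ := by
    rw [← ENNReal.toReal_inv, ← ENNReal.toReal_inv, ← h, ENNReal.toReal_add]
    · exact ENNReal.inv_ne_top.2 (zero_lt_one.trans_le hγ.out).ne'
    · exact ENNReal.inv_ne_top.2 (zero_lt_one.trans_le hs.out).ne'
  have hu0 : ∀ l, 0 ≤ β l / N := fun l => div_nonneg (hβ l) hN.le
  have hsum : ∑ l ∈ S, (β l / N) ^ s.toReal = 1 := by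
    have h1 : ∑ l ∈ S, β l ^ s.toReal = N ^ s.toReal := by
      rw [hNdef, ellNorm_rpow hs', Finset.sum_coe_sort S fun l => |β l| ^ s.toReal]
      exact Finset.sum_congr rfl fun l _ => by rw [abs_of_nonneg (hβ l)]
    calc ∑ l ∈ S, (β l / N) ^ s.toReal = ∑ l ∈ S, β l ^ s.toReal / N ^ s.toReal :=
          Finset.sum_congr rfl fun l _ => Real.div_rpow (hβ l) hN.le _
      _ = 1 := by rw [← Finset.sum_div, h1, _root_.div_self (by positivity)]
  -- With u = β/N these are t = u^{s/γ} and c = u^{s/ρ}. As s/γ + s/ρ + 1 = s, the product t c β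
  -- equals u^s N, and ∑ u^s = 1.
  refine ⟨fun l => (β l / N) ^ (s.toReal * γ⁻¹.toReal), fun l => (β l / N) ^ (s.toReal * ρ⁻¹),
    fun l => Real.rpow_nonneg (hu0 l) _, fun l => Real.rpow_nonneg (hu0 l) _, ?_, fun v hv => ?_, ?_⟩
  · rcases eq_or_ne γ ∞ with rfl | hγ'
    · rw [ellNorm_top]
      exact Real.iSup_le (fun l => by simp) zero_le_one
    · have hγ0 := toReal_pos_of_one_le hγ.out hγ'
      rw [ellNorm_eq hγ.out hγ']
      refine (congrArg (· ^ (1 / γ.toReal)) ?_).le.trans (Real.one_rpow _).le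
      rw [← hsum, ← Finset.sum_coe_sort S fun l => (β l / N) ^ s.toReal]
      refine Finset.sum_congr rfl fun l _ => ?_
      rw [abs_of_nonneg (Real.rpow_nonneg (hu0 l) _), ← Real.rpow_mul (hu0 l), ENNReal.toReal_inv,
        inv_mul_cancel_right₀ hγ0.ne']
  · have h1 := Real.inner_le_Lp_mul_Lq_of_nonneg S hc.symm
      (f := fun l => (β l / N) ^ (s.toReal * ρ⁻¹)) (g := v)
      (fun l _ => Real.rpow_nonneg (hu0 l) _) fun l _ => hv l
    refine h1.trans (le_of_eq ?_)
    have h2 : ∀ l ∈ S, ((β l / N) ^ (s.toReal * ρ⁻¹)) ^ ρ = (β l / N) ^ s.toReal := fun l _ => by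
      rw [← Real.rpow_mul (hu0 l), inv_mul_cancel_right₀ hρ0.ne']
    rw [Finset.sum_congr rfl h2, hsum, Real.one_rpow, one_mul, ellNorm_eq hr.out hr',
      Finset.sum_coe_sort S fun l => |v l| ^ r.toReal]
    congr 1
    exact Finset.sum_congr rfl fun l _ => by rw [abs_of_nonneg (hv l)]
  · have h1 : ∀ l ∈ S, (β l / N) ^ (s.toReal * γ⁻¹.toReal) * ((β l / N) ^ (s.toReal * ρ⁻¹) * β l) =
        (β l / N) ^ s.toReal * N := fun l _ => by
      have he : s.toReal = s.toReal * γ⁻¹.toReal + (s.toReal * ρ⁻¹ + 1) := by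
        have := hc.inv_add_inv_eq_one
        have h3 : γ⁻¹.toReal + ρ⁻¹ = 1 - s.toReal⁻¹ := by linarith
        rw [← add_assoc, ← _root_.mul_add, h3, _root_.mul_sub, mul_inv_cancel₀ hs0.ne']
        ring
      conv_rhs => rw [he, Real.rpow_add_of_nonneg (hu0 l) (by positivity) (by positivity),
        Real.rpow_add_of_nonneg (hu0 l) (by positivity) zero_le_one, Real.rpow_one]
      field_simp
    rw [Finset.sum_congr rfl h1, ← Finset.sum_mul, hsum, one_mul]

variable {Λ : Type u} {X : Λ → Type u} [∀ l, NormedAddCommGroup (X l)] [∀ l, NormedSpace 𝕜 (X l)]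
  {Y : Λ → Type u} [∀ l, NormedAddCommGroup (Y l)] [∀ l, NormedSpace 𝕜 (Y l)]
  {p r : ℝ≥0∞} [Fact (p = 0 ∨ 1 ≤ p)] [Fact (r = 0 ∨ 1 ≤ r)]

theorem zero_mem_adjointBall {X : Type u} [NormedAddCommGroup X] [NormedSpace 𝕜 X]
    {Y : Type u} [NormedAddCommGroup Y] [NormedSpace 𝕜 Y] (A : X →L[𝕜] Y) :
    (0 : StrongDual 𝕜 X) ∈ adjointBall A :=
  ⟨0, by simp, by ext; simp⟩

/-- The near-optimal data of the summands are combined with weights for which Hölder's inequality is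
an equality; then ‖β‖_s over any finite set is at most 2M. -/
theorem exists_memℓp_of_estimate (h : Admissible p r) (A : ∀ l, X l →L[𝕜] Y l)
    (hA : ∃ C : ℝ, ∀ l, ‖A l‖ ≤ C) {ξ : Ordinal.{u}} {γ s : ℝ≥0∞} (hγ : 1 ≤ γ) (hs : 1 ≤ s)
    (hs' : s ≠ ∞) (hr1 : 1 < normExp r) (hr' : normExp r ≠ ∞) (hγs : γ⁻¹ + s⁻¹ = (normExp r)⁻¹)
    {M : ℝ} (hM : 0 ≤ M) (hest : Estimate (adjointBall (diagOp h A hA Set.univ)) ξ γ M) :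
    ∃ β : Λ → ℝ, (∀ l, 0 ≤ β l) ∧ (∀ l, Estimate (adjointBall (A l)) ξ γ (β l)) ∧
      Memℓp β s := by
  have : Fact (1 ≤ γ) := ⟨hγ⟩
  have : Fact (1 ≤ s) := ⟨hs⟩
  choose β hβ hestβ n ε b hε hb hb1 hne hle using fun l =>
    (Estimate.of_diagOp h A hA hest l).exists_optimal hM ⟨0, zero_mem_adjointBall (A l)⟩
  refine ⟨β, hβ, hestβ, (memℓp_iff_ellNorm β).2 ⟨2 * M, fun S => ?_⟩⟩
  obtain ⟨t, c, ht0, hc0, ht, hc, heq⟩ := exists_hoelder_witness hs' hr1 hr' hγs hβ S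
  have h1 := sum_le_of_estimate h A hA hM hest hc0 hc n ε b hε hb hb1 hne ht0 ht
  rw [← heq]
  calc ∑ l ∈ S, t l * (c l * β l)
      ≤ ∑ l ∈ S, t l * (c l * (2 * ∑ i, b l i * ε l i)) := by
        refine Finset.sum_le_sum fun l _ => ?_
        exact mul_le_mul_of_nonneg_left (mul_le_mul_of_nonneg_left (hle l) (hc0 l)) (ht0 l)
    _ = 2 * ∑ l ∈ S, t l * (c l * ∑ i, b l i * ε l i) := by
        rw [Finset.mul_sum]
        exact Finset.sum_congr rfl fun l _ => by ring
    _ ≤ 2 * M := by linarith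

end Summability

/-! ### The characterisations of finiteness. -/

section Main

variable {𝕜 : Type*} [RCLike 𝕜]

/-- One level with coefficient 1 shows that every ε-derivative of order ω ^ ξ is empty; conversely,
emptiness forces all levels to vanish. -/
theorem estimate_zero_iff {X : Type u} [NormedAddCommGroup X] [NormedSpace 𝕜 X]
    {K : Set (StrongDual 𝕜 X)} {ξ : Ordinal.{u}} {γ : ℝ≥0∞} :
    Estimate K ξ γ 0 ↔ szlenk K ≤ ((ω ^ ξ : Ordinal.{u}) : WithTop Ordinal.{u}) := by
  rw [szlenk_le_iff]
  constructor
  · intro h ε hε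
    by_contra hne
    have := h 1 (fun _ => ε) (fun _ => 1) (fun _ => hε.le) (fun _ => zero_le_one) (by
      simpa [List.ofFn_succ, derivList_cons, derivList_nil, derivZ_of_ne hε.ne'] using
        Set.nonempty_iff_ne_empty.2 hne)
    simp only [Finset.univ_unique, Finset.sum_singleton, one_mul, zero_mul] at this
    exact this.not_gt hε
  · intro h n ε b hε hb hne
    have h0 : ∀ i, ε i = 0 := fun i => by
      by_contra hi
      have hpos := lt_of_le_of_ne (hε i) (Ne.symm hi)
      have := hne.mono (derivList_subset_of_mem hpos le_rfl (List.mem_ofFn.2 ⟨i, rfl⟩))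
      rw [h _ hpos] at this
      exact Set.not_nonempty_empty this
    simp [h0]

theorem memEll_of_le {Λ : Type u} {s : ℝ≥0∞} [Fact (1 ≤ s)] {a : Λ → ℝ≥0∞} {β : Λ → ℝ}
    (hβ : ∀ l, 0 ≤ β l) (h : ∀ l, a l ≤ ENNReal.ofReal (β l)) (hmem : Memℓp β s) : MemEll s a := by
  refine ⟨fun l => ne_top_of_le_ne_top ENNReal.ofReal_ne_top (h l), ?_⟩
  obtain ⟨B, hB⟩ := (memℓp_iff_ellNorm β).1 hmem
  refine (memℓp_iff_ellNorm _).2 ⟨B, fun S => (ellNorm_mono' (ι := S) (fun l => ?_)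
    fun l => ?_).trans (hB S)⟩
  · exact ENNReal.toReal_nonneg
  · exact ENNReal.toReal_le_of_le_ofReal (hβ l) (h l)

theorem exists_estimate_of_opAlpha_ne_top {X Y : Type u} [NormedAddCommGroup X] [NormedSpace 𝕜 X]
    [NormedAddCommGroup Y] [NormedSpace 𝕜 Y] (A : X →L[𝕜] Y) {ξ : Ordinal.{u}} {γ : ℝ≥0∞}
    (hγ : 1 ≤ γ) (h : opAlpha A ξ γ ≠ ∞) :
    Estimate (adjointBall A) ξ γ (8 * (opAlpha A ξ γ).toReal) :=
  estimate_of_opAlpha_le hγ A ENNReal.toReal_nonneg (ENNReal.ofReal_toReal h).ge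

theorem le_normExp_iff {γ r : ℝ≥0∞} : γ ≤ normExp r ↔ r = 0 ∨ γ ≤ r := by
  unfold normExp
  split_ifs with h <;> simp [h]

theorem Admissible.one_lt {p r : ℝ≥0∞} (h : Admissible p r) (hr : r ≠ 0) : 1 < r := by
  rcases h with ⟨h, -⟩ | ⟨-, -, h, -⟩
  · exact absurd h hr
  · exact h

variable {Λ : Type u} {X : Λ → Type u} [∀ l, NormedAddCommGroup (X l)] [∀ l, NormedSpace 𝕜 (X l)]
  {Y : Λ → Type u} [∀ l, NormedAddCommGroup (Y l)] [∀ l, NormedSpace 𝕜 (Y l)]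
  {p r : ℝ≥0∞} [Fact (p = 0 ∨ 1 ≤ p)] [Fact (r = 0 ∨ 1 ≤ r)]

theorem exists_tail_eq_empty (h : Admissible p r) (A : ∀ l, X l →L[𝕜] Y l)
    (hA : ∃ C : ℝ, ∀ l, ‖A l‖ ≤ C) {ξ : Ordinal.{u}} {γ : ℝ≥0∞} (hr0 : r ≠ 0) (hrγ : r < γ) {M : ℝ}
    (hest : Estimate (adjointBall (diagOp h A hA Set.univ)) ξ γ M) {ε : ℝ} (hε : 0 < ε) :
    ∃ S : Finset Λ, szlenkDerivatives ε (adjointBall (diagOp h A hA (S : Set Λ)ᶜ)) (ω ^ ξ) = ∅ := by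
  have hr1 := h.one_lt hr0
  by_contra! hne
  exact not_estimate_of_forall_tail h (Or.inr ⟨hr1.le, le_rfl, hr1, hrγ.trans_le le_top⟩) hr0 hr1 hrγ
    A hA hε hne M hest

/-- θ_{ξ,1} and the critical level of the derivative of order ω ^ ξ control each other: θ is at
least ε/8 if the ε-derivative is non-empty, and at most 2ε if it is empty. -/
theorem iInf_opTheta_eq_zero_iff (h : Admissible p r) (A : ∀ l, X l →L[𝕜] Y l)
    (hA : ∃ C : ℝ, ∀ l, ‖A l‖ ≤ C) {ξ : Ordinal.{u}} :
    (⨅ S : Finset Λ, opTheta (diagOp h A hA (S : Set Λ)ᶜ) ξ 1) = 0 ↔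
      ∀ ε : ℝ, 0 < ε → ∃ S : Finset Λ,
        szlenkDerivatives ε (adjointBall (diagOp h A hA (S : Set Λ)ᶜ)) (ω ^ ξ) = ∅ := by
  constructor
  · intro h0 ε hε
    by_contra! hne
    have : ENNReal.ofReal (ε / 8) ≤ 0 := by
      rw [← h0]
      exact le_iInf fun S => ofReal_le_opTheta _ hε (hne S)
    rw [ENNReal.ofReal_le_iff_le_toReal ENNReal.zero_ne_top, ENNReal.toReal_zero] at this
    linarith
  · intro hS
    refine le_antisymm (ENNReal.le_of_forall_pos_le_add fun ε hε _ => ?_) bot_le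
    obtain ⟨S, hS⟩ := hS (ε / 2) (by positivity)
    refine (iInf_le _ S).trans ((opTheta_le_of_szlenkDerivatives_eq_empty _ (by positivity) hS).trans ?_)
    rw [zero_add, mul_div_cancel₀ _ two_ne_zero, ENNReal.ofReal_coe_nnreal]

/-- All summands have estimates with constant 0, so γ ≤ r and r = 0 need only the uniform norm
bound. For γ > r, finiteness makes the tails small, hence α = 0, against the lower bound for the
Szlenk index of the sum. -/
theorem opAlpha_lt_top_iff_of_szlenk_le (h : Admissible p r) (A : ∀ l, X l →L[𝕜] Y l)
    (hA : ∃ C : ℝ, ∀ l, ‖A l‖ ≤ C) {ξ : Ordinal.{u}} {γ : ℝ≥0∞} (hγ : 1 ≤ γ)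
    (hD : ¬ opSzlenk (diagOp h A hA Set.univ) ≤ ((ω ^ ξ : Ordinal.{u}) : WithTop Ordinal.{u}))
    (hsz : ∀ l, opSzlenk (A l) ≤ ((ω ^ ξ : Ordinal.{u}) : WithTop Ordinal.{u})) :
    opAlpha (diagOp h A hA Set.univ) ξ γ < ∞ ↔ r = 0 ∨ γ ≤ r := by
  have hest : ∀ l, Estimate (adjointBall (A l)) ξ γ 0 := fun l => estimate_zero_iff.2 (hsz l)
  constructor
  · intro hlt
    by_contra! hcon
    obtain ⟨hr0, hrγ⟩ := hcon
    have hr : normExp r = r := if_neg hr0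
    have hr1 := h.one_lt hr0
    have hinv : γ⁻¹ < r⁻¹ := ENNReal.inv_lt_inv.2 hrγ
    have hs : 1 ≤ (r⁻¹ - γ⁻¹)⁻¹ := by
      rw [ENNReal.one_le_inv]
      exact tsub_le_self.trans (ENNReal.inv_le_one.2 hr1.le)
    have hs' : (r⁻¹ - γ⁻¹)⁻¹ ≠ ∞ := ENNReal.inv_ne_top.2 (tsub_pos_of_lt hinv).ne'
    have : Fact (1 ≤ (r⁻¹ - γ⁻¹)⁻¹) := ⟨hs⟩
    -- With β = 0 and B = 0 the bound says that α of the diagonal operator vanishes. The exponent s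
    -- = (1/r - 1/γ)⁻¹ is finite and at least 1.
    have h0 := opAlpha_diagOp_le_of_hoelder h A hA hγ hs hs' (hr.trans_le hrγ.le)
      (by rw [hr, inv_inv, add_tsub_cancel_of_le hinv.le]) (fun _ => le_rfl) hest (B := 0)
      (fun S => ellNorm_zero.le) fun ε hε => exists_tail_eq_empty h A hA hr0 hrγ
        (exists_estimate_of_opAlpha_ne_top _ hγ hlt.ne) hε
    refine hD (estimate_zero_iff.1 (?_ : Estimate _ ξ γ 0))
    have h1 := estimate_of_opAlpha_le hγ _ le_rfl h0
    rwa [mul_zero] at h1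
  · intro hr
    obtain ⟨C, hC⟩ := hA
    exact (opAlpha_diagOp_le h A ⟨C, hC⟩ hγ (le_normExp_iff.2 hr) (abs_nonneg C)
      (fun l => (hC l).trans (le_abs_self C)) le_rfl hest).trans_lt ENNReal.ofReal_lt_top

theorem opAlpha_lt_top_of_memEll (h : Admissible p r) (A : ∀ l, X l →L[𝕜] Y l)
    (hA : ∃ C : ℝ, ∀ l, ‖A l‖ ≤ C) {ξ : Ordinal.{u}} {γ : ℝ≥0∞} (hγ : 1 ≤ γ)
    (hγr : r = 0 ∨ γ ≤ r) (hmem : MemEll ∞ fun l => opAlpha (A l) ξ γ) :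
    opAlpha (diagOp h A hA Set.univ) ξ γ < ∞ := by
  obtain ⟨hfin, hmem⟩ := hmem
  obtain ⟨M, hM⟩ := memℓp_infty_iff.1 hmem
  have hest : ∀ l, Estimate (adjointBall (A l)) ξ γ (8 * |M|) := fun l => by
    refine estimate_of_opAlpha_le hγ (A l) (abs_nonneg M) ?_
    refine (ENNReal.ofReal_toReal (hfin l)).ge.trans ?_
    exact ENNReal.ofReal_le_ofReal
      ((le_abs_self _).trans ((hM ⟨l, rfl⟩).trans (le_abs_self M)))
  obtain ⟨C, hC⟩ := hA
  exact (opAlpha_diagOp_le h A ⟨C, hC⟩ hγ (le_normExp_iff.2 hγr) (abs_nonneg C)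
    (fun l => (hC l).trans (le_abs_self C)) (by positivity) hest).trans_lt ENNReal.ofReal_lt_top

theorem memEll_top_of_opAlpha_lt_top (h : Admissible p r) (A : ∀ l, X l →L[𝕜] Y l)
    (hA : ∃ C : ℝ, ∀ l, ‖A l‖ ≤ C) {ξ : Ordinal.{u}} {γ : ℝ≥0∞} (hγ : 1 ≤ γ)
    (hlt : opAlpha (diagOp h A hA Set.univ) ξ γ < ∞) : MemEll ∞ fun l => opAlpha (A l) ξ γ := by
  set M := 8 * (opAlpha (diagOp h A hA Set.univ) ξ γ).toReal with hM
  have hM0 : 0 ≤ M := by positivity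
  refine memEll_of_le (β := fun _ => M) (fun _ => hM0) (fun l => opAlpha_le_of_estimate hγ _ hM0
    (Estimate.of_diagOp h A hA (exists_estimate_of_opAlpha_ne_top _ hγ hlt.ne) l)) ?_
  exact memℓp_infty_iff.2 ⟨‖M‖, by rintro _ ⟨l, rfl⟩; exact le_rfl⟩

theorem opAlpha_lt_top_of_iInf_opTheta_eq_zero (h : Admissible p r) (A : ∀ l, X l →L[𝕜] Y l)
    (hA : ∃ C : ℝ, ∀ l, ‖A l‖ ≤ C) {ξ : Ordinal.{u}} {γ s : ℝ≥0∞} (hγ : 1 ≤ γ) (hr1 : 1 ≤ r)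
    (hrγ : r < γ) (hθ : (⨅ S : Finset Λ, opTheta (diagOp h A hA (S : Set Λ)ᶜ) ξ 1) = 0)
    (hs : γ⁻¹ + s⁻¹ = r⁻¹) (hmem : MemEll s fun l => opAlpha (A l) ξ γ) :
    opAlpha (diagOp h A hA Set.univ) ξ γ < ∞ := by
  have hr : normExp r = r := if_neg (zero_lt_one.trans_le hr1).ne'
  have hs1 : 1 ≤ s := by
    rw [← ENNReal.inv_le_one]
    exact (le_add_self.trans hs.le).trans (ENNReal.inv_le_one.2 hr1)
  have hs' : s ≠ ∞ := by
    rintro rfl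
    rw [ENNReal.inv_top, add_zero, inv_inj] at hs
    exact hrγ.ne' hs
  have : Fact (1 ≤ s) := ⟨hs1⟩
  obtain ⟨hfin, hmem⟩ := hmem
  obtain ⟨B, hB⟩ := (memℓp_iff_ellNorm _).1 (hmem.const_smul (8 : ℝ))
  exact (opAlpha_diagOp_le_of_hoelder h A hA hγ hs1 hs' (hr.trans_le hrγ.le) (by rw [hr, hs])
    (β := fun l => 8 * (opAlpha (A l) ξ γ).toReal) (B := B) (fun l => by positivity)
    (fun l => exists_estimate_of_opAlpha_ne_top (A l) hγ (hfin l)) hB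
    ((iInf_opTheta_eq_zero_iff h A hA).1 hθ)).trans_lt ENNReal.ofReal_lt_top

/-- The best constants in the estimates, not the numbers α themselves, are shown to be in ℓ_s; they
dominate α. -/
theorem exists_memEll_of_opAlpha_lt_top (h : Admissible p r) (A : ∀ l, X l →L[𝕜] Y l)
    (hA : ∃ C : ℝ, ∀ l, ‖A l‖ ≤ C) {ξ : Ordinal.{u}} {γ : ℝ≥0∞} (hγ : 1 ≤ γ) (hr0 : r ≠ 0)
    (hrγ : r < γ) (hlt : opAlpha (diagOp h A hA Set.univ) ξ γ < ∞) :
    ∃ s : ℝ≥0∞, γ⁻¹ + s⁻¹ = r⁻¹ ∧ MemEll s fun l => opAlpha (A l) ξ γ := by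
  have hr : normExp r = r := if_neg hr0
  have hr1 := h.one_lt hr0
  have hinv : γ⁻¹ < r⁻¹ := ENNReal.inv_lt_inv.2 hrγ
  have hs : 1 ≤ (r⁻¹ - γ⁻¹)⁻¹ := by
    rw [ENNReal.one_le_inv]
    exact tsub_le_self.trans (ENNReal.inv_le_one.2 hr1.le)
  have hs' : (r⁻¹ - γ⁻¹)⁻¹ ≠ ∞ := ENNReal.inv_ne_top.2 (tsub_pos_of_lt hinv).ne'
  have hsum : γ⁻¹ + (r⁻¹ - γ⁻¹)⁻¹⁻¹ = r⁻¹ := by rw [inv_inv, add_tsub_cancel_of_le hinv.le]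
  have : Fact (1 ≤ (r⁻¹ - γ⁻¹)⁻¹) := ⟨hs⟩
  obtain ⟨β, hβ, hest, hmem⟩ := exists_memℓp_of_estimate h A hA hγ hs hs' (hr1.trans_eq hr.symm)
    (hr.trans_ne (hrγ.trans_le le_top).ne) (hsum.trans (by rw [hr])) (by positivity)
    (exists_estimate_of_opAlpha_ne_top _ hγ hlt.ne)
  exact ⟨_, hsum, memEll_of_le hβ (fun l => opAlpha_le_of_estimate hγ _ (hβ l) (hest l)) hmem⟩

end Main

end SzlenkSums

theorem mainTheorem10 {𝕜 : Type*} [RCLike 𝕜] {Λ : Type u} {X Y : Λ → Type u}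
    [∀ l, NormedAddCommGroup (X l)] [∀ l, NormedSpace 𝕜 (X l)] [∀ l, CompleteSpace (X l)]
    [∀ l, NormedAddCommGroup (Y l)] [∀ l, NormedSpace 𝕜 (Y l)] [∀ l, CompleteSpace (Y l)]
    (A : ∀ l, X l →L[𝕜] Y l) (hA : ∃ C : ℝ, ∀ l, ‖A l‖ ≤ C)
    (p r : ℝ≥0∞) [Fact (p = 0 ∨ 1 ≤ p)] [Fact (r = 0 ∨ 1 ≤ r)]
    (hpr : SzlenkSums.Admissible p r)
    (γ : ℝ≥0∞) (hγ : 1 ≤ γ) (ξ ζ : Ordinal.{u})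
    (hD : SzlenkSums.opSzlenk (SzlenkSums.diagOp hpr A hA Set.univ) =
      ((ω ^ (ξ + 1) : Ordinal.{u}) : WithTop Ordinal.{u}))
    (hsup : (⨆ l, SzlenkSums.opSzlenk (A l)) = ((ω ^ ζ : Ordinal.{u}) : WithTop Ordinal.{u})) :
    (ζ = ξ →
      (SzlenkSums.opAlpha (SzlenkSums.diagOp hpr A hA Set.univ) ξ γ < ∞ ↔ r = 0 ∨ γ ≤ r)) ∧
    (ζ = ξ + 1 →
      (SzlenkSums.opAlpha (SzlenkSums.diagOp hpr A hA Set.univ) ξ γ < ∞ ↔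
        (r = 0 ∧ SzlenkSums.MemEll ∞ (fun l => SzlenkSums.opAlpha (A l) ξ γ)) ∨
        (γ ≤ r ∧ SzlenkSums.MemEll ∞ (fun l => SzlenkSums.opAlpha (A l) ξ γ)) ∨
        (1 ≤ r ∧ r < γ ∧
          (⨅ S : Finset Λ,
            SzlenkSums.opTheta (SzlenkSums.diagOp hpr A hA ((S : Set Λ)ᶜ)) ξ 1) = 0 ∧
          ∃ s : ℝ≥0∞, γ⁻¹ + s⁻¹ = r⁻¹ ∧
            SzlenkSums.MemEll s (fun l => SzlenkSums.opAlpha (A l) ξ γ)))) := by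
  have hle : ∀ l, SzlenkSums.opSzlenk (A l) ≤ ((ω ^ ζ : Ordinal.{u}) : WithTop Ordinal.{u}) :=
    fun l => (le_iSup _ l).trans hsup.le
  refine ⟨?_, fun _ => ⟨fun hlt => ?_, ?_⟩⟩
  · rintro rfl
    refine SzlenkSums.opAlpha_lt_top_iff_of_szlenk_le hpr A hA hγ (fun hcon => ?_) hle
    rw [hD, WithTop.coe_le_coe, opow_le_opow_iff_right one_lt_omega0] at hcon
    exact hcon.not_gt (lt_add_one ζ)
  · have hmem := SzlenkSums.memEll_top_of_opAlpha_lt_top hpr A hA hγ hlt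
    rcases eq_or_ne r 0 with hr0 | hr0
    · exact Or.inl ⟨hr0, hmem⟩
    rcases le_or_gt γ r with hγr | hrγ
    · exact Or.inr (Or.inl ⟨hγr, hmem⟩)
    -- The condition on θ is necessary because an estimate with an exponent above r forces the tails
    -- to be small.
    · refine Or.inr (Or.inr ⟨(hpr.one_lt hr0).le, hrγ, ?_,
        SzlenkSums.exists_memEll_of_opAlpha_lt_top hpr A hA hγ hr0 hrγ hlt⟩)
      exact (SzlenkSums.iInf_opTheta_eq_zero_iff hpr A hA).2 fun ε hε =>
        SzlenkSums.exists_tail_eq_empty hpr A hA hr0 hrγ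
          (SzlenkSums.exists_estimate_of_opAlpha_ne_top _ hγ hlt.ne) hε
  · rintro (⟨hr, hmem⟩ | ⟨hr, hmem⟩ | ⟨hr1, hrγ, hθ, s, hs, hmem⟩)
    · exact SzlenkSums.opAlpha_lt_top_of_memEll hpr A hA hγ (Or.inl hr) hmem
    · exact SzlenkSums.opAlpha_lt_top_of_memEll hpr A hA hγ (Or.inr hr) hmem
    · exact SzlenkSums.opAlpha_lt_top_of_iInf_opTheta_eq_zero hpr A hA hγ hr1 hrγ hθ hs hmem
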